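/- Let $d,t\ge 2$ be integers. A system of affine-linear forms $\Psi=(\psi_1,\dots,\psi_t):\mathbb Z^d\to\mathbb Z^t$ has linear coefficients $\dot\psi_i(e_j)\in\mathbb Z$ and constant coefficients $\psi_i(0)\in\mathbb Z$. For a prime $p$ put $\Lambda_p(b)=\frac{p}{p-1}$ if $p\nmid b$ and $\Lambda_p(b)=0$ otherwise, and let $$\beta_p=\frac1{p^d}\sum_{a\in(\mathbb Z/p\mathbb Z)^d}\ \prod_{i=1}^t\Lambda_p(\psi_i(a)).$$ Call $\Psi$ \emph{admissible} if no $\psi_i$ is of the form $\lambda\psi_j+\mu$ with $j\ne i$ and $\lambda,\mu\in\mathbb Q$, and $\beta_p\neq0$ for every prime $p$. Let $P_\Psi$ be the set of exceptional primes, i.e. the primes $p$ such that, modulo $p$, some $\psi_i$ is of the form $\lambda\psi_j+\mu$ with $j\neq i$ and $\lambda,\mu\in\mathbb Z/p\mathbb Z$. For real $Z>1$ and $B>0$ let $$\|\Psi\|_{Z,B}=\frac1{\log^BZ}\Big(\sum_{i}\Big|\frac{\psi_i(0)}Z\Big|+\sum_{i,j}|\dot\psi_i(e_j)|\Big).$$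 For a smooth function $\chi:\mathbb R\to\mathbb R$ of bounded support and $R>1$ let $$\Lambda_{\chi,R}(n)=\log R\,\Big(\sum_{m\mid n}\mu(m)\,\chi\Big(\frac{\log m}{\log R}\Big)\Big)^2\qquad(n\in\mathbb Z),$$ the sum being over positive divisors $m$ of $n$ (all positive integers if $n=0$), and let $c_\chi=\int_0^\infty\chi'(x)^2\,dx$. Write $[Z]=\{n\in\mathbb Z:1\le n\le Z\}$. (a) For all $B,L>0$ there are constants $C,Z_0$, depending only on $d,t,B,L$, such that for every $Z\ge Z_0$ and every admissible $\Psi$ with $\|\Psi\|_{Z,B}\le L$ the set $P_\Psi$ is finite and $\sum_{p\in P_\Psi}p^{-1/2}\le C\sqrt{\log\log Z}$. (b) For every $S>0$ there is $\gamma_0=\gamma_0(d,t,S)>0$ with the following property. Let $0<\gamma<\gamma_0$, let $\chi$ be smooth and supported on $[-S,S]$ with $\chi(0)=1$, and let $A,B,L>0$. Let $N\to\infty$, put $R=N^\gamma$, and let $Z$ be real with $N\log^{-A}N\le Z\le N\log^AN$. Then, for $N$ large enough, for every admissible $\Psi$ with $\|\Psi\|_{Z,B}\le L$ the product $\prod_p\beta_p$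 converges (unconditionally) to a positive real number, and $$\sum_{n\in[Z]^d}\ \prod_{i=1}^t\Lambda_{\chi,R}(\psi_i(n))=c_\chi^{\,t}\,Z^d\prod_p\beta_p\,(1+o(1)),$$ where the $o(1)$ is as $N\to\infty$, uniformly in $\Psi$ and $Z$, for fixed $d,t,S,\gamma,\chi,A,B,L$. In particular, if $c_\chi=1$, the right-hand side is $Z^d\prod_p\beta_p(1+o(1))$. -/

import Mathlib

open scoped ContDiff

noncomputable section

/-- A system `Ψ = (ψ₁, …, ψ_t) : ℤ^d → ℤ^t` of affine-linear forms, given by its linear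
coefficients `lin i j = ψ̇_i(e_j)` and its constant coefficients `const i = ψ_i(0)`. -/
structure AffineSystem (d t : ℕ) where
  lin : Fin t → Fin d → ℤ
  const : Fin t → ℤ

namespace AffineSystem

variable {d t : ℕ}

/-- The form `ψ_i` read over a commutative ring `K`: for `K = ℤ` it is `ψ_i` itself, for
`K = ZMod p` its reduction modulo `p`. -/
def form (Ψ : AffineSystem d t) (K : Type*) [CommRing K] (i : Fin t) (n : Fin d → K) : K :=
  ∑ j, (Ψ.lin i j : K) * n j + (Ψ.const i : K)

/-- Over `K`, the form `ψ_i` lies in the affine-linear span of `ψ_j`. -/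
def InAffineSpan (Ψ : AffineSystem d t) (K : Type*) [CommRing K] (i j : Fin t) : Prop :=
  ∃ a b : K, ∀ n : Fin d → K, Ψ.form K i n = a * Ψ.form K j n + b

/-- No form is in the (rational) affine-linear span of another one. -/
def FiniteComplexity (Ψ : AffineSystem d t) : Prop :=
  ∀ i j : Fin t, i ≠ j → ¬ Ψ.InAffineSpan ℚ i j

/-- The size `‖Ψ‖_{N,B}` of the system at scale `(N, B)`. -/
def size (Ψ : AffineSystem d t) (N B : ℝ) : ℝ :=
  1 / Real.log N ^ B *
    (∑ i, |(Ψ.const i : ℝ) / N| + ∑ i, ∑ j, |(Ψ.lin i j : ℝ)|)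

/-- The primes modulo which some form is in the affine-linear span of another one. -/
def exceptionalPrimes (Ψ : AffineSystem d t) : Set ℕ :=
  {p | p.Prime ∧ ∃ i j : Fin t, i ≠ j ∧ Ψ.InAffineSpan (ZMod p) i j}

end AffineSystem

open Classical in
/-- `Λ_q(b) = (q / φ(q)) 1_{(b, q) = 1}` for a residue class `b` modulo `q`. -/
def localVonMangoldt (q : ℕ) (b : ZMod q) : ℝ :=
  if IsUnit b then (q : ℝ) / (Nat.totient q : ℝ) else 0

instance neZeroOfPrimes (p : Nat.Primes) : NeZero (p : ℕ) := ⟨p.2.ne_zero⟩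

namespace AffineSystem

variable {d t : ℕ}

/-- The local factor `β_p`, the average over `a ∈ (ℤ/pℤ)^d` of `∏_i Λ_p(ψ_i(a))`. -/
def localFactor (Ψ : AffineSystem d t) (p : Nat.Primes) : ℝ :=
  (∑ a : Fin d → ZMod (p : ℕ), ∏ i, localVonMangoldt p (Ψ.form (ZMod (p : ℕ)) i a)) /
    ((p : ℕ) : ℝ) ^ d

/-- Finite complexity and no vanishing local factor. -/
def Admissible (Ψ : AffineSystem d t) : Prop :=
  Ψ.FiniteComplexity ∧ ∀ p : Nat.Primes, Ψ.localFactor p ≠ 0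

end AffineSystem

/-- `Λ_{χ,R}(n) = log R (∑_{m ∣ n} μ(m) χ(log m / log R))²`, where `m` runs over the positive
divisors of the integer `n`. Every positive integer divides `0`; the sum is still finite when
`χ` has bounded support and `R > 1`. -/
def truncatedDivisorSum (χ : ℝ → ℝ) (R : ℝ) (n : ℤ) : ℝ :=
  Real.log R *
    (∑ᶠ m ∈ {m : ℕ | 0 < m ∧ (m : ℤ) ∣ n},
      (ArithmeticFunction.moebius m : ℝ) * χ (Real.log m / Real.log R)) ^ 2

/-- The box `[Z]^d`, where `[Z]` is the set of integers `1 ≤ n ≤ Z`. -/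
def intBox (d : ℕ) (Z : ℝ) : Finset (Fin d → ℤ) :=
  Fintype.piFinset fun _ => Finset.Icc 1 ⌊Z⌋

end

/-! ### Sums of `p^{-1/2}` over prime divisors -/

/-! Exceptional primes. A prime modulo which `ψ_i` is affinely dependent on `ψ_j` divides every 2×2
minor of their linear parts. Finite complexity provides a nonzero minor for each pair, of size at
most `2 L² log^{2B} Z`, so it has `O(log log Z)` prime factors. A sum of `n^{-1/2}` over `k`
distinct positive integers is at most `3 √k`, whence the bound in (a).

Correlations. Expanding the squares writes the left side as a sum over families of `2t` sets of
primes. The support of `χ` forces the product of the primes involved to be at most `R^{2tS}`, so the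
box is equidistributed modulo this product. The total error is about `Z^d R^{4tS} / Z` up to powers
of `log R`, which is negligible for `γ < 1/(8tS)` (`abs_sum_prod_truncatedDivisorSum_sub_le`). What
remains is `sieveMean`, an average over residues modulo a finite set `P` of primes. `P` may be taken
as large as convenient, since no error bound depends on it.

To evaluate this mean, write `χ(x) = ∫ φ(v) e^{-τx} dv` with `τ = 1 - 2πiv`. The divisor sums become
products over `p ∈ P` of `1 - 1_{p ∣ ψ_i} p^{-τ/ℓ}`, where `ℓ = log R`, and averaging over residues
factorises into local means. Each form contributes an Euler product close to `ζ(1 + (τ+τ')/ℓ) / (ζ(1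
+ τ/ℓ) ζ(1 + τ'/ℓ))`, which is `ℓ⁻¹ ττ'/(τ+τ')` to leading order by the simple pole of `ζ`.
Integrated against `φφ`, the factor `ττ'/(τ+τ')` yields `∫_0^∞ χ'²`, because `1/(τ+τ') = ∫_0^∞
e^{-(τ+τ')x} dx`. After removal of the Euler products there remain the twisted factors, which are `1
+ O(p^{-2})` off the exceptional primes and tend to `β_p` as the twists tend to 1.

The exceptional primes cost a factor `exp(O(1 + X))`, with `X` the sum in (a). Part (a) makes this
`exp(O(√(log log Z)))`, which is beaten by the saving `1/√(log R)`. Finally `∏ β_p` is bounded below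
in terms of `d` and `t` alone (`exists_prod_localFactor_ge`), and the constant `c_χ` is positive, so
the absolute error is also a relative one. -/

theorem sum_Icc_rpow_neg_half_le (k : ℕ) :
    ∑ n ∈ Finset.Icc 1 k, (n : ℝ) ^ (-(1 / 2) : ℝ) ≤ 2 * √k := by
  induction k with
  | zero => simp
  | succ k ih =>
    rw [Finset.sum_Icc_succ_top (by omega)]
    have h1 : ((k + 1 : ℕ) : ℝ) ^ (-(1 / 2) : ℝ) = 1 / √(k + 1 : ℕ) := by
      rw [Real.rpow_neg (by positivity), ← Real.sqrt_eq_rpow, one_div]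
    rw [h1]
    have hpos : 0 < √((k + 1 : ℕ) : ℝ) := Real.sqrt_pos.2 (by positivity)
    -- Telescoping inequality. Multiplied by `√(k+1)`, it is the nonnegativity of `(√(k+1) - √k)²`.
    have h2 : 1 / √((k + 1 : ℕ) : ℝ) ≤ 2 * √((k + 1 : ℕ) : ℝ) - 2 * √(k : ℝ) := by
      rw [div_le_iff₀ hpos]
      have e1 : √((k + 1 : ℕ) : ℝ) ^ 2 = k + 1 := by rw [Real.sq_sqrt (by positivity)]; simp
      have e2 : √(k : ℝ) ^ 2 = k := Real.sq_sqrt (by positivity)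
      nlinarith [sq_nonneg (√((k + 1 : ℕ) : ℝ) - √(k : ℝ))]
    linarith

/-- With `k` elements, those at most `k` contribute no more than the full sum over `1..k`, that is
`2√k`. Each of the others contributes at most `k^{-1/2}`, and there are at most `k` of them. -/
theorem sum_rpow_neg_half_le_sqrt_card (s : Finset ℕ) (hs : ∀ n ∈ s, 0 < n) :
    ∑ n ∈ s, (n : ℝ) ^ (-(1 / 2) : ℝ) ≤ 3 * √s.card := by
  rcases s.eq_empty_or_nonempty with rfl | hne
  · simp
  have hk : 0 < s.card := hne.card_pos
  rw [← Finset.sum_filter_add_sum_filter_not s (fun n => n ≤ s.card)]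
  have h1 : ∑ n ∈ s.filter (fun n => n ≤ s.card), (n : ℝ) ^ (-(1 / 2) : ℝ) ≤ 2 * √s.card := by
    refine le_trans (Finset.sum_le_sum_of_subset_of_nonneg ?_ ?_) (sum_Icc_rpow_neg_half_le _)
    · intro n hn
      rw [Finset.mem_filter] at hn
      exact Finset.mem_Icc.2 ⟨hs n hn.1, hn.2⟩
    · intros; positivity
  have h2 : ∑ n ∈ s.filter (fun n => ¬ n ≤ s.card), (n : ℝ) ^ (-(1 / 2) : ℝ) ≤ √s.card := by
    have hb : ∀ n ∈ s.filter (fun n => ¬ n ≤ s.card),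
        (n : ℝ) ^ (-(1 / 2) : ℝ) ≤ (s.card : ℝ) ^ (-(1 / 2) : ℝ) := by
      intro n hn
      rw [Finset.mem_filter] at hn
      exact Real.rpow_le_rpow_of_nonpos (by positivity) (by exact_mod_cast (by omega))
        (by norm_num)
    refine (Finset.sum_le_card_nsmul _ _ _ hb).trans ?_
    rw [nsmul_eq_mul]
    have hc : ((s.filter (fun n => ¬ n ≤ s.card)).card : ℝ) ≤ s.card := by
      exact_mod_cast Finset.card_filter_le _ _
    refine (mul_le_mul_of_nonneg_right hc (by positivity)).trans (le_of_eq ?_)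
    have hpos : (0 : ℝ) < s.card := by exact_mod_cast hk
    rw [Real.rpow_neg hpos.le, ← Real.sqrt_eq_rpow, ← div_eq_mul_inv, Real.div_sqrt]
  linarith

/-- The product of the prime factors divides `n`, so there are at most `log n / log 2 ≤ 2 log n` of
them. -/
theorem sum_primeFactors_rpow_neg_half_le (n : ℕ) (hn : n ≠ 0) :
    ∑ p ∈ n.primeFactors, (p : ℝ) ^ (-(1 / 2) : ℝ) ≤ 3 * √(2 * Real.log n) := by
  refine (sum_rpow_neg_half_le_sqrt_card _ fun p hp => (Nat.prime_of_mem_primeFactors hp).pos).trans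
    (mul_le_mul_of_nonneg_left (Real.sqrt_le_sqrt ?_) (by norm_num))
  have h1 : 2 ^ n.primeFactors.card ≤ n := by
    calc 2 ^ n.primeFactors.card ≤ ∏ p ∈ n.primeFactors, p := by
          rw [← Finset.prod_const]
          exact Finset.prod_le_prod' fun p hp => (Nat.prime_of_mem_primeFactors hp).two_le
      _ ≤ n := Nat.le_of_dvd (Nat.pos_of_ne_zero hn) (Nat.prod_primeFactors_dvd n)
  have h2 : Real.log ((2 : ℝ) ^ n.primeFactors.card) ≤ Real.log n :=
    Real.log_le_log (by positivity) (by exact_mod_cast h1)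
  rw [Real.log_pow] at h2
  nlinarith [Real.log_two_gt_d9, (Nat.cast_nonneg n.primeFactors.card : (0:ℝ) ≤ _)]

theorem sum_biUnion_le_sum_sum {α β : Type*} [DecidableEq β] (s : Finset α) (u : α → Finset β)
    (f : β → ℝ) (hf : ∀ b, 0 ≤ f b) : ∑ b ∈ s.biUnion u, f b ≤ ∑ a ∈ s, ∑ b ∈ u a, f b := by
  classical
  induction s using Finset.induction_on with
  | empty => simp
  | insert a s ha ih =>
    rw [Finset.biUnion_insert, Finset.sum_insert ha]
    have := Finset.sum_union_inter (s₁ := u a) (s₂ := s.biUnion u) (f := f)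
    have h0 : 0 ≤ ∑ b ∈ u a ∩ s.biUnion u, f b := Finset.sum_nonneg fun b _ => hf b
    linarith

/-! ### Minors and exceptional primes -/

namespace AffineSystem

variable {d t : ℕ}

/-- The minor of the linear parts of `ψ_i` and `ψ_j` in the columns `k`, `l`. -/
def minor (Ψ : AffineSystem d t) (i j : Fin t) (k l : Fin d) : ℤ :=
  Ψ.lin i k * Ψ.lin j l - Ψ.lin i l * Ψ.lin j k

theorem form_zero (Ψ : AffineSystem d t) (K : Type*) [CommRing K] (i : Fin t) :
    Ψ.form K i 0 = (Ψ.const i : K) := by simp [form]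

theorem form_single (Ψ : AffineSystem d t) (K : Type*) [CommRing K] (i : Fin t) (k : Fin d) :
    Ψ.form K i (Pi.single k 1) = (Ψ.lin i k : K) + (Ψ.const i : K) := by
  simp [form, Pi.single_apply]

theorem InAffineSpan.lin_eq {Ψ : AffineSystem d t} {K : Type*} [CommRing K] {i j : Fin t} {a b : K}
    (h : ∀ n : Fin d → K, Ψ.form K i n = a * Ψ.form K j n + b) (k : Fin d) :
    (Ψ.lin i k : K) = a * (Ψ.lin j k : K) := by
  have h0 := h 0
  have h1 := h (Pi.single k 1)
  rw [form_zero, form_zero] at h0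
  rw [form_single, form_single] at h1
  linear_combination h1 - h0

theorem InAffineSpan.minor_eq_zero {Ψ : AffineSystem d t} {K : Type*} [CommRing K] {i j : Fin t}
    (h : Ψ.InAffineSpan K i j) (k l : Fin d) : (Ψ.minor i j k l : K) = 0 := by
  obtain ⟨a, b, h⟩ := h
  have h1 := InAffineSpan.lin_eq h k
  have h2 := InAffineSpan.lin_eq h l
  simp only [minor, Int.cast_sub, Int.cast_mul, h1, h2]
  ring

theorem inAffineSpan_of_lin_eq {Ψ : AffineSystem d t} {K : Type*} [CommRing K] {i j : Fin t}
    (a : K) (h : ∀ k, (Ψ.lin i k : K) = a * (Ψ.lin j k : K)) : Ψ.InAffineSpan K i j := by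
  refine ⟨a, Ψ.const i - a * Ψ.const j, fun n => ?_⟩
  simp only [form, h, mul_add, Finset.mul_sum, mul_assoc]
  ring

/-- If all minors vanish, the linear parts are proportional, with the ratio read off in a column
where `ψ_j` is nonzero. If there is no such column, `ψ_j` is constant and lies in the span of `ψ_i`
with `λ = 0`; this is why both non-inclusions are needed. -/
theorem exists_minor_ne_zero {Ψ : AffineSystem d t} {K : Type*} [Field K] {i j : Fin t}
    (hij : ¬ Ψ.InAffineSpan K i j) (hji : ¬ Ψ.InAffineSpan K j i) :
    ∃ k l, (Ψ.minor i j k l : K) ≠ 0 := by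
  by_contra! hm
  have hl : ∃ l, (Ψ.lin j l : K) ≠ 0 := by
    by_contra! h
    exact hji (inAffineSpan_of_lin_eq 0 fun k => by simp [h])
  obtain ⟨l, hl⟩ := hl
  refine hij (inAffineSpan_of_lin_eq ((Ψ.lin i l : K) / Ψ.lin j l) fun k => ?_)
  have := hm k l
  simp only [minor, Int.cast_sub, Int.cast_mul] at this
  field_simp
  linear_combination this

theorem exceptionalPrimes_subset {Ψ : AffineSystem d t} {k l : Fin t → Fin t → Fin d}
    (h : ∀ i j, i ≠ j → Ψ.minor i j (k i j) (l i j) ≠ 0) :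
    Ψ.exceptionalPrimes ⊆ (Finset.univ.filter fun q : Fin t × Fin t => q.1 ≠ q.2).biUnion
      fun q => (Ψ.minor q.1 q.2 (k q.1 q.2) (l q.1 q.2)).natAbs.primeFactors := by
  rintro p ⟨hp, i, j, hij, hs⟩
  have h0 := hs.minor_eq_zero (k i j) (l i j)
  rw [ZMod.intCast_zmod_eq_zero_iff_dvd] at h0
  simp only [Finset.coe_biUnion, Finset.coe_filter, Finset.mem_univ, true_and, Set.mem_ofPred_eq,
    Set.mem_iUnion, Finset.mem_coe, Nat.mem_primeFactors]
  exact ⟨(i, j), hij, hp, Int.natCast_dvd.1 h0, Int.natAbs_ne_zero.2 (h i j hij)⟩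

theorem exists_minors {Ψ : AffineSystem d t} (hd : 0 < d) (h : Ψ.FiniteComplexity) :
    ∃ k l : Fin t → Fin t → Fin d, ∀ i j, i ≠ j → Ψ.minor i j (k i j) (l i j) ≠ 0 := by
  have H : ∀ i j : Fin t, ∃ kl : Fin d × Fin d, i ≠ j → Ψ.minor i j kl.1 kl.2 ≠ 0 := by
    intro i j
    by_cases hij : i = j
    -- Diagonal pairs carry no condition. The columns chosen here are dummies, and `0 < d` serves
    -- only to have some.
    · exact ⟨(⟨0, hd⟩, ⟨0, hd⟩), fun h => absurd hij h⟩
    · obtain ⟨k, l, hkl⟩ := exists_minor_ne_zero (h i j hij) (h j i (Ne.symm hij))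
      exact ⟨(k, l), fun _ h0 => hkl (by simp [h0])⟩
  choose kl hkl using H
  exact ⟨fun i j => (kl i j).1, fun i j => (kl i j).2, hkl⟩

theorem abs_lin_le_of_size_le {Ψ : AffineSystem d t} {Z B L : ℝ} (hZ : 1 < Z)
    (h : Ψ.size Z B ≤ L) (i : Fin t) (j : Fin d) : |(Ψ.lin i j : ℝ)| ≤ L * Real.log Z ^ B := by
  have hl : 0 < Real.log Z ^ B := Real.rpow_pos_of_pos (Real.log_pos hZ) _
  rw [size, one_div, inv_mul_le_iff₀ hl, mul_comm] at h
  refine le_trans ?_ h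
  have h1 : |(Ψ.lin i j : ℝ)| ≤ ∑ i, ∑ j, |(Ψ.lin i j : ℝ)| :=
    (Finset.single_le_sum (f := fun j => |(Ψ.lin i j : ℝ)|) (fun _ _ => abs_nonneg _)
      (Finset.mem_univ j)).trans
      (Finset.single_le_sum (f := fun i => ∑ j, |(Ψ.lin i j : ℝ)|)
        (fun _ _ => Finset.sum_nonneg fun _ _ => abs_nonneg _) (Finset.mem_univ i))
  have h2 : 0 ≤ ∑ i, |(Ψ.const i : ℝ) / Z| := Finset.sum_nonneg fun _ _ => abs_nonneg _
  linarith

theorem exceptionalPrimes_finite {Ψ : AffineSystem d t} (hd : 0 < d) (h : Ψ.FiniteComplexity) :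
    Ψ.exceptionalPrimes.Finite := by
  obtain ⟨k, l, hkl⟩ := exists_minors hd h
  exact (Finset.finite_toSet _).subset (exceptionalPrimes_subset hkl)

theorem exceptionalPrimes_sum_le (d t : ℕ) (hd : 0 < d) (B L : ℝ) (hB : 0 < B) (hL : 0 < L) :
    ∃ C Z₀ : ℝ, 0 < C ∧ ∀ Z : ℝ, Z₀ ≤ Z →
      ∀ Ψ : AffineSystem d t, Ψ.FiniteComplexity → Ψ.size Z B ≤ L →
        ∑' p : Ψ.exceptionalPrimes, ((p : ℕ) : ℝ) ^ (-(1 / 2) : ℝ) ≤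
          C * √(Real.log (Real.log Z)) := by
  set C₁ : ℝ := |Real.log (2 * L ^ 2)| + 2 * B with hC₁
  -- For `Z ≥ e^e` one has `log log Z ≥ 1`, which lets `|log (2L²)|` be absorbed into `C₁ log log
  -- Z`. The factor `t * t` bounds the number of pairs, and the summand `1` only secures positivity.
  refine ⟨(t * t : ℕ) * (3 * √(2 * C₁)) + 1, Real.exp (Real.exp 1), by positivity,
    fun Z hZ Ψ hΨ hs => ?_⟩
  have hZ1 : 1 < Z := lt_of_lt_of_le (Real.one_lt_exp_iff.2 (Real.exp_pos 1)) hZ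
  have hlZ : Real.exp 1 ≤ Real.log Z := (Real.le_log_iff_exp_le (by linarith)).2 hZ
  have hlZ0 : 0 < Real.log Z := (Real.exp_pos 1).trans_le hlZ
  have hllZ : 1 ≤ Real.log (Real.log Z) := (Real.le_log_iff_exp_le hlZ0).2 hlZ
  obtain ⟨k, l, hkl⟩ := exists_minors hd hΨ
  set U := (Finset.univ.filter fun q : Fin t × Fin t => q.1 ≠ q.2).biUnion
      fun q => (Ψ.minor q.1 q.2 (k q.1 q.2) (l q.1 q.2)).natAbs.primeFactors with hU
  have hsub : Ψ.exceptionalPrimes ⊆ U := exceptionalPrimes_subset hkl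
  have hfin := exceptionalPrimes_finite hd hΨ
  have hpair : ∀ q ∈ Finset.univ.filter fun q : Fin t × Fin t => q.1 ≠ q.2,
      ∑ p ∈ (Ψ.minor q.1 q.2 (k q.1 q.2) (l q.1 q.2)).natAbs.primeFactors,
        (p : ℝ) ^ (-(1 / 2) : ℝ) ≤ 3 * √(2 * C₁) * √(Real.log (Real.log Z)) := by
    rintro ⟨i, j⟩ hij
    simp only [Finset.mem_filter, Finset.mem_univ, true_and] at hij
    set m := Ψ.minor i j (k i j) (l i j) with hm
    have hm0 : m ≠ 0 := hkl i j hij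
    refine (sum_primeFactors_rpow_neg_half_le _ (Int.natAbs_ne_zero.2 hm0)).trans ?_
    rw [mul_assoc, ← Real.sqrt_mul (by positivity), mul_assoc]
    refine mul_le_mul_of_nonneg_left (Real.sqrt_le_sqrt ?_) (by norm_num)
    refine mul_le_mul_of_nonneg_left ?_ (by norm_num)
    have hbd : ((m.natAbs : ℕ) : ℝ) ≤ 2 * L ^ 2 * (Real.log Z ^ B) ^ 2 := by
      rw [Nat.cast_natAbs, Int.cast_abs, hm, minor]
      push_cast
      have b := abs_lin_le_of_size_le hZ1 hs
      calc |(Ψ.lin i (k i j) : ℝ) * Ψ.lin j (l i j) - Ψ.lin i (l i j) * Ψ.lin j (k i j)|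
          ≤ |(Ψ.lin i (k i j) : ℝ)| * |(Ψ.lin j (l i j) : ℝ)|
            + |(Ψ.lin i (l i j) : ℝ)| * |(Ψ.lin j (k i j) : ℝ)| := by
            rw [← abs_mul, ← abs_mul]; exact abs_sub _ _
        _ ≤ (L * Real.log Z ^ B) * (L * Real.log Z ^ B)
            + (L * Real.log Z ^ B) * (L * Real.log Z ^ B) := by
            gcongr <;> exact b _ _
        _ = _ := by ring
    have hlog : Real.log (m.natAbs : ℕ) ≤
        Real.log (2 * L ^ 2) + 2 * B * Real.log (Real.log Z) := by
      refine (Real.log_le_log (by exact_mod_cast Int.natAbs_pos.2 hm0) hbd).trans (le_of_eq ?_)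
      rw [Real.log_mul (by positivity) (by positivity), Real.log_pow, Real.log_rpow hlZ0]
      push_cast; ring
    refine hlog.trans ?_
    rw [hC₁, add_mul]
    have := le_abs_self (Real.log (2 * L ^ 2))
    nlinarith [abs_nonneg (Real.log (2 * L ^ 2))]
  have h1 : ∑' p : Ψ.exceptionalPrimes, ((p : ℕ) : ℝ) ^ (-(1 / 2) : ℝ) ≤
      ∑ p ∈ U, (p : ℝ) ^ (-(1 / 2) : ℝ) := by
    have he : ∑' p : Ψ.exceptionalPrimes, ((p : ℕ) : ℝ) ^ (-(1 / 2) : ℝ) =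
        ∑ p ∈ hfin.toFinset, (p : ℝ) ^ (-(1 / 2) : ℝ) := by
      rw [← Finset.tsum_subtype', hfin.coe_toFinset]
    rw [he]
    exact Finset.sum_le_sum_of_subset_of_nonneg
      (fun p hp => hsub (hfin.mem_toFinset.1 hp)) fun _ _ _ => by positivity
  have h2 : ∑ p ∈ U, (p : ℝ) ^ (-(1 / 2) : ℝ) ≤
      ∑ q ∈ Finset.univ.filter fun q : Fin t × Fin t => q.1 ≠ q.2,
        3 * √(2 * C₁) * √(Real.log (Real.log Z)) := by
    exact le_trans (sum_biUnion_le_sum_sum _ _ _ fun _ => by positivity) (Finset.sum_le_sum hpair)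
  refine h1.trans (h2.trans ?_)
  rw [Finset.sum_const, nsmul_eq_mul]
  have hc : ((Finset.univ.filter fun q : Fin t × Fin t => q.1 ≠ q.2).card : ℝ) ≤ (t * t : ℕ) := by
    have := Finset.card_filter_le (Finset.univ : Finset (Fin t × Fin t)) (fun q => q.1 ≠ q.2)
    simp only [Finset.card_univ, Fintype.card_prod, Fintype.card_fin] at this
    exact_mod_cast this
  have h3 : 0 ≤ 3 * √(2 * C₁) * √(Real.log (Real.log Z)) := by positivity
  nlinarith [mul_le_mul_of_nonneg_right hc h3, Real.sqrt_nonneg (Real.log (Real.log Z))]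

end AffineSystem

/-! ### Elementary estimates for finite products -/

theorem norm_prod_le_prod_of_le {ι 𝕜 : Type*} [NormedField 𝕜] (s : Finset ι) {a : ι → 𝕜}
    {m : ι → ℝ} (ha : ∀ i ∈ s, ‖a i‖ ≤ m i) : ‖∏ i ∈ s, a i‖ ≤ ∏ i ∈ s, m i := by
  rw [norm_prod]
  exact Finset.prod_le_prod (fun _ _ => norm_nonneg _) ha

/-- Factors are exchanged one at a time; `1 ≤ m i` allows the full product of the `m i` to be used
in every term. -/
theorem norm_prod_sub_prod_le {ι 𝕜 : Type*} [NormedField 𝕜] (s : Finset ι) {a b : ι → 𝕜}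
    {m : ι → ℝ} (hm : ∀ i ∈ s, 1 ≤ m i) (ha : ∀ i ∈ s, ‖a i‖ ≤ m i) (hb : ∀ i ∈ s, ‖b i‖ ≤ m i) :
    ‖∏ i ∈ s, a i - ∏ i ∈ s, b i‖ ≤ (∏ i ∈ s, m i) * ∑ i ∈ s, ‖a i - b i‖ := by
  classical
  induction s using Finset.induction_on with
  | empty => simp
  | insert j s hj ih =>
    simp only [Finset.forall_mem_insert] at hm ha hb
    rw [Finset.prod_insert hj, Finset.prod_insert hj, Finset.prod_insert hj, Finset.sum_insert hj]
    have ih' := ih hm.2 ha.2 hb.2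
    have e : a j * ∏ i ∈ s, a i - b j * ∏ i ∈ s, b i =
        (a j - b j) * ∏ i ∈ s, a i + b j * (∏ i ∈ s, a i - ∏ i ∈ s, b i) := by ring
    have h1 : ‖∏ i ∈ s, a i‖ ≤ ∏ i ∈ s, m i := norm_prod_le_prod_of_le s ha.2
    have h0 : 0 ≤ ∏ i ∈ s, m i := (norm_nonneg _).trans h1
    have hm0 : 0 ≤ m j := zero_le_one.trans hm.1
    rw [e]
    calc _ ≤ ‖a j - b j‖ * ‖∏ i ∈ s, a i‖ + ‖b j‖ * ‖∏ i ∈ s, a i - ∏ i ∈ s, b i‖ := by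
          rw [← norm_mul, ← norm_mul]; exact norm_add_le _ _
      _ ≤ ‖a j - b j‖ * (m j * ∏ i ∈ s, m i) +
          m j * ((∏ i ∈ s, m i) * ∑ i ∈ s, ‖a i - b i‖) := by
          gcongr
          · exact h1.trans (le_mul_of_one_le_left h0 hm.1)
          · exact hb.1
      _ = _ := by ring

theorem norm_prod_sub_prod_le_pow {ι 𝕜 : Type*} [NormedField 𝕜] [Fintype ι] {a b : ι → 𝕜}
    {M : ℝ} (hM : 1 ≤ M) (ha : ∀ i, ‖a i‖ ≤ M) (hb : ∀ i, ‖b i‖ ≤ M) :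
    ‖∏ i, a i - ∏ i, b i‖ ≤ M ^ Fintype.card ι * ∑ i, ‖a i - b i‖ := by
  simpa using norm_prod_sub_prod_le Finset.univ (m := fun _ => M) (fun _ _ => hM)
    (fun i _ => ha i) (fun i _ => hb i)

/-- Second order expansion by induction: a new factor adds the cross term `y_j (∏ - 1)`, of size `δ
· M^k k δ`, and `k² + k ≤ (k+1)²`. -/
theorem norm_prod_one_add_sub_one_sub_sum_le {ι 𝕜 : Type*} [NormedField 𝕜] (s : Finset ι)
    {y : ι → 𝕜} {δ M : ℝ} (hM : 1 + δ ≤ M) (hδ : 0 ≤ δ) (hy : ∀ i ∈ s, ‖y i‖ ≤ δ) :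
    ‖∏ i ∈ s, (1 + y i) - 1 - ∑ i ∈ s, y i‖ ≤ s.card ^ 2 * M ^ s.card * δ ^ 2 := by
  classical
  induction s using Finset.induction_on with
  | empty => simp
  | insert j s hj ih =>
    simp only [Finset.forall_mem_insert] at hy
    have ih' := ih hy.2
    have hM1 : 1 ≤ M := by linarith
    have h1 : ‖∏ i ∈ s, (1 + y i) - 1‖ ≤ M ^ s.card * (s.card * δ) := by
      have h := norm_prod_sub_prod_le s (a := fun i => 1 + y i) (b := fun _ => (1 : 𝕜))
        (m := fun _ => M) (fun _ _ => hM1)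
        (fun i hi => (norm_add_le _ _).trans (by rw [norm_one]; linarith [hy.2 i hi]))
        (fun i hi => by simpa using hM1)
      simp only [Finset.prod_const_one, Finset.prod_const, add_sub_cancel_left] at h
      refine h.trans (mul_le_mul_of_nonneg_left ?_ (by positivity))
      simpa using Finset.sum_le_card_nsmul s _ δ hy.2
    rw [Finset.prod_insert hj, Finset.sum_insert hj, Finset.card_insert_of_notMem hj]
    have e : (1 + y j) * ∏ i ∈ s, (1 + y i) - 1 - (y j + ∑ i ∈ s, y i) =
        (∏ i ∈ s, (1 + y i) - 1 - ∑ i ∈ s, y i) + y j * (∏ i ∈ s, (1 + y i) - 1) := by ring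
    rw [e]
    calc _ ≤ s.card ^ 2 * M ^ s.card * δ ^ 2 + δ * (M ^ s.card * (s.card * δ)) := by
          refine (norm_add_le _ _).trans (add_le_add ih' ?_)
          rw [norm_mul]
          exact mul_le_mul hy.1 h1 (norm_nonneg _) hδ
      _ = (s.card ^ 2 + s.card : ℝ) * M ^ s.card * δ ^ 2 := by ring
      _ ≤ ((s.card + 1 : ℕ) : ℝ) ^ 2 * M ^ (s.card + 1) * δ ^ 2 := by
          gcongr
          · push_cast; nlinarith [(Nat.cast_nonneg s.card : (0:ℝ) ≤ _)]
          · omega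

/-! ### Zeros of the forms modulo a prime -/

namespace AffineSystem

variable {d t : ℕ}

/-- The linear part of `ψ_i` over `K`. -/
def linHom (Ψ : AffineSystem d t) (K : Type*) [CommRing K] (i : Fin t) : (Fin d → K) →+ K where
  toFun n := ∑ j, (Ψ.lin i j : K) * n j
  map_zero' := by simp
  map_add' := by intros; simp [mul_add, Finset.sum_add_distrib]

theorem form_eq_zero_iff (Ψ : AffineSystem d t) (K : Type*) [CommRing K] (i : Fin t)
    (n : Fin d → K) : Ψ.form K i n = 0 ↔ Ψ.linHom K i n = -(Ψ.const i : K) := by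
  rw [eq_neg_iff_add_eq_zero]; rfl

theorem linHom_single (Ψ : AffineSystem d t) (K : Type*) [CommRing K] (i : Fin t) (k : Fin d)
    (c : K) : Ψ.linHom K i (Pi.single k c) = (Ψ.lin i k : K) * c := by
  simp [linHom, Pi.single_apply]

theorem card_fiber_mul_card {G H : Type*} [AddCommGroup G] [AddCommGroup H] [Fintype G]
    [Fintype H] [DecidableEq H] (f : G →+ H) (hf : Function.Surjective f) (h : H) :
    (Finset.univ.filter fun g => f g = h).card * Fintype.card H = Fintype.card G := by
  have h1 := Finset.card_eq_sum_card_fiberwise (f := f) (s := Finset.univ) (t := Finset.univ)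
    (fun _ _ => Finset.mem_coe.2 (Finset.mem_univ _))
  rw [← Finset.card_univ (α := G), h1, Finset.sum_congr rfl fun b _ =>
    AddMonoidHom.card_fiber_eq_of_mem_range f (hf b) (hf h), Finset.sum_const, Finset.card_univ,
    smul_eq_mul, mul_comm]

variable (p : ℕ) [Fact p.Prime]

/-- A nonzero linear form over a field is surjective, so all its fibres have the same size. The
count is kept multiplicative to avoid the exponent `d - 1`. -/
theorem card_zeros_mul (Ψ : AffineSystem d t) {i : Fin t} {k : Fin d}
    (h : (Ψ.lin i k : ZMod p) ≠ 0) :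
    (Finset.univ.filter fun a => Ψ.form (ZMod p) i a = 0).card * p = p ^ d := by
  have hs : Function.Surjective (Ψ.linHom (ZMod p) i) := fun y =>
    ⟨Pi.single k (y / Ψ.lin i k), by rw [linHom_single]; field_simp⟩
  have := card_fiber_mul_card _ hs (-(Ψ.const i : ZMod p))
  simpa [form_eq_zero_iff, ZMod.card] using this

theorem card_common_zeros_mul (Ψ : AffineSystem d t) {i j : Fin t} {k l : Fin d}
    (h : (Ψ.minor i j k l : ZMod p) ≠ 0) :
    (Finset.univ.filter fun a =>
      Ψ.form (ZMod p) i a = 0 ∧ Ψ.form (ZMod p) j a = 0).card * p ^ 2 = p ^ d := by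
  have hs : Function.Surjective ((Ψ.linHom (ZMod p) i).prod (Ψ.linHom (ZMod p) j)) := by
    rintro ⟨y, z⟩
    set m := (Ψ.minor i j k l : ZMod p) with hm
    -- Cramer's rule in the columns `k`, `l`: a nonzero minor makes the pair of linear parts
    -- surjective onto the plane.
    refine ⟨Pi.single k ((y * Ψ.lin j l - z * Ψ.lin i l) / m) +
      Pi.single l ((z * Ψ.lin i k - y * Ψ.lin j k) / m), ?_⟩
    simp only [AddMonoidHom.prod_apply, map_add, linHom_single, Prod.mk_add_mk,
      Prod.mk.injEq]
    constructor
    · field_simp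
      rw [hm, minor]; push_cast; ring
    · field_simp
      rw [hm, minor]; push_cast; ring
  have := card_fiber_mul_card _ hs (-(Ψ.const i : ZMod p), -(Ψ.const j : ZMod p))
  simpa [form_eq_zero_iff, ZMod.card, sq] using this

end AffineSystem

namespace AffineSystem

variable {d t : ℕ}

instance (p : Nat.Primes) : Fact (p : ℕ).Prime := ⟨p.2⟩

open Classical in
/-- The indicator function of the zeros of `ψ_i` over `K`. -/
noncomputable def zeroInd (Ψ : AffineSystem d t) (K : Type*) [CommRing K] (i : Fin t) (a : Fin d → K) :
    ℝ :=
  if Ψ.form K i a = 0 then 1 else 0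

theorem zeroInd_nonneg (Ψ : AffineSystem d t) (K : Type*) [CommRing K] (i : Fin t)
    (a : Fin d → K) : 0 ≤ Ψ.zeroInd K i a := by
  unfold zeroInd; split_ifs <;> norm_num

theorem zeroInd_le_one (Ψ : AffineSystem d t) (K : Type*) [CommRing K] (i : Fin t)
    (a : Fin d → K) : Ψ.zeroInd K i a ≤ 1 := by
  unfold zeroInd; split_ifs <;> norm_num

theorem sum_zeroInd_eq_card (Ψ : AffineSystem d t) (p : Nat.Primes) (i : Fin t) :
    ∑ a, Ψ.zeroInd (ZMod p) i a =
      ((Finset.univ.filter fun a => Ψ.form (ZMod p) i a = 0).card : ℝ) := by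
  rw [Finset.card_filter, Nat.cast_sum]
  refine Finset.sum_congr rfl fun a _ => ?_
  unfold zeroInd
  split_ifs <;> simp

theorem sum_zeroInd_mul_eq_card (Ψ : AffineSystem d t) (p : Nat.Primes) (i j : Fin t) :
    ∑ a, Ψ.zeroInd (ZMod p) i a * Ψ.zeroInd (ZMod p) j a =
      ((Finset.univ.filter fun a =>
        Ψ.form (ZMod p) i a = 0 ∧ Ψ.form (ZMod p) j a = 0).card : ℝ) := by
  rw [Finset.card_filter, Nat.cast_sum]
  refine Finset.sum_congr rfl fun a _ => ?_
  unfold zeroInd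
  split_ifs <;> simp_all

theorem localVonMangoldt_form (Ψ : AffineSystem d t) (p : Nat.Primes) (i : Fin t)
    (a : Fin d → ZMod p) :
    localVonMangoldt p (Ψ.form (ZMod p) i a) =
      (1 - Ψ.zeroInd (ZMod p) i a) * ((p : ℕ) / ((p : ℕ) - 1 : ℝ)) := by
  rw [localVonMangoldt, zeroInd, Nat.totient_prime p.2]
  simp only [isUnit_iff_ne_zero]
  split_ifs <;> simp_all [Nat.cast_sub p.2.one_le]

theorem localFactor_eq (Ψ : AffineSystem d t) (p : Nat.Primes) :
    Ψ.localFactor p = (∑ a, ∏ i, (1 - Ψ.zeroInd (ZMod p) i a)) / ((p : ℕ) : ℝ) ^ d *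
      ((p : ℕ) / ((p : ℕ) - 1 : ℝ)) ^ t := by
  simp only [localFactor, localVonMangoldt_form, Finset.prod_mul_distrib, Finset.prod_const,
    Finset.card_univ, Fintype.card_fin, ← Finset.sum_mul]
  ring

/-- A form that is nonconstant modulo `p` vanishes with density exactly `1/p`. A form that is
constant modulo `p` cannot be identically zero, for then `β_p` would vanish. Hence the bound also
holds at exceptional primes. -/
theorem sum_zeroInd_le {Ψ : AffineSystem d t} {p : Nat.Primes} (h : Ψ.localFactor p ≠ 0)
    (i : Fin t) : (∑ a, Ψ.zeroInd (ZMod p) i a) / ((p : ℕ) : ℝ) ^ d ≤ 1 / (p : ℕ) := by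
  have hp : (0 : ℝ) < (p : ℕ) := by exact_mod_cast p.2.pos
  rw [div_le_div_iff₀ (by positivity) hp, one_mul, sum_zeroInd_eq_card]
  by_cases hk : ∃ k, (Ψ.lin i k : ZMod p) ≠ 0
  · obtain ⟨k, hk⟩ := hk
    exact_mod_cast (card_zeros_mul p Ψ hk).le
  · push Not at hk
    have hc : (Ψ.const i : ZMod p) ≠ 0 := by
      intro hc
      refine h ?_
      rw [localFactor_eq, Finset.sum_eq_zero, zero_div, zero_mul]
      intro a _
      refine Finset.prod_eq_zero (Finset.mem_univ i) ?_
      simp [zeroInd, form, hk, hc]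
    have : (Finset.univ.filter fun a => Ψ.form (ZMod p) i a = 0) = ∅ := by
      ext a; simp [form, hk, hc]
    rw [this]
    simp only [Finset.card_empty, Nat.cast_zero, zero_mul]
    positivity

/-- Off the exceptional primes no form is constant modulo `p`: a constant form lies in the span of
any other form with `λ = 0`, and `2 ≤ t` supplies another one. -/
theorem sum_zeroInd_eq {Ψ : AffineSystem d t} (ht : 2 ≤ t) {p : Nat.Primes}
    (h : (p : ℕ) ∉ Ψ.exceptionalPrimes) (i : Fin t) :
    (∑ a, Ψ.zeroInd (ZMod p) i a) / ((p : ℕ) : ℝ) ^ d = 1 / (p : ℕ) := by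
  have hp : (0 : ℝ) < (p : ℕ) := by exact_mod_cast p.2.pos
  rw [div_eq_div_iff (by positivity) hp.ne', one_mul, sum_zeroInd_eq_card]
  have hk : ∃ k, (Ψ.lin i k : ZMod p) ≠ 0 := by
    by_contra! hk
    have : Nontrivial (Fin t) := Fin.nontrivial_iff_two_le.2 ht
    obtain ⟨j, hj⟩ := exists_ne i
    exact h ⟨p.2, i, j, hj.symm, inAffineSpan_of_lin_eq 0 fun k => by simp [hk]⟩
  obtain ⟨k, hk⟩ := hk
  exact_mod_cast card_zeros_mul p Ψ hk

/-- Two independent forms modulo `p` vanish together like independent events. This is the source of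
all `O(p^{-2})` bounds off the exceptional primes. -/
theorem sum_zeroInd_mul_eq {Ψ : AffineSystem d t} {p : Nat.Primes}
    (h : (p : ℕ) ∉ Ψ.exceptionalPrimes) {i j : Fin t} (hij : i ≠ j) :
    (∑ a, Ψ.zeroInd (ZMod p) i a * Ψ.zeroInd (ZMod p) j a) / ((p : ℕ) : ℝ) ^ d =
      1 / ((p : ℕ) : ℝ) ^ 2 := by
  have hp : (0 : ℝ) < (p : ℕ) := by exact_mod_cast p.2.pos
  rw [div_eq_div_iff (by positivity) (by positivity), one_mul, sum_zeroInd_mul_eq_card]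
  obtain ⟨k, l, hkl⟩ := exists_minor_ne_zero (Ψ := Ψ) (K := ZMod p)
    (fun hs => h ⟨p.2, i, j, hij, hs⟩) (fun hs => h ⟨p.2, j, i, hij.symm, hs⟩)
  exact_mod_cast card_common_zeros_mul p Ψ hkl

end AffineSystem

/-! ### The local factors of the twisted Euler product -/

/-- The Euler factor of `ζ(s) ζ(s') / ζ(s + s')`, with `x = 1 / p` and `u`, `u'` the twists. -/
noncomputable def eulerRatio (x u u' : ℂ) : ℂ :=
  (1 - u * u' * x) * ((1 - u * x)⁻¹ * (1 - u' * x)⁻¹)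

section EulerRatio

variable {x u u' : ℂ}

theorem one_half_le_norm_one_sub (hx : ‖x‖ ≤ 1 / 2) (hu : ‖u‖ ≤ 1) : 1 / 2 ≤ ‖1 - u * x‖ := by
  have h1 : ‖u * x‖ ≤ 1 / 2 := by
    rw [norm_mul]; nlinarith [norm_nonneg u, norm_nonneg x]
  have h2 := norm_sub_norm_le (1 : ℂ) (u * x)
  rw [norm_one] at h2
  linarith

theorem one_sub_mul_ne_zero (hx : ‖x‖ ≤ 1 / 2) (hu : ‖u‖ ≤ 1) : 1 - u * x ≠ 0 := by
  rw [← norm_pos_iff]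
  exact lt_of_lt_of_le (by norm_num) (one_half_le_norm_one_sub hx hu)

theorem norm_inv_one_sub_le (hx : ‖x‖ ≤ 1 / 2) (hu : ‖u‖ ≤ 1) : ‖(1 - u * x)⁻¹‖ ≤ 2 := by
  rw [norm_inv]
  exact (inv_anti₀ (by norm_num) (one_half_le_norm_one_sub hx hu)).trans (by norm_num)

theorem norm_add_sub_mul_le (hu : ‖u‖ ≤ 1) (hu' : ‖u'‖ ≤ 1) : ‖u + u' - u * u'‖ ≤ 3 := by
  have h1 : ‖u * u'‖ ≤ 1 := by rw [norm_mul]; exact mul_le_one₀ hu (norm_nonneg _) hu'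
  calc _ ≤ ‖u‖ + ‖u'‖ + ‖u * u'‖ := (norm_sub_le _ _).trans (by gcongr; exact norm_add_le _ _)
    _ ≤ 3 := by linarith

theorem eulerRatio_sub_one_eq (hx : ‖x‖ ≤ 1 / 2) (hu : ‖u‖ ≤ 1) (hu' : ‖u'‖ ≤ 1) :
    eulerRatio x u u' - 1 =
      x * ((u + u' - u * u') - u * u' * x) * ((1 - u * x)⁻¹ * (1 - u' * x)⁻¹) := by
  have h1 := one_sub_mul_ne_zero hx hu
  have h2 := one_sub_mul_ne_zero hx hu'
  rw [eulerRatio]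
  field_simp
  ring

theorem norm_eulerRatio_sub_one_le (hx : ‖x‖ ≤ 1 / 2) (hu : ‖u‖ ≤ 1) (hu' : ‖u'‖ ≤ 1) :
    ‖eulerRatio x u u' - 1‖ ≤ 16 * ‖x‖ := by
  rw [eulerRatio_sub_one_eq hx hu hu', norm_mul, norm_mul, norm_mul (1 - u * x)⁻¹]
  have h1 := norm_inv_one_sub_le hx hu
  have h2 := norm_inv_one_sub_le hx hu'
  have h3 := norm_add_sub_mul_le hu hu'
  have h4 : ‖u * u' * x‖ ≤ 1 := by
    rw [norm_mul, norm_mul]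
    exact mul_le_one₀ (mul_le_one₀ hu (norm_nonneg _) hu') (norm_nonneg _) (by linarith)
  have h5 : ‖(u + u' - u * u') - u * u' * x‖ ≤ 4 := (norm_sub_le _ _).trans (by linarith)
  calc _ ≤ ‖x‖ * 4 * (2 * 2) := by gcongr
    _ = _ := by ring

theorem norm_eulerRatio_le (hx : ‖x‖ ≤ 1 / 2) (hu : ‖u‖ ≤ 1) (hu' : ‖u'‖ ≤ 1) :
    ‖eulerRatio x u u'‖ ≤ 9 := by
  have h1 := norm_eulerRatio_sub_one_le hx hu hu'
  have h2 := norm_sub_norm_le (eulerRatio x u u') 1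
  rw [norm_one] at h2
  linarith

/-- The first order term `(u + u' - u u') x` is isolated because it cancels the first order term of
`localMean`. -/
theorem norm_eulerRatio_sub_one_sub_le (hx : ‖x‖ ≤ 1 / 2) (hu : ‖u‖ ≤ 1) (hu' : ‖u'‖ ≤ 1) :
    ‖eulerRatio x u u' - 1 - (u + u' - u * u') * x‖ ≤ 64 * ‖x‖ ^ 2 := by
  have h1 := one_sub_mul_ne_zero hx hu
  have h2 := one_sub_mul_ne_zero hx hu'
  have e : eulerRatio x u u' - 1 - (u + u' - u * u') * x =
      (x * x) * (-(u * u') + (u + u' - u * u') * (u + u' - u * u' * x)) *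
        ((1 - u * x)⁻¹ * (1 - u' * x)⁻¹) := by
    rw [eulerRatio]
    field_simp
    ring
  rw [e, norm_mul, norm_mul, norm_mul x, norm_mul (1 - u * x)⁻¹]
  have h1 := norm_inv_one_sub_le hx hu
  have h2 := norm_inv_one_sub_le hx hu'
  have h3 := norm_add_sub_mul_le hu hu'
  have h6 : ‖u * u'‖ ≤ 1 := by rw [norm_mul]; exact mul_le_one₀ hu (norm_nonneg _) hu'
  have h4 : ‖u * u' * x‖ ≤ 1 := by
    rw [norm_mul]; exact mul_le_one₀ h6 (norm_nonneg _) (by linarith)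
  have h5 : ‖u + u' - u * u' * x‖ ≤ 3 :=
    (norm_sub_le _ _).trans (by linarith [norm_add_le u u'])
  have h7 : ‖-(u * u') + (u + u' - u * u') * (u + u' - u * u' * x)‖ ≤ 16 := by
    refine (norm_add_le _ _).trans ?_
    rw [norm_neg, norm_mul (u + u' - u * u')]
    nlinarith [mul_le_mul h3 h5 (norm_nonneg _) (by norm_num)]
  calc _ ≤ ‖x‖ * ‖x‖ * 16 * (2 * 2) := by gcongr
    _ = _ := by ring

theorem norm_mul_sub_one_le (hu : ‖u‖ ≤ 1) : ‖u * u' - 1‖ ≤ ‖u - 1‖ + ‖u' - 1‖ := by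
  have e : u * u' - 1 = u * (u' - 1) + (u - 1) := by ring
  rw [e]
  refine (norm_add_le _ _).trans ?_
  rw [norm_mul]
  nlinarith [norm_nonneg (u' - 1)]

theorem norm_inv_one_sub_sub_le (hx : ‖x‖ ≤ 1 / 2) (hu : ‖u‖ ≤ 1) :
    ‖(1 - u * x)⁻¹ - (1 - 1 * x)⁻¹‖ ≤ 4 * ‖x‖ * ‖u - 1‖ := by
  have h1 := one_sub_mul_ne_zero hx hu
  have h2 := one_sub_mul_ne_zero hx (u := 1) (by simp)
  have e : (1 - u * x)⁻¹ - (1 - 1 * x)⁻¹ = x * (u - 1) * ((1 - u * x)⁻¹ * (1 - 1 * x)⁻¹) := by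
    rw [inv_sub_inv h1 h2, div_eq_mul_inv, mul_inv]
    ring
  rw [e, norm_mul, norm_mul, norm_mul (1 - u * x)⁻¹]
  have h1 := norm_inv_one_sub_le hx hu
  have h2 := norm_inv_one_sub_le hx (u := 1) (by simp)
  calc _ ≤ ‖x‖ * ‖u - 1‖ * (2 * 2) := by gcongr
    _ = _ := by ring

theorem norm_eulerRatio_sub_le (hx : ‖x‖ ≤ 1 / 2) (hu : ‖u‖ ≤ 1) (hu' : ‖u'‖ ≤ 1) :
    ‖eulerRatio x u u' - eulerRatio x 1 1‖ ≤ 24 * ‖x‖ * (‖u - 1‖ + ‖u' - 1‖) := by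
  have h1 := norm_inv_one_sub_le hx hu
  have h2 := norm_inv_one_sub_le hx hu'
  have h3 := norm_inv_one_sub_le hx (u := 1) (by simp)
  have d1 := norm_inv_one_sub_sub_le hx hu
  have d2 := norm_inv_one_sub_sub_le hx hu'
  have d3 := norm_mul_sub_one_le (u' := u') hu
  have h4 : ‖1 - 1 * 1 * x‖ ≤ 3 / 2 := by
    refine (norm_sub_le _ _).trans ?_
    simp only [mul_one, one_mul, norm_one]; linarith
  -- The product `u u'` in the numerator and then each of the two inverses are replaced by their
  -- values at `1`, one after the other; every difference carries a factor `x`.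
  have e : eulerRatio x u u' - eulerRatio x 1 1 =
      -(x * (u * u' - 1) * ((1 - u * x)⁻¹ * (1 - u' * x)⁻¹)) +
      ((1 - 1 * 1 * x) * (((1 - u * x)⁻¹ - (1 - 1 * x)⁻¹) * (1 - u' * x)⁻¹) +
      (1 - 1 * 1 * x) * ((1 - 1 * x)⁻¹ * ((1 - u' * x)⁻¹ - (1 - 1 * x)⁻¹))) := by
    rw [eulerRatio, eulerRatio]
    ring
  rw [e]
  calc _ ≤ ‖x‖ * (‖u - 1‖ + ‖u' - 1‖) * (2 * 2) +
        (3 / 2 * (4 * ‖x‖ * ‖u - 1‖ * 2) + 3 / 2 * (2 * (4 * ‖x‖ * ‖u' - 1‖))) := by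
        refine (norm_add_le _ _).trans (add_le_add ?_ ((norm_add_le _ _).trans (add_le_add ?_ ?_)))
        · rw [norm_neg, norm_mul, norm_mul, norm_mul (1 - u * x)⁻¹]
          gcongr
        · rw [norm_mul, norm_mul ((1 - u * x)⁻¹ - _)]
          gcongr
        · rw [norm_mul, norm_mul (1 - 1 * x)⁻¹]
          gcongr
    _ ≤ _ := by nlinarith [mul_nonneg (norm_nonneg x) (norm_nonneg (u - 1)),
                  mul_nonneg (norm_nonneg x) (norm_nonneg (u' - 1))]

end EulerRatio

/-! ### Local means and the twisted local factor -/

namespace AffineSystem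

variable {d t : ℕ}

/-- The mean over `(ℤ/pℤ)^d` of `∏_i (1 - w_i 1_{ψ_i = 0})`. -/
noncomputable def localMean (Ψ : AffineSystem d t) (p : Nat.Primes) (w : Fin t → ℂ) : ℂ :=
  (∑ a : Fin d → ZMod (p : ℕ), ∏ i, (1 - (Ψ.zeroInd (ZMod (p : ℕ)) i a : ℂ) * w i)) /
    ((p : ℕ) : ℂ) ^ d

/-- The local factor twisted by `u`, `u'`. -/
noncomputable def twistedFactor (Ψ : AffineSystem d t) (p : Nat.Primes) (u u' : Fin t → ℂ) : ℂ :=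
  Ψ.localMean p (fun i => u i + u' i - u i * u' i) * ∏ i, eulerRatio (1 / (p : ℕ)) (u i) (u' i)

theorem norm_zeroInd_mul_le (Ψ : AffineSystem d t) {K : Type*} [CommRing K] (i : Fin t)
    (a : Fin d → K) {w : ℂ} {c : ℝ} (hw : ‖w‖ ≤ c) : ‖(Ψ.zeroInd K i a : ℂ) * w‖ ≤ c := by
  rw [norm_mul, Complex.norm_real, Real.norm_of_nonneg (Ψ.zeroInd_nonneg K i a)]
  nlinarith [Ψ.zeroInd_nonneg K i a, Ψ.zeroInd_le_one K i a, norm_nonneg w]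

theorem norm_one_sub_zeroInd_mul_le (Ψ : AffineSystem d t) {K : Type*} [CommRing K] (i : Fin t)
    (a : Fin d → K) {w : ℂ} (hw : ‖w‖ ≤ 3) : ‖1 - (Ψ.zeroInd K i a : ℂ) * w‖ ≤ 4 := by
  refine (norm_sub_le _ _).trans ?_
  rw [norm_one]
  linarith [Ψ.norm_zeroInd_mul_le i a hw]

/-- The value of `w i` matters only where `ψ_i` vanishes, which has density at most `1/p`. The base
`4` bounds `|1 - w|` for `‖w‖ ≤ 3`. -/
theorem norm_localMean_sub_le {Ψ : AffineSystem d t} {p : Nat.Primes} (h : Ψ.localFactor p ≠ 0)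
    {w w' : Fin t → ℂ} (hw : ∀ i, ‖w i‖ ≤ 3) (hw' : ∀ i, ‖w' i‖ ≤ 3) :
    ‖Ψ.localMean p w - Ψ.localMean p w'‖ ≤ 4 ^ t * (∑ i, ‖w i - w' i‖) / (p : ℕ) := by
  have hp : (0 : ℝ) < (p : ℕ) := by exact_mod_cast p.2.pos
  rw [localMean, localMean, ← sub_div, ← Finset.sum_sub_distrib, norm_div, norm_pow,
    Complex.norm_natCast]
  have h1 : ∀ a : Fin d → ZMod (p : ℕ),
      ‖∏ i, (1 - (Ψ.zeroInd (ZMod (p : ℕ)) i a : ℂ) * w i) -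
        ∏ i, (1 - (Ψ.zeroInd (ZMod (p : ℕ)) i a : ℂ) * w' i)‖ ≤
      4 ^ t * ∑ i, Ψ.zeroInd (ZMod (p : ℕ)) i a * ‖w i - w' i‖ := by
    intro a
    have := norm_prod_sub_prod_le_pow (M := 4) (by norm_num)
      (fun i => Ψ.norm_one_sub_zeroInd_mul_le i a (hw i))
      (fun i => Ψ.norm_one_sub_zeroInd_mul_le i a (hw' i))
    rw [Fintype.card_fin] at this
    refine this.trans (le_of_eq ?_)
    congr 1
    refine Finset.sum_congr rfl fun i _ => ?_
    rw [sub_sub_sub_cancel_left, ← mul_sub, norm_mul, Complex.norm_real,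
      Real.norm_of_nonneg (Ψ.zeroInd_nonneg _ i a), norm_sub_rev]
  calc _ ≤ (∑ a : Fin d → ZMod (p : ℕ),
        4 ^ t * ∑ i, Ψ.zeroInd (ZMod (p : ℕ)) i a * ‖w i - w' i‖) / ((p : ℕ) : ℝ) ^ d := by
        gcongr
        exact (norm_sum_le _ _).trans (Finset.sum_le_sum fun a _ => h1 a)
    _ = 4 ^ t * ∑ i, ((∑ a, Ψ.zeroInd (ZMod (p : ℕ)) i a) / ((p : ℕ) : ℝ) ^ d) *
          ‖w i - w' i‖ := by
        rw [← Finset.mul_sum, Finset.sum_comm, mul_div_assoc, Finset.sum_div]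
        congr 1
        refine Finset.sum_congr rfl fun i _ => ?_
        rw [← Finset.sum_mul]; ring
    _ ≤ 4 ^ t * ∑ i, (1 / (p : ℕ)) * ‖w i - w' i‖ := by
        refine mul_le_mul_of_nonneg_left (Finset.sum_le_sum fun i _ => ?_) (by positivity)
        exact mul_le_mul_of_nonneg_right (sum_zeroInd_le h i) (norm_nonneg _)
    _ = _ := by rw [← Finset.mul_sum]; ring

theorem localMean_zero (Ψ : AffineSystem d t) (p : Nat.Primes) : Ψ.localMean p 0 = 1 := by
  have hp : ((p : ℕ) : ℂ) ≠ 0 := by exact_mod_cast p.2.ne_zero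
  simp [localMean, ZMod.card, hp]

/-- Where at most one form vanishes, the linear truncation of the product is exact. Elsewhere the
sum over pairs is at least `1`, and `4^t + 1 + 3t` bounds the three terms trivially. -/
theorem norm_prod_one_sub_zeroInd_sub_le (Ψ : AffineSystem d t) {K : Type*} [CommRing K]
    (a : Fin d → K) {w : Fin t → ℂ} (hw : ∀ i, ‖w i‖ ≤ 3) :
    ‖∏ i, (1 - (Ψ.zeroInd K i a : ℂ) * w i) - 1 + ∑ i, (Ψ.zeroInd K i a : ℂ) * w i‖ ≤
      (4 ^ t + 1 + t * 3) *
        ∑ q ∈ Finset.univ.filter (fun q : Fin t × Fin t => q.1 ≠ q.2),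
          Ψ.zeroInd K q.1 a * Ψ.zeroInd K q.2 a := by
  classical
  have hnn : ∀ q ∈ Finset.univ.filter (fun q : Fin t × Fin t => q.1 ≠ q.2),
      0 ≤ Ψ.zeroInd K q.1 a * Ψ.zeroInd K q.2 a := fun q _ =>
    mul_nonneg (Ψ.zeroInd_nonneg K _ a) (Ψ.zeroInd_nonneg K _ a)
  by_cases h : ∃ i j, i ≠ j ∧ Ψ.form K i a = 0 ∧ Ψ.form K j a = 0
  · obtain ⟨i, j, hij, hi, hj⟩ := h
    have h1 : (1 : ℝ) ≤ ∑ q ∈ Finset.univ.filter (fun q : Fin t × Fin t => q.1 ≠ q.2),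
          Ψ.zeroInd K q.1 a * Ψ.zeroInd K q.2 a := by
      refine le_trans (le_of_eq ?_) (Finset.single_le_sum hnn (a := (i, j)) (by simpa using hij))
      simp [zeroInd, hi, hj]
    refine le_trans ?_ (le_mul_of_one_le_right (by positivity) h1)
    refine (norm_add_le _ _).trans (add_le_add ((norm_sub_le _ _).trans (add_le_add ?_ ?_)) ?_)
    · refine (norm_prod_le_prod_of_le _ fun i _ =>
        Ψ.norm_one_sub_zeroInd_mul_le i a (hw i)).trans ?_
      simp
    · simp
    · refine (norm_sum_le _ _).trans
        ((Finset.sum_le_sum fun i _ => Ψ.norm_zeroInd_mul_le i a (hw i)).trans ?_)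
      simp
  · push Not at h
    refine le_trans (le_of_eq ?_) (mul_nonneg (by positivity) (Finset.sum_nonneg hnn))
    rw [norm_eq_zero]
    by_cases h0 : ∃ i, Ψ.form K i a = 0
    · obtain ⟨i, hi⟩ := h0
      have hj : ∀ j, j ≠ i → Ψ.zeroInd K j a = 0 := fun j hj => by
        simp [zeroInd, h i j (Ne.symm hj) hi]
      rw [Finset.prod_eq_single i (fun j _ hji => by simp [hj j hji]) (by simp),
        Finset.sum_eq_single i (fun j _ hji => by simp [hj j hji]) (by simp)]
      ring
    · push Not at h0
      simp [zeroInd, h0]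

theorem norm_localMean_sub_one_add_le {Ψ : AffineSystem d t} (ht : 2 ≤ t) {p : Nat.Primes}
    (h : (p : ℕ) ∉ Ψ.exceptionalPrimes) {w : Fin t → ℂ} (hw : ∀ i, ‖w i‖ ≤ 3) :
    ‖Ψ.localMean p w - 1 + ∑ i, w i * (1 / (p : ℕ))‖ ≤
      (4 ^ t + 1 + t * 3) * (t * t) * (1 / ((p : ℕ) : ℝ)) ^ 2 := by
  have hp : (0 : ℝ) < (p : ℕ) := by exact_mod_cast p.2.pos
  have hpc : ((p : ℕ) : ℂ) ≠ 0 := by exact_mod_cast p.2.ne_zero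
  have hone : ∀ i, (∑ a, (Ψ.zeroInd (ZMod (p : ℕ)) i a : ℂ)) / ((p : ℕ) : ℂ) ^ d = 1 / (p : ℕ) := by
    intro i
    have := congrArg (fun r : ℝ => (r : ℂ)) (sum_zeroInd_eq ht h i)
    push_cast at this
    exact this
  have e : Ψ.localMean p w - 1 + ∑ i, w i * (1 / (p : ℕ)) =
      (∑ a : Fin d → ZMod (p : ℕ), (∏ i, (1 - (Ψ.zeroInd (ZMod (p : ℕ)) i a : ℂ) * w i) - 1 +
        ∑ i, (Ψ.zeroInd (ZMod (p : ℕ)) i a : ℂ) * w i)) / ((p : ℕ) : ℂ) ^ d := by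
    rw [Finset.sum_add_distrib, Finset.sum_sub_distrib, add_div, sub_div, localMean]
    congr 1
    · congr 1
      simp [ZMod.card, hpc]
    · rw [Finset.sum_comm, Finset.sum_div]
      refine Finset.sum_congr rfl fun i _ => ?_
      rw [← Finset.sum_mul, ← hone i]; ring
  rw [e, norm_div, norm_pow, Complex.norm_natCast]
  calc _ ≤ (∑ a : Fin d → ZMod (p : ℕ), (4 ^ t + 1 + t * 3 : ℝ) *
        ∑ q ∈ Finset.univ.filter (fun q : Fin t × Fin t => q.1 ≠ q.2),
          Ψ.zeroInd (ZMod (p : ℕ)) q.1 a * Ψ.zeroInd (ZMod (p : ℕ)) q.2 a) /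
            ((p : ℕ) : ℝ) ^ d := by
        gcongr
        exact (norm_sum_le _ _).trans
          (Finset.sum_le_sum fun a _ => Ψ.norm_prod_one_sub_zeroInd_sub_le a hw)
    _ = (4 ^ t + 1 + t * 3 : ℝ) *
        ∑ q ∈ Finset.univ.filter (fun q : Fin t × Fin t => q.1 ≠ q.2), (1 / ((p : ℕ) : ℝ)) ^ 2 := by
        rw [← Finset.mul_sum, Finset.sum_comm, mul_div_assoc, Finset.sum_div]
        congr 1
        refine Finset.sum_congr rfl fun q hq => ?_
        rw [sum_zeroInd_mul_eq h (by simpa using hq), one_div_pow]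
    _ ≤ _ := by
        rw [Finset.sum_const, nsmul_eq_mul, ← mul_assoc]
        gcongr
        have := Finset.card_filter_le (Finset.univ : Finset (Fin t × Fin t)) (fun q => q.1 ≠ q.2)
        simp only [Finset.card_univ, Fintype.card_prod, Fintype.card_fin] at this
        exact_mod_cast this

/-- At trivial twists `w = 1`, and the Euler factor reduces to `(1 - 1/p)⁻¹ = p/(p-1)`, the
normalisation of `Λ_p`. -/
theorem twistedFactor_one (Ψ : AffineSystem d t) (p : Nat.Primes) :
    Ψ.twistedFactor p 1 1 = Ψ.localFactor p := by
  have hp : ((p : ℕ) : ℂ) ≠ 0 := by exact_mod_cast p.2.ne_zero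
  have hp1 : ((p : ℕ) : ℂ) - 1 ≠ 0 := by
    rw [sub_ne_zero]; exact_mod_cast p.2.one_lt.ne'
  have hE : eulerRatio (1 / (p : ℕ)) 1 1 = (p : ℕ) / ((p : ℕ) - 1) := by
    have h1 : (1 : ℂ) - 1 / (p : ℕ) ≠ 0 := by
      rw [one_sub_div hp]; exact div_ne_zero hp1 hp
    simp only [eulerRatio, one_mul]
    rw [mul_inv_cancel_left₀ h1, one_sub_div hp, inv_div]
  rw [twistedFactor, localMean, localFactor_eq]
  simp only [Pi.one_apply, hE, Finset.prod_const, Finset.card_univ, Fintype.card_fin, mul_one,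
    add_sub_cancel_right]
  push_cast
  rfl

end AffineSystem

/-! ### Bounds for the twisted local factors -/

namespace AffineSystem

variable {d t : ℕ}

theorem norm_one_div_prime_le (p : Nat.Primes) : ‖(1 / (p : ℕ) : ℂ)‖ ≤ 1 / 2 := by
  rw [norm_div, norm_one, Complex.norm_natCast]
  exact one_div_le_one_div_of_le (by norm_num) (by exact_mod_cast p.2.two_le)

theorem norm_one_div_prime (p : Nat.Primes) : ‖(1 / (p : ℕ) : ℂ)‖ = 1 / ((p : ℕ) : ℝ) := by
  rw [norm_div, norm_one, Complex.norm_natCast]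

theorem norm_localMean_le (Ψ : AffineSystem d t) (p : Nat.Primes) {w : Fin t → ℂ}
    (hw : ∀ i, ‖w i‖ ≤ 3) : ‖Ψ.localMean p w‖ ≤ 4 ^ t := by
  have hp : (0 : ℝ) < (p : ℕ) := by exact_mod_cast p.2.pos
  rw [localMean, norm_div, norm_pow, Complex.norm_natCast, div_le_iff₀ (by positivity)]
  refine (norm_sum_le _ _).trans ((Finset.sum_le_sum fun a _ => norm_prod_le_prod_of_le _ fun i _ =>
    Ψ.norm_one_sub_zeroInd_mul_le i a (hw i)).trans (le_of_eq ?_))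
  simp [ZMod.card, mul_comm]

section

variable (p : Nat.Primes) {u u' : Fin t → ℂ}

theorem norm_prod_eulerRatio_le (hu : ∀ i, ‖u i‖ ≤ 1)
    (hu' : ∀ i, ‖u' i‖ ≤ 1) : ‖∏ i, eulerRatio (1 / (p : ℕ)) (u i) (u' i)‖ ≤ 9 ^ t := by
  refine (norm_prod_le_prod_of_le _ fun i _ =>
    norm_eulerRatio_le (norm_one_div_prime_le p) (hu i) (hu' i)).trans (le_of_eq ?_)
  simp

theorem norm_prod_eulerRatio_sub_one_le (hu : ∀ i, ‖u i‖ ≤ 1)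
    (hu' : ∀ i, ‖u' i‖ ≤ 1) :
    ‖∏ i, eulerRatio (1 / (p : ℕ)) (u i) (u' i) - 1‖ ≤ 9 ^ t * (16 * t) * (1 / (p : ℕ)) := by
  have h := norm_prod_sub_prod_le_pow (M := 9) (by norm_num)
    (fun i => norm_eulerRatio_le (norm_one_div_prime_le p) (hu i) (hu' i))
    (b := fun _ : Fin t => (1 : ℂ)) (fun _ => by norm_num)
  rw [Finset.prod_const_one, Fintype.card_fin] at h
  refine h.trans ?_
  rw [mul_assoc]
  refine mul_le_mul_of_nonneg_left ?_ (by positivity)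
  refine (Finset.sum_le_sum fun i _ => norm_eulerRatio_sub_one_le (norm_one_div_prime_le p) (hu i)
    (hu' i)).trans (le_of_eq ?_)
  rw [norm_one_div_prime]
  simp
  ring

theorem norm_prod_eulerRatio_sub_le (hu : ∀ i, ‖u i‖ ≤ 1)
    (hu' : ∀ i, ‖u' i‖ ≤ 1) :
    ‖∏ i, eulerRatio (1 / (p : ℕ)) (u i) (u' i) - ∏ _i : Fin t, eulerRatio (1 / (p : ℕ)) 1 1‖ ≤
      9 ^ t * 24 * (∑ i, (‖u i - 1‖ + ‖u' i - 1‖)) * (1 / (p : ℕ)) := by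
  have h := norm_prod_sub_prod_le_pow (M := 9) (by norm_num)
    (fun i => norm_eulerRatio_le (norm_one_div_prime_le p) (hu i) (hu' i))
    (b := fun _ : Fin t => eulerRatio (1 / (p : ℕ)) 1 1) (fun _ =>
      norm_eulerRatio_le (norm_one_div_prime_le p) (by norm_num) (by norm_num))
  rw [Fintype.card_fin] at h
  refine h.trans ?_
  rw [mul_assoc, mul_assoc]
  refine mul_le_mul_of_nonneg_left ?_ (by positivity)
  refine (Finset.sum_le_sum fun i _ => norm_eulerRatio_sub_le (norm_one_div_prime_le p) (hu i)
    (hu' i)).trans (le_of_eq ?_)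
  rw [norm_one_div_prime, ← Finset.mul_sum]
  ring

theorem norm_prod_eulerRatio_sub_one_sub_le (hu : ∀ i, ‖u i‖ ≤ 1)
    (hu' : ∀ i, ‖u' i‖ ≤ 1) :
    ‖∏ i, eulerRatio (1 / (p : ℕ)) (u i) (u' i) - 1 -
        ∑ i, (u i + u' i - u i * u' i) * (1 / (p : ℕ))‖ ≤
      (t ^ 2 * 9 ^ t * 16 ^ 2 + t * 64) * (1 / ((p : ℕ) : ℝ)) ^ 2 := by
  have hx : 1 / ((p : ℕ) : ℝ) ≤ 1 / 2 := by
    rw [← norm_one_div_prime]; exact norm_one_div_prime_le p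
  have h := norm_prod_one_add_sub_one_sub_sum_le (Finset.univ : Finset (Fin t))
    (y := fun i => eulerRatio (1 / (p : ℕ)) (u i) (u' i) - 1) (δ := 16 * (1 / ((p : ℕ) : ℝ)))
    (M := 9) (by linarith) (by positivity) (fun i _ => by
      rw [← norm_one_div_prime]
      exact norm_eulerRatio_sub_one_le (norm_one_div_prime_le p) (hu i) (hu' i))
  simp only [add_sub_cancel, Finset.card_univ, Fintype.card_fin] at h
  have h2 : ‖∑ i, (eulerRatio (1 / (p : ℕ)) (u i) (u' i) - 1) -
      ∑ i, (u i + u' i - u i * u' i) * (1 / (p : ℕ))‖ ≤ t * 64 * (1 / ((p : ℕ) : ℝ)) ^ 2 := by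
    rw [← Finset.sum_sub_distrib]
    refine (norm_sum_le _ _).trans ((Finset.sum_le_sum fun i _ =>
      norm_eulerRatio_sub_one_sub_le (norm_one_div_prime_le p) (hu i) (hu' i)).trans
        (le_of_eq ?_))
    rw [norm_one_div_prime]
    simp
    ring
  rw [← sub_add_sub_cancel]
  refine (norm_add_le _ _).trans ((add_le_add h h2).trans (le_of_eq ?_))
  ring

variable {Ψ : AffineSystem d t}

/-- The crude bound, which is all that survives at the exceptional primes: it only uses that each
form vanishes with density at most `1/p`. -/
theorem norm_twistedFactor_sub_one_le (hu : ∀ i, ‖u i‖ ≤ 1)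
    (hu' : ∀ i, ‖u' i‖ ≤ 1) (h : Ψ.localFactor p ≠ 0) :
    ‖Ψ.twistedFactor p u u' - 1‖ ≤ 9 ^ t * (4 ^ t * 3 + 16) * t * (1 / ((p : ℕ) : ℝ)) := by
  set w := fun i => u i + u' i - u i * u' i with hw
  have hw3 : ∀ i, ‖w i‖ ≤ 3 := fun i => norm_add_sub_mul_le (hu i) (hu' i)
  have h1 := norm_localMean_sub_le h hw3 (w' := 0) (by simp)
  rw [localMean_zero] at h1
  have h1' : ‖Ψ.localMean p w - 1‖ ≤ 4 ^ t * (t * 3) * (1 / ((p : ℕ) : ℝ)) := by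
    refine h1.trans ?_
    rw [mul_one_div]
    gcongr
    refine (Finset.sum_le_sum fun i _ => (by simpa using hw3 i : ‖w i - (0 : Fin t → ℂ) i‖ ≤ 3)).trans ?_
    simp
  have e : Ψ.twistedFactor p u u' - 1 = (Ψ.localMean p w - 1) *
      ∏ i, eulerRatio (1 / (p : ℕ)) (u i) (u' i) +
      (∏ i, eulerRatio (1 / (p : ℕ)) (u i) (u' i) - 1) := by
    rw [twistedFactor]; ring
  rw [e]
  calc _ ≤ 4 ^ t * (t * 3) * (1 / ((p : ℕ) : ℝ)) * 9 ^ t + 9 ^ t * (16 * t) * (1 / (p : ℕ)) := by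
        refine (norm_add_le _ _).trans
          (add_le_add ?_ (norm_prod_eulerRatio_sub_one_le p hu hu'))
        rw [norm_mul]
        exact mul_le_mul h1' (norm_prod_eulerRatio_le p hu hu') (norm_nonneg _) (by positivity)
    _ = _ := by ring

theorem norm_twistedFactor_sub_localFactor_le (hu : ∀ i, ‖u i‖ ≤ 1)
    (hu' : ∀ i, ‖u' i‖ ≤ 1) (h : Ψ.localFactor p ≠ 0) :
    ‖Ψ.twistedFactor p u u' - Ψ.localFactor p‖ ≤
      9 ^ t * 4 ^ t * 26 * (∑ i, (‖u i - 1‖ + ‖u' i - 1‖)) * (1 / ((p : ℕ) : ℝ)) := by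
  set w := fun i => u i + u' i - u i * u' i with hw
  have hw3 : ∀ i, ‖w i‖ ≤ 3 := fun i => norm_add_sub_mul_le (hu i) (hu' i)
  set w1 : Fin t → ℂ := fun i => (1 : Fin t → ℂ) i + (1 : Fin t → ℂ) i -
    (1 : Fin t → ℂ) i * (1 : Fin t → ℂ) i with hw1
  have hw13 : ∀ i, ‖w1 i‖ ≤ 3 := fun i => norm_add_sub_mul_le (by simp) (by simp)
  have h1 := norm_localMean_sub_le h hw3 hw13
  have h1' : ‖Ψ.localMean p w - Ψ.localMean p w1‖ ≤
      4 ^ t * (2 * ∑ i, (‖u i - 1‖ + ‖u' i - 1‖)) * (1 / ((p : ℕ) : ℝ)) := by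
    refine h1.trans ?_
    rw [mul_one_div]
    gcongr
    rw [Finset.mul_sum]
    refine Finset.sum_le_sum fun i _ => ?_
    -- Since `u + u' - u u' = 1 - (1 - u)(1 - u')`, the weight is even of second order near `u = u'
    -- = 1`; only one of the two small factors is used.
    have e : w i - w1 i = (u i - 1) * (1 - u' i) := by simp only [hw, hw1, Pi.one_apply]; ring
    rw [e, norm_mul]
    have h2 : ‖1 - u' i‖ ≤ 2 := (norm_sub_le _ _).trans (by rw [norm_one]; linarith [hu' i])
    nlinarith [norm_nonneg (u i - 1), norm_nonneg (u' i - 1)]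
  rw [← twistedFactor_one]
  have e : Ψ.twistedFactor p u u' - Ψ.twistedFactor p 1 1 =
      (Ψ.localMean p w - Ψ.localMean p w1) * ∏ i, eulerRatio (1 / (p : ℕ)) (u i) (u' i) +
      Ψ.localMean p w1 * (∏ i, eulerRatio (1 / (p : ℕ)) (u i) (u' i) -
        ∏ i : Fin t, eulerRatio (1 / (p : ℕ)) 1 1) := by
    rw [twistedFactor, twistedFactor]
    simp only [hw, hw1, Pi.one_apply]
    ring
  rw [e]
  calc _ ≤ 4 ^ t * (2 * ∑ i, (‖u i - 1‖ + ‖u' i - 1‖)) * (1 / ((p : ℕ) : ℝ)) * 9 ^ t +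
        4 ^ t * (9 ^ t * 24 * (∑ i, (‖u i - 1‖ + ‖u' i - 1‖)) * (1 / (p : ℕ))) := by
        refine (norm_add_le _ _).trans (add_le_add ?_ ?_)
        · rw [norm_mul]
          refine mul_le_mul h1' (norm_prod_eulerRatio_le p hu hu') (norm_nonneg _) ?_
          exact mul_nonneg (mul_nonneg (by positivity) (mul_nonneg (by norm_num)
            (Finset.sum_nonneg fun _ _ => by positivity))) (by positivity)
        · rw [norm_mul]
          exact mul_le_mul (Ψ.norm_localMean_le p hw13) (norm_prod_eulerRatio_sub_le p hu hu')
            (norm_nonneg _) (by positivity)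
    _ = _ := by ring

/-- With `s = ∑ w_i / p`, the local mean is `1 - s + O(p^{-2})` and the product of Euler factors is
`1 + s + O(p^{-2})`. The first order terms cancel, leaving `-s²` and the two remainders. -/
theorem norm_twistedFactor_sub_one_le_sq (hu : ∀ i, ‖u i‖ ≤ 1)
    (hu' : ∀ i, ‖u' i‖ ≤ 1) (ht : 2 ≤ t) (h : (p : ℕ) ∉ Ψ.exceptionalPrimes) :
    ‖Ψ.twistedFactor p u u' - 1‖ ≤ ((3 * t) ^ 2 + (t ^ 2 * 9 ^ t * 16 ^ 2 + t * 64) * 4 ^ t +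
      (4 ^ t + 1 + t * 3) * (t * t) * (1 + 3 * t)) * (1 / ((p : ℕ) : ℝ)) ^ 2 := by
  set w := fun i => u i + u' i - u i * u' i with hw
  have hw3 : ∀ i, ‖w i‖ ≤ 3 := fun i => norm_add_sub_mul_le (hu i) (hu' i)
  have hE := norm_localMean_sub_one_add_le ht h hw3
  have hG := norm_prod_eulerRatio_sub_one_sub_le p hu hu'
  set s := ∑ i, w i * (1 / ((p : ℕ) : ℂ)) with hs
  have hx : 1 / ((p : ℕ) : ℝ) ≤ 1 / 2 := by
    rw [← norm_one_div_prime]; exact norm_one_div_prime_le p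
  have hx0 : 0 ≤ 1 / ((p : ℕ) : ℝ) := by positivity
  have hsn : ‖s‖ ≤ 3 * t * (1 / ((p : ℕ) : ℝ)) := by
    rw [hs, ← Finset.sum_mul, norm_mul, norm_one_div_prime]
    refine mul_le_mul_of_nonneg_right ?_ (by positivity)
    refine (norm_sum_le _ _).trans ((Finset.sum_le_sum fun i _ => hw3 i).trans ?_)
    simp [mul_comm]
  have hs1 : ‖1 + s‖ ≤ 1 + 3 * t := by
    refine (norm_add_le _ _).trans ?_
    rw [norm_one]
    have : 3 * t * (1 / ((p : ℕ) : ℝ)) ≤ 3 * t * 1 := by gcongr; linarith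
    linarith
  have e : Ψ.twistedFactor p u u' - 1 = -(s * s) +
      (∏ i, eulerRatio (1 / (p : ℕ)) (u i) (u' i) - 1 - s) * Ψ.localMean p w +
      (Ψ.localMean p w - 1 + s) * (1 + s) := by
    rw [twistedFactor]; ring
  rw [e]
  calc _ ≤ (3 * t * (1 / ((p : ℕ) : ℝ))) * (3 * t * (1 / ((p : ℕ) : ℝ))) +
        (t ^ 2 * 9 ^ t * 16 ^ 2 + t * 64) * (1 / ((p : ℕ) : ℝ)) ^ 2 * 4 ^ t +
        (4 ^ t + 1 + t * 3) * (t * t) * (1 / ((p : ℕ) : ℝ)) ^ 2 * (1 + 3 * t) := by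
        refine (norm_add_le _ _).trans (add_le_add ((norm_add_le _ _).trans (add_le_add ?_ ?_)) ?_)
        · rw [norm_neg, norm_mul]
          exact mul_le_mul hsn hsn (norm_nonneg _) (by positivity)
        · rw [norm_mul]
          exact mul_le_mul hG (Ψ.norm_localMean_le p hw3) (norm_nonneg _) (by positivity)
        · rw [norm_mul]
          exact mul_le_mul hE hs1 (norm_nonneg _) (by positivity)
    _ = _ := by ring

end

/-- Uniform bounds for the twisted local factors. -/
theorem exists_twistedFactor_bound (t : ℕ) (ht : 2 ≤ t) : ∃ C : ℝ, 1 ≤ C ∧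
    ∀ (d : ℕ) (Ψ : AffineSystem d t) (p : Nat.Primes) (u u' : Fin t → ℂ), (∀ i, ‖u i‖ ≤ 1) →
      (∀ i, ‖u' i‖ ≤ 1) → Ψ.localFactor p ≠ 0 →
      ‖Ψ.twistedFactor p u u' - 1‖ ≤ C * (1 / ((p : ℕ) : ℝ)) ∧
      ((p : ℕ) ∉ Ψ.exceptionalPrimes →
        ‖Ψ.twistedFactor p u u' - 1‖ ≤ C * (1 / ((p : ℕ) : ℝ)) ^ 2) ∧
      ‖Ψ.twistedFactor p u u' - Ψ.localFactor p‖ ≤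
        C * (∑ i, (‖u i - 1‖ + ‖u' i - 1‖)) * (1 / ((p : ℕ) : ℝ)) := by
  set C₁ : ℝ := 9 ^ t * (4 ^ t * 3 + 16) * t
  set C₂ : ℝ := (3 * t) ^ 2 + (t ^ 2 * 9 ^ t * 16 ^ 2 + t * 64) * 4 ^ t +
      (4 ^ t + 1 + t * 3) * (t * t) * (1 + 3 * t)
  set C₃ : ℝ := 9 ^ t * 4 ^ t * 26
  have h1 : 0 ≤ C₁ := by positivity
  have h2 : 0 ≤ C₂ := by positivity
  have h3 : 0 ≤ C₃ := by positivity
  refine ⟨1 + C₁ + C₂ + C₃, by linarith, fun d Ψ p u u' hu hu' h => ⟨?_, fun he => ?_, ?_⟩⟩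
  · exact (norm_twistedFactor_sub_one_le p hu hu' h).trans
      (mul_le_mul_of_nonneg_right (by linarith) (by positivity))
  · exact (norm_twistedFactor_sub_one_le_sq p hu hu' ht he).trans
      (mul_le_mul_of_nonneg_right (by linarith) (by positivity))
  · refine (norm_twistedFactor_sub_localFactor_le p hu hu' h).trans
      (mul_le_mul_of_nonneg_right (mul_le_mul_of_nonneg_right (by linarith) ?_) (by positivity))
    exact Finset.sum_nonneg fun _ _ => by positivity

end AffineSystem

/-! ### Comparison of the twisted and untwisted products -/

theorem one_sub_sum_le_prod_one_sub {ι : Type*} (s : Finset ι) {f : ι → ℝ}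
    (h0 : ∀ i ∈ s, 0 ≤ f i) (h1 : ∀ i ∈ s, f i ≤ 1) :
    1 - ∑ i ∈ s, f i ≤ ∏ i ∈ s, (1 - f i) := by
  classical
  induction s using Finset.induction_on with
  | empty => simp
  | insert j s hj ih =>
    simp only [Finset.forall_mem_insert] at h0 h1
    rw [Finset.sum_insert hj, Finset.prod_insert hj]
    have h2 : ∏ i ∈ s, (1 - f i) ≤ 1 :=
      Finset.prod_le_one (fun i hi => by linarith [h1.2 i hi]) fun i hi => by linarith [h0.2 i hi]
    nlinarith [ih h0.2 h1.2, h0.1]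

/-- Mean value inequality on the left half-plane, which is convex and on which the derivative of
`exp` has norm at most `1`. -/
theorem Complex.norm_exp_sub_one_le_of_re_nonpos {z : ℂ} (hz : z.re ≤ 0) :
    ‖Complex.exp z - 1‖ ≤ ‖z‖ := by
  have h := (convex_halfSpace_re_le 0).norm_image_sub_le_of_norm_deriv_le (f := Complex.exp)
    (C := 1) (x := 0) (y := z) (fun w _ => Complex.differentiable_exp.differentiableAt)
    (fun w hw => by
      rw [Complex.deriv_exp, Complex.norm_exp]
      exact Real.exp_le_one_iff.2 hw) (by simp) hz
  simpa using h

section PrimeTwist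

variable (p : Nat.Primes) {z : ℂ}

theorem norm_prime_cpow_neg_le_one (hz : 0 ≤ z.re) : ‖((p : ℕ) : ℂ) ^ (-z)‖ ≤ 1 := by
  rw [Complex.norm_natCast_cpow_of_pos p.2.pos, Complex.neg_re]
  exact Real.rpow_le_one_of_one_le_of_nonpos (by exact_mod_cast p.2.one_le) (by linarith)

theorem norm_prime_cpow_neg_sub_one_le (hz : 0 ≤ z.re) :
    ‖((p : ℕ) : ℂ) ^ (-z) - 1‖ ≤ ‖z‖ * Real.log (p : ℕ) := by
  have hl : 0 ≤ Real.log (p : ℕ) := Real.log_natCast_nonneg _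
  have hp : ((p : ℕ) : ℂ) ≠ 0 := by exact_mod_cast p.2.ne_zero
  rw [Complex.cpow_def_of_ne_zero hp, Complex.natCast_log.symm]
  refine (Complex.norm_exp_sub_one_le_of_re_nonpos ?_).trans (le_of_eq ?_)
  · rw [Complex.re_ofReal_mul, Complex.neg_re]
    nlinarith
  · rw [norm_mul, norm_neg, Complex.norm_real, Real.norm_of_nonneg hl, mul_comm]

/-- Twists differ from `1` by `O(log p)` times a small parameter. Trading `log p` for `p^{1/2}`
turns the density `1/p` into the weight `p^{-1/2}` of the exceptional sum. -/
theorem log_prime_le_sqrt : Real.log (p : ℕ) ≤ 2 * ((p : ℕ) : ℝ) ^ (1 / 2 : ℝ) := by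
  have := Real.log_le_rpow_div (Nat.cast_nonneg (p : ℕ)) (ε := 1 / 2) (by norm_num)
  linarith

end PrimeTwist

namespace AffineSystem

variable {d t : ℕ}

/-- The sum of `p^{-1/2}` over the exceptional primes. -/
noncomputable def exceptionalSum (Ψ : AffineSystem d t) : ℝ :=
  ∑' p : Ψ.exceptionalPrimes, ((p : ℕ) : ℝ) ^ (-(1 / 2) : ℝ)

theorem exceptionalSum_nonneg (Ψ : AffineSystem d t) : 0 ≤ Ψ.exceptionalSum :=
  tsum_nonneg fun _ => by positivity

open Classical in
theorem sum_filter_exceptional_le {Ψ : AffineSystem d t} (h : Ψ.exceptionalPrimes.Finite)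
    (P : Finset Nat.Primes) :
    ∑ p ∈ P.filter (fun p : Nat.Primes => (p : ℕ) ∈ Ψ.exceptionalPrimes), ((p : ℕ) : ℝ) ^ (-(1 / 2) : ℝ) ≤
      Ψ.exceptionalSum := by
  have he : Ψ.exceptionalSum = ∑ p ∈ h.toFinset, (p : ℝ) ^ (-(1 / 2) : ℝ) := by
    rw [exceptionalSum, ← Finset.tsum_subtype', h.coe_toFinset]
  rw [he, ← Finset.sum_image (s := P.filter _) (g := fun p : Nat.Primes => (p : ℕ))
    (f := fun n : ℕ => (n : ℝ) ^ (-(1 / 2) : ℝ)) (Subtype.val_injective.injOn)]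
  refine Finset.sum_le_sum_of_subset_of_nonneg ?_ fun _ _ _ => by positivity
  intro n hn
  obtain ⟨p, hp, rfl⟩ := Finset.mem_image.1 hn
  exact h.mem_toFinset.2 (Finset.mem_filter.1 hp).2

/-- The size of the difference between the twisted and the untwisted product. -/
theorem exists_prod_twistedFactor_bound (t : ℕ) (ht : 2 ≤ t) : ∃ C : ℝ, 1 ≤ C ∧
    ∀ (d : ℕ) (Ψ : AffineSystem d t) (P : Finset Nat.Primes) (z z' : Fin t → ℂ), 0 < d →
      Ψ.Admissible → (∀ i, 0 ≤ (z i).re) → (∀ i, 0 ≤ (z' i).re) →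
      ‖∏ p ∈ P, Ψ.twistedFactor p (fun i => ((p : ℕ) : ℂ) ^ (-z i))
        (fun i => ((p : ℕ) : ℂ) ^ (-z' i))‖ ≤ Real.exp (C * (1 + Ψ.exceptionalSum)) ∧
      ‖∏ p ∈ P, Ψ.twistedFactor p (fun i => ((p : ℕ) : ℂ) ^ (-z i))
        (fun i => ((p : ℕ) : ℂ) ^ (-z' i)) - ∏ p ∈ P, (Ψ.localFactor p : ℂ)‖ ≤
        Real.exp (C * (1 + Ψ.exceptionalSum)) *
          (C * (1 + Ψ.exceptionalSum) * (√(∑ i, (‖z i‖ + ‖z' i‖)) + ∑ i, (‖z i‖ + ‖z' i‖))) := by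
  classical
  obtain ⟨C, hC1, hC⟩ := exists_twistedFactor_bound t ht
  have hsum2 : Summable fun p : Nat.Primes => ((p : ℕ) : ℝ) ^ (-2 : ℝ) :=
    Nat.Primes.summable_rpow.2 (by norm_num)
  have hsum5 : Summable fun p : Nat.Primes => ((p : ℕ) : ℝ) ^ (-(5 / 4) : ℝ) :=
    Nat.Primes.summable_rpow.2 (by norm_num)
  set K2 := ∑' p : Nat.Primes, ((p : ℕ) : ℝ) ^ (-2 : ℝ) with hK2
  set K5 := ∑' p : Nat.Primes, ((p : ℕ) : ℝ) ^ (-(5 / 4) : ℝ) with hK5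
  have hK20 : 0 ≤ K2 := tsum_nonneg fun _ => by positivity
  have hK50 : 0 ≤ K5 := tsum_nonneg fun _ => by positivity
  refine ⟨2 * C * (1 + K2 + K5), by nlinarith, fun d Ψ P z z' hd hΨ hz hz' => ?_⟩
  have hfin := exceptionalPrimes_finite hd hΨ.1
  have hX0 := Ψ.exceptionalSum_nonneg
  set X := Ψ.exceptionalSum with hX
  set s := ∑ i, (‖z i‖ + ‖z' i‖) with hs
  have hs0 : 0 ≤ s := Finset.sum_nonneg fun _ _ => by positivity
  set r := fun p : Nat.Primes => Ψ.twistedFactor p (fun i => ((p : ℕ) : ℂ) ^ (-z i))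
        (fun i => ((p : ℕ) : ℂ) ^ (-z' i)) with hr
  set e := fun p : Nat.Primes => if (p : ℕ) ∈ Ψ.exceptionalPrimes then
    ((p : ℕ) : ℝ) ^ (-(1 / 2) : ℝ) else 0 with he
  have hesum : ∑ p ∈ P, e p ≤ X := by
    rw [he, ← Finset.sum_filter]
    exact sum_filter_exceptional_le hfin P
  set m := fun p : Nat.Primes => 1 + C * (((p : ℕ) : ℝ) ^ (-2 : ℝ) + e p) with hm
  have he0 : ∀ p, 0 ≤ e p := fun p => by simp only [he]; split_ifs <;> positivity
  have hm1 : ∀ p, 1 ≤ m p := fun p => by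
    have := he0 p
    simp only [hm]
    have : 0 ≤ C * (((p : ℕ) : ℝ) ^ (-2 : ℝ) + e p) := by positivity
    linarith
  have hpos : ∀ p : Nat.Primes, (0 : ℝ) < (p : ℕ) := fun p => by exact_mod_cast p.2.pos
  have hge1 : ∀ p : Nat.Primes, (1 : ℝ) ≤ (p : ℕ) := fun p => by exact_mod_cast p.2.one_le
  have hsq : ∀ p : Nat.Primes, (1 / ((p : ℕ) : ℝ)) ^ 2 = ((p : ℕ) : ℝ) ^ (-2 : ℝ) := fun p => by
    rw [Real.rpow_neg (hpos p).le, one_div, inv_pow]; norm_cast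
  have hbd : ∀ (p : Nat.Primes) (u u' : Fin t → ℂ), (∀ i, ‖u i‖ ≤ 1) → (∀ i, ‖u' i‖ ≤ 1) →
      ‖Ψ.twistedFactor p u u'‖ ≤ m p := by
    intro p u u' hu hu'
    obtain ⟨h1, h2, -⟩ := hC d Ψ p u u' hu hu' (hΨ.2 p)
    have h3 : ‖Ψ.twistedFactor p u u'‖ ≤ 1 + ‖Ψ.twistedFactor p u u' - 1‖ := by
      have := norm_sub_norm_le (Ψ.twistedFactor p u u') 1
      rw [norm_one] at this; linarith
    refine h3.trans (add_le_add le_rfl ?_)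
    have hn2 : 0 ≤ ((p : ℕ) : ℝ) ^ (-2 : ℝ) := by positivity
    by_cases hp : (p : ℕ) ∈ Ψ.exceptionalPrimes
    · refine h1.trans (mul_le_mul_of_nonneg_left ?_ (by linarith))
      simp only [he, if_pos hp]
      have : 1 / ((p : ℕ) : ℝ) ≤ ((p : ℕ) : ℝ) ^ (-(1 / 2) : ℝ) := by
        rw [one_div, ← Real.rpow_neg_one]
        exact Real.rpow_le_rpow_of_exponent_le (hge1 p) (by norm_num)
      linarith
    · refine (h2 hp).trans (mul_le_mul_of_nonneg_left ?_ (by linarith))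
      rw [hsq]
      linarith [he0 p]
  have hu : ∀ (p : Nat.Primes) i, ‖((p : ℕ) : ℂ) ^ (-z i)‖ ≤ 1 := fun p i =>
    norm_prime_cpow_neg_le_one p (hz i)
  have hu' : ∀ (p : Nat.Primes) i, ‖((p : ℕ) : ℂ) ^ (-z' i)‖ ≤ 1 := fun p i =>
    norm_prime_cpow_neg_le_one p (hz' i)
  have hrm : ∀ p, ‖r p‖ ≤ m p := fun p => hbd p _ _ (hu p) (hu' p)
  have hβm : ∀ p, ‖(Ψ.localFactor p : ℂ)‖ ≤ m p := fun p => by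
    rw [← twistedFactor_one]; exact hbd p _ _ (by simp) (by simp)
  have hprod : ∏ p ∈ P, m p ≤ Real.exp (2 * C * (1 + K2 + K5) * (1 + X)) := by
    refine (Real.prod_one_add_le_exp_sum _ (f := fun p : Nat.Primes =>
      C * (((p : ℕ) : ℝ) ^ (-2 : ℝ) + e p)) fun p => ?_).trans (Real.exp_le_exp.2 ?_)
    · have := he0 p; positivity
    · rw [← Finset.mul_sum, Finset.sum_add_distrib]
      have h1 : ∑ p ∈ P, ((p : ℕ) : ℝ) ^ (-2 : ℝ) ≤ K2 :=
        hsum2.sum_le_tsum P fun _ _ => by positivity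
      calc C * (∑ p ∈ P, ((p : ℕ) : ℝ) ^ (-2 : ℝ) + ∑ p ∈ P, e p) ≤ C * (K2 + X) := by gcongr
        _ ≤ C * (2 * (1 + K2 + K5) * (1 + X)) := by
            gcongr
            nlinarith [mul_nonneg hK20 hX0, mul_nonneg hK50 hX0]
        _ = _ := by ring
  -- Continuity in the twists gives `O(s p^{-1/2})`, which is not summable over all primes. Off the
  -- exceptional primes both factors are also `1 + O(p^{-2})`, and the geometric mean of the two
  -- bounds is the summable `√s p^{-5/4}`. The first bound is kept only at exceptional primes.
  have hdiff : ∀ p : Nat.Primes, ‖r p - Ψ.localFactor p‖ ≤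
      2 * C * √s * ((p : ℕ) : ℝ) ^ (-(5 / 4) : ℝ) + 2 * C * s * e p := by
    intro p
    have h3 := (hC d Ψ p _ _ (hu p) (hu' p) (hΨ.2 p)).2.2
    have hu1 : ∑ i, (‖((p : ℕ) : ℂ) ^ (-z i) - 1‖ + ‖((p : ℕ) : ℂ) ^ (-z' i) - 1‖) ≤
        s * (2 * ((p : ℕ) : ℝ) ^ (1 / 2 : ℝ)) := by
      refine le_trans ?_ (mul_le_mul_of_nonneg_left (log_prime_le_sqrt p) hs0)
      rw [hs, Finset.sum_mul]
      refine Finset.sum_le_sum fun i _ => ?_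
      rw [add_mul]
      exact add_le_add (norm_prime_cpow_neg_sub_one_le p (hz i))
        (norm_prime_cpow_neg_sub_one_le p (hz' i))
    have hb : ‖r p - Ψ.localFactor p‖ ≤ 2 * C * s * ((p : ℕ) : ℝ) ^ (-(1 / 2) : ℝ) := by
      refine h3.trans ?_
      calc C * (∑ i, (‖((p : ℕ) : ℂ) ^ (-z i) - 1‖ + ‖((p : ℕ) : ℂ) ^ (-z' i) - 1‖)) *
            (1 / ((p : ℕ) : ℝ)) ≤ C * (s * (2 * ((p : ℕ) : ℝ) ^ (1 / 2 : ℝ))) *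
            (1 / ((p : ℕ) : ℝ)) := by gcongr
        _ = 2 * C * s * (((p : ℕ) : ℝ) ^ (1 / 2 : ℝ) * ((p : ℕ) : ℝ) ^ (-1 : ℝ)) := by
            rw [Real.rpow_neg_one]; ring
        _ = _ := by rw [← Real.rpow_add (hpos p)]; norm_num
    by_cases hp : (p : ℕ) ∈ Ψ.exceptionalPrimes
    · refine hb.trans ?_
      simp only [he, if_pos hp]
      have : 0 ≤ 2 * C * √s * ((p : ℕ) : ℝ) ^ (-(5 / 4) : ℝ) := by positivity
      linarith
    · have ha : ‖r p - Ψ.localFactor p‖ ≤ 2 * C * ((p : ℕ) : ℝ) ^ (-2 : ℝ) := by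
        have h1 := (hC d Ψ p _ _ (hu p) (hu' p) (hΨ.2 p)).2.1 hp
        have h2 := (hC d Ψ p 1 1 (by simp) (by simp) (hΨ.2 p)).2.1 hp
        rw [twistedFactor_one] at h2
        rw [hsq] at h1 h2
        have := norm_sub_le (r p - 1) (Ψ.localFactor p - 1)
        rw [sub_sub_sub_cancel_right] at this
        linarith
      simp only [he, if_neg hp, mul_zero, add_zero]
      refine abs_le_of_sq_le_sq' ?_ (by positivity) |>.2
      have hpp : (((p : ℕ) : ℝ) ^ (-(5 / 4) : ℝ)) ^ 2 =
          ((p : ℕ) : ℝ) ^ (-2 : ℝ) * ((p : ℕ) : ℝ) ^ (-(1 / 2) : ℝ) := by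
        rw [← Real.rpow_natCast, ← Real.rpow_mul (hpos p).le, ← Real.rpow_add (hpos p)]
        norm_num
      calc ‖r p - Ψ.localFactor p‖ ^ 2 ≤ (2 * C * ((p : ℕ) : ℝ) ^ (-2 : ℝ)) *
            (2 * C * s * ((p : ℕ) : ℝ) ^ (-(1 / 2) : ℝ)) := by
            rw [sq]; exact mul_le_mul ha hb (norm_nonneg _) (by positivity)
        _ = _ := by rw [mul_pow, mul_pow, Real.sq_sqrt hs0, hpp]; ring
  have hdsum : ∑ p ∈ P, ‖r p - Ψ.localFactor p‖ ≤
      2 * C * (1 + K2 + K5) * (1 + X) * (√s + s) := by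
    calc _ ≤ ∑ p ∈ P, (2 * C * √s * ((p : ℕ) : ℝ) ^ (-(5 / 4) : ℝ) + 2 * C * s * e p) :=
          Finset.sum_le_sum fun p _ => hdiff p
      _ = 2 * C * √s * ∑ p ∈ P, ((p : ℕ) : ℝ) ^ (-(5 / 4) : ℝ) + 2 * C * s * ∑ p ∈ P, e p := by
          rw [Finset.sum_add_distrib, ← Finset.mul_sum, ← Finset.mul_sum]
      _ ≤ 2 * C * √s * K5 + 2 * C * s * X := by
          gcongr
          exact hsum5.sum_le_tsum P fun _ _ => by positivity
      _ ≤ 2 * C * √s * ((1 + K2 + K5) * (1 + X)) + 2 * C * s * ((1 + K2 + K5) * (1 + X)) := by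
          gcongr
          · nlinarith [mul_nonneg hK20 hX0, mul_nonneg hK50 hX0]
          · nlinarith [mul_nonneg hK20 hX0, mul_nonneg hK50 hX0]
      _ = _ := by ring
  refine ⟨(norm_prod_le_prod_of_le P fun p _ => hrm p).trans hprod, ?_⟩
  refine (norm_prod_sub_prod_le P (fun p _ => hm1 p) (fun p _ => hrm p) fun p _ => hβm p).trans ?_
  exact mul_le_mul hprod hdsum (Finset.sum_nonneg fun _ _ => norm_nonneg _) (Real.exp_pos _).le

/-! ### The singular series -/

theorem multipliable_localFactor {Ψ : AffineSystem d t} (hd : 0 < d) (ht : 2 ≤ t)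
    (hΨ : Ψ.Admissible) : Multipliable Ψ.localFactor := by
  classical
  obtain ⟨C, hC1, hC⟩ := exists_twistedFactor_bound t ht
  have hfin := exceptionalPrimes_finite hd hΨ.1
  have hsum2 : Summable fun p : Nat.Primes => C * (1 / ((p : ℕ) : ℝ)) ^ 2 := by
    refine Summable.mul_left C ?_
    refine (Nat.Primes.summable_rpow.2 (by norm_num : (-2 : ℝ) < -1)).congr fun p => ?_
    rw [Real.rpow_neg (by positivity), one_div, inv_pow]; norm_cast
  have h : Summable fun p => Ψ.localFactor p - 1 := by
    refine hsum2.of_norm_bounded_eventually ?_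
    have hpre : ((fun p : Nat.Primes => (p : ℕ)) ⁻¹' Ψ.exceptionalPrimes).Finite :=
      hfin.preimage Subtype.val_injective.injOn
    filter_upwards [hpre.compl_mem_cofinite] with p hp
    have := (hC d Ψ p 1 1 (by simp) (by simp) (hΨ.2 p)).2.1 hp
    rw [twistedFactor_one] at this
    have e : ((Ψ.localFactor p : ℂ) - 1) = ((Ψ.localFactor p - 1 : ℝ) : ℂ) := by push_cast; rfl
    rwa [e, Complex.norm_real] at this
  simpa using Real.multipliable_one_add_of_summable h

theorem one_sub_zeroInd_mem (Ψ : AffineSystem d t) {K : Type*} [CommRing K] (i : Fin t)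
    (a : Fin d → K) : 1 - Ψ.zeroInd K i a ∈ Set.Icc (0 : ℝ) 1 :=
  ⟨by linarith [Ψ.zeroInd_le_one K i a], by linarith [Ψ.zeroInd_nonneg K i a]⟩

theorem one_le_prime_div (p : Nat.Primes) : 1 + 1 / ((p : ℕ) : ℝ) ≤ (p : ℕ) / ((p : ℕ) - 1 : ℝ) := by
  have h1 : (1 : ℝ) < (p : ℕ) := by exact_mod_cast p.2.one_lt
  rw [le_div_iff₀ (by linarith)]
  field_simp
  nlinarith

/-- A nonzero `β_p` has at least one residue vector at which no form vanishes. That vector alone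
contributes `p^{-d}` times a normalisation at least `1`. -/
theorem localFactor_ge_pow {Ψ : AffineSystem d t} {p : Nat.Primes} (h : Ψ.localFactor p ≠ 0) :
    (1 / ((p : ℕ) : ℝ)) ^ d ≤ Ψ.localFactor p := by
  have hp : (0 : ℝ) < (p : ℕ) := by exact_mod_cast p.2.pos
  rw [localFactor_eq] at h ⊢
  have hnn : ∀ a : Fin d → ZMod (p : ℕ), 0 ≤ ∏ i, (1 - Ψ.zeroInd (ZMod (p : ℕ)) i a) := fun a =>
    Finset.prod_nonneg fun i _ => (Ψ.one_sub_zeroInd_mem i a).1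
  have h1 : (1 : ℝ) ≤ ∑ a, ∏ i, (1 - Ψ.zeroInd (ZMod (p : ℕ)) i a) := by
    obtain ⟨a, -, ha⟩ := Finset.exists_ne_zero_of_sum_ne_zero
      (fun h0 => h (by rw [h0, zero_div, zero_mul]))
    refine le_trans (le_of_eq ?_) (Finset.single_le_sum (fun a _ => hnn a) (Finset.mem_univ a))
    symm
    refine Finset.prod_eq_one fun i _ => ?_
    have := Finset.prod_ne_zero_iff.1 ha i (Finset.mem_univ i)
    unfold zeroInd at this ⊢
    split_ifs at this ⊢ <;> simp_all
  have h2 : 1 ≤ ((p : ℕ) / ((p : ℕ) - 1 : ℝ)) ^ t := by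
    refine one_le_pow₀ (le_trans ?_ (one_le_prime_div p))
    have : 0 ≤ 1 / ((p : ℕ) : ℝ) := by positivity
    linarith
  rw [one_div_pow]
  refine le_trans ?_ (le_mul_of_one_le_right (by positivity) h2)
  gcongr

theorem localFactor_pos {Ψ : AffineSystem d t} {p : Nat.Primes} (h : Ψ.localFactor p ≠ 0) :
    0 < Ψ.localFactor p := by
  have hp : (0 : ℝ) < (p : ℕ) := by exact_mod_cast p.2.pos
  exact lt_of_lt_of_le (by positivity) (localFactor_ge_pow h)

/-- The union bound gives density at least `1 - t/p` for the points where no form vanishes, and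
Bernoulli gives `(p/(p-1))^t ≥ 1 + t/p`. No independence of the forms is used, so exceptional primes
are covered too. -/
theorem localFactor_ge_one_sub {Ψ : AffineSystem d t} {p : Nat.Primes} (h : Ψ.localFactor p ≠ 0) :
    1 - t ^ 2 * (1 / ((p : ℕ) : ℝ)) ^ 2 ≤ Ψ.localFactor p := by
  have hp : (0 : ℝ) < (p : ℕ) := by exact_mod_cast p.2.pos
  set x := 1 / ((p : ℕ) : ℝ) with hx
  have hx0 : 0 < x := by positivity
  by_cases hlt : 1 ≤ t * x
  · refine le_trans ?_ (localFactor_pos h).le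
    nlinarith
  push Not at hlt
  have h1 : 1 - t * x ≤ (∑ a, ∏ i, (1 - Ψ.zeroInd (ZMod (p : ℕ)) i a)) / ((p : ℕ) : ℝ) ^ d := by
    calc 1 - t * x = 1 - ∑ i : Fin t, x := by simp
      _ ≤ 1 - ∑ i, (∑ a, Ψ.zeroInd (ZMod (p : ℕ)) i a) / ((p : ℕ) : ℝ) ^ d := by
          refine sub_le_sub_left (Finset.sum_le_sum fun i _ => sum_zeroInd_le h i) _
      _ = (∑ a : Fin d → ZMod (p : ℕ), (1 - ∑ i, Ψ.zeroInd (ZMod (p : ℕ)) i a)) /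
            ((p : ℕ) : ℝ) ^ d := by
          rw [← Finset.sum_div, Finset.sum_sub_distrib, sub_div, Finset.sum_comm]
          congr 1
          simp [ZMod.card, hp.ne']
      _ ≤ _ := by
          gcongr with a
          exact one_sub_sum_le_prod_one_sub _ (fun i _ => Ψ.zeroInd_nonneg _ i a)
            fun i _ => Ψ.zeroInd_le_one _ i a
  have h2 : 1 + t * x ≤ ((p : ℕ) / ((p : ℕ) - 1 : ℝ)) ^ t := by
    refine (one_add_mul_le_pow (by linarith) t).trans ?_
    exact pow_le_pow_left₀ (by positivity) (one_le_prime_div p) t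
  rw [localFactor_eq]
  calc 1 - t ^ 2 * x ^ 2 = (1 - t * x) * (1 + t * x) := by ring
    _ ≤ _ := mul_le_mul h1 h2 (by positivity) (le_trans (by linarith) h1)

/-- The partial products of the singular series are bounded below uniformly in the system. -/
theorem exists_prod_localFactor_ge (d t : ℕ) : ∃ c : ℝ, 0 < c ∧
    ∀ (Ψ : AffineSystem d t) (P : Finset Nat.Primes), Ψ.Admissible →
      c ≤ ∏ p ∈ P, Ψ.localFactor p := by
  classical
  have hsum2 : Summable fun p : Nat.Primes => (t : ℝ) ^ 2 * (1 / ((p : ℕ) : ℝ)) ^ 2 := by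
    refine Summable.mul_left _ ?_
    refine (Nat.Primes.summable_rpow.2 (by norm_num : (-2 : ℝ) < -1)).congr fun p => ?_
    rw [Real.rpow_neg (by positivity), one_div, inv_pow]; norm_cast
  -- `S` depends on `t` only. Primes in `S` are bounded below by `p^{-d}`, and those outside
  -- contribute at least `1 - ∑ t²/p² ≥ 1/2`.
  obtain ⟨S, hS⟩ := summable_iff_vanishing_norm.1 hsum2 (1 / 2) (by norm_num)
  have hpos : ∀ p : Nat.Primes, (0 : ℝ) < (p : ℕ) := fun p => by exact_mod_cast p.2.pos
  have hle1 : ∀ p : Nat.Primes, (1 / ((p : ℕ) : ℝ)) ^ d ≤ 1 := fun p => by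
    refine pow_le_one₀ (by positivity) ?_
    rw [div_le_one (hpos p)]
    exact_mod_cast p.2.one_le
  refine ⟨(∏ p ∈ S, (1 / ((p : ℕ) : ℝ)) ^ d) * (1 / 2), ?_, fun Ψ P hΨ => ?_⟩
  · exact mul_pos (Finset.prod_pos fun p _ => by have := hpos p; positivity) (by norm_num)
  rw [← Finset.prod_inter_mul_prod_sdiff P S]
  have h1 : ∏ p ∈ S, (1 / ((p : ℕ) : ℝ)) ^ d ≤ ∏ p ∈ P ∩ S, Ψ.localFactor p := by
    refine le_trans ?_ (Finset.prod_le_prod (fun p _ => by positivity)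
      fun p _ => localFactor_ge_pow (hΨ.2 p))
    exact Finset.prod_le_prod_of_subset_of_le_one Finset.inter_subset_right
      (fun p _ => by positivity) fun p _ _ => hle1 p
  have h2 : (1 : ℝ) / 2 ≤ ∏ p ∈ P \ S, Ψ.localFactor p := by
    have hlt : ∑ p ∈ P \ S, (t : ℝ) ^ 2 * (1 / ((p : ℕ) : ℝ)) ^ 2 < 1 / 2 :=
      (le_abs_self _).trans_lt (hS _ Finset.sdiff_disjoint)
    have hle : ∀ p ∈ P \ S, (t : ℝ) ^ 2 * (1 / ((p : ℕ) : ℝ)) ^ 2 ≤ 1 := fun p hp =>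
      (Finset.single_le_sum (f := fun p : Nat.Primes => (t : ℝ) ^ 2 * (1 / ((p : ℕ) : ℝ)) ^ 2)
        (fun _ _ => by positivity) hp).trans (by linarith)
    calc (1 : ℝ) / 2 ≤ 1 - ∑ p ∈ P \ S, (t : ℝ) ^ 2 * (1 / ((p : ℕ) : ℝ)) ^ 2 := by linarith
      _ ≤ ∏ p ∈ P \ S, (1 - (t : ℝ) ^ 2 * (1 / ((p : ℕ) : ℝ)) ^ 2) :=
          one_sub_sum_le_prod_one_sub _ (fun _ _ => by positivity) hle
      _ ≤ _ := Finset.prod_le_prod (fun p hp => by linarith [hle p hp])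
          fun p _ => localFactor_ge_one_sub (hΨ.2 p)
  exact mul_le_mul h1 h2 (by norm_num) (Finset.prod_nonneg fun p _ => (localFactor_pos (hΨ.2 p)).le)

end AffineSystem

/-! ### Fourier representation of the weight -/

section FourierDensity

open MeasureTheory

/-- The points `1 - 2πiv` of the line `Re = 1`. -/
noncomputable def lineOne (v : ℝ) : ℂ := 1 - 2 * Real.pi * v * Complex.I

@[simp]
theorem lineOne_re (v : ℝ) : (lineOne v).re = 1 := by simp [lineOne]

theorem continuous_lineOne : Continuous lineOne := by unfold lineOne; fun_prop

theorem one_le_norm_lineOne (v : ℝ) : 1 ≤ ‖lineOne v‖ := by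
  have := Complex.abs_re_le_norm (lineOne v)
  simpa using this

theorem norm_lineOne_le (v : ℝ) : ‖lineOne v‖ ≤ 1 + 2 * Real.pi * |v| := by
  refine (norm_sub_le _ _).trans (le_of_eq ?_)
  simp [abs_of_pos Real.pi_pos]

/-- `φ` is a rapidly decaying density with `χ(x) = ∫ φ(v) e^{-(1 - 2πiv)x} dv`. -/
structure IsFourierDensity (φ : ℝ → ℂ) (χ : ℝ → ℝ) : Prop where
  continuous : Continuous φ
  integrable : ∀ k : ℕ, Integrable fun v => ‖φ v‖ * ‖lineOne v‖ ^ k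
  eq_integral : ∀ x : ℝ, (χ x : ℂ) = ∫ v, φ v * Complex.exp (-lineOne v * x)

/-- `φ` is the Fourier transform of the Schwartz function `e^x χ(x)`. The weight `e^x` moves the
integral to `Re = 1`, so that the zeta values met later lie in the region of absolute convergence.
-/
theorem exists_isFourierDensity {χ : ℝ → ℝ} (hχ : ContDiff ℝ ∞ χ) {S : ℝ}
    (hS : Function.support χ ⊆ Set.Icc (-S) S) : ∃ φ, IsFourierDensity φ χ := by
  have hc : HasCompactSupport χ :=
    HasCompactSupport.intro isCompact_Icc fun x hx => by
      by_contra h; exact hx (hS h)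
  have hcg : HasCompactSupport fun x : ℝ => ((Real.exp x * χ x : ℝ) : ℂ) := by
    have : HasCompactSupport fun x : ℝ => Real.exp x * χ x := hc.mul_left
    exact this.comp_left (g := fun r : ℝ => (r : ℂ)) (by simp)
  have hsg : ContDiff ℝ ∞ fun x : ℝ => ((Real.exp x * χ x : ℝ) : ℂ) :=
    Complex.ofRealCLM.contDiff.comp (Real.contDiff_exp.mul hχ)
  set g := hcg.toSchwartzMap hsg with hg
  set φ := FourierTransform.fourier g with hφ
  refine ⟨φ, φ.continuous, fun k => ?_, fun x => ?_⟩
  · have h1 : Integrable fun v : ℝ => (2 ^ k : ℝ) * (‖φ v‖ + (2 * Real.pi) ^ k * (‖v‖ ^ k * ‖φ v‖)) := by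
      refine Integrable.const_mul (Integrable.add ?_ (Integrable.const_mul ?_ _)) _
      · simpa using φ.integrable_pow_mul volume 0
      · exact φ.integrable_pow_mul volume k
    refine h1.mono ?_ (Filter.Eventually.of_forall fun v => ?_)
    · exact (φ.continuous.norm.mul (continuous_lineOne.norm.pow k)).aestronglyMeasurable
    · rw [Real.norm_of_nonneg (by positivity), Real.norm_of_nonneg (by positivity)]
      have h2 : ‖lineOne v‖ ^ k ≤ 2 ^ k * (1 + (2 * Real.pi) ^ k * ‖v‖ ^ k) := by
        calc ‖lineOne v‖ ^ k ≤ (1 + 2 * Real.pi * |v|) ^ k :=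
              pow_le_pow_left₀ (norm_nonneg _) (norm_lineOne_le v) k
          _ ≤ 2 ^ (k - 1) * (1 ^ k + (2 * Real.pi * |v|) ^ k) :=
              add_pow_le zero_le_one (by positivity) k
          _ ≤ 2 ^ k * (1 ^ k + (2 * Real.pi * |v|) ^ k) := by
              gcongr
              · norm_num
              · omega
          _ = _ := by rw [one_pow, mul_pow, Real.norm_eq_abs]
      calc ‖φ v‖ * ‖lineOne v‖ ^ k ≤ ‖φ v‖ * (2 ^ k * (1 + (2 * Real.pi) ^ k * ‖v‖ ^ k)) := by
            gcongr
        _ = _ := by ring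
  · have h1 : FourierTransformInv.fourierInv φ = g := by
      rw [hφ, FourierTransform.fourierInv_fourier_eq]
    have h2 : g x = FourierTransformInv.fourierInv (φ : ℝ → ℂ) x := by
      rw [← SchwartzMap.fourierInv_coe, h1]
    rw [Real.fourierInv_eq'] at h2
    have h3 : g x = ((Real.exp x * χ x : ℝ) : ℂ) := rfl
    have h4 : (χ x : ℂ) = Complex.exp (-x) * g x := by
      rw [h3]; push_cast
      rw [← mul_assoc, ← Complex.exp_add]; simp
    rw [h4, h2, ← integral_const_mul]
    refine integral_congr_ae (Filter.Eventually.of_forall fun v => ?_)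
    simp only [smul_eq_mul]
    rw [← mul_assoc, ← Complex.exp_add, mul_comm]
    congr 2
    simp [lineOne]
    ring

namespace IsFourierDensity

variable {φ : ℝ → ℂ} {χ : ℝ → ℝ}

theorem norm_exp_lineOne (v x : ℝ) : ‖Complex.exp (-lineOne v * x)‖ = Real.exp (-x) := by
  rw [Complex.norm_exp]; simp

theorem integrable_mul_exp (h : IsFourierDensity φ χ) (x : ℝ) :
    Integrable fun v => φ v * Complex.exp (-lineOne v * x) := by
  refine ((h.integrable 0).mul_const (Real.exp (-x))).mono ?_ (Filter.Eventually.of_forall fun v => ?_)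
  · have := continuous_lineOne
    have := h.continuous
    exact (by fun_prop : Continuous _).aestronglyMeasurable
  · rw [norm_mul, norm_exp_lineOne, Real.norm_of_nonneg (by positivity)]
    simp

theorem hasDerivAt (h : IsFourierDensity φ χ) (x : ℝ) :
    HasDerivAt (fun x => (χ x : ℂ))
      (∫ v, φ v * (-lineOne v * Complex.exp (-lineOne v * x))) x := by
  have hl := continuous_lineOne
  have hφ := h.continuous
  have he : (fun x => (χ x : ℂ)) = fun x : ℝ => ∫ v, φ v * Complex.exp (-lineOne v * x) :=
    funext h.eq_integral
  rw [he]
  -- On the half-line `y > x - 1` the exponential is dominated by the constant `e^{-(x-1)}`, and one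
  -- power of `‖lineOne v‖` remains to be integrated.
  refine (hasDerivAt_integral_of_dominated_loc_of_deriv_le (s := Set.Ioi (x - 1))
    (F := fun (y : ℝ) v => φ v * Complex.exp (-lineOne v * y))
    (F' := fun (y : ℝ) v => φ v * (-lineOne v * Complex.exp (-lineOne v * y)))
    (bound := fun v => ‖φ v‖ * ‖lineOne v‖ ^ 1 * Real.exp (-(x - 1)))
    (Ioi_mem_nhds (by linarith)) (Filter.Eventually.of_forall fun y => ?_)
    (h.integrable_mul_exp x) ?_ (Filter.Eventually.of_forall fun v y hy => ?_)
    ((h.integrable 1).mul_const _) (Filter.Eventually.of_forall fun v y _ => ?_)).2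
  · exact (by fun_prop : Continuous _).aestronglyMeasurable
  · exact (by fun_prop : Continuous _).aestronglyMeasurable
  · rw [norm_mul, norm_mul, norm_exp_lineOne, norm_neg, pow_one, mul_assoc]
    gcongr
    exact le_of_lt hy
  · have h1 : HasDerivAt (fun y : ℝ => -lineOne v * (y : ℂ)) (-lineOne v) y := by
      simpa using (Complex.ofRealCLM.hasDerivAt (x := y)).const_mul (-lineOne v)
    exact (h1.cexp.const_mul (φ v)).congr_deriv (by ring)

theorem ofReal_deriv (h : IsFourierDensity φ χ) (hχ : Differentiable ℝ χ) (x : ℝ) :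
    ((deriv χ x : ℝ) : ℂ) = ∫ v, φ v * (-lineOne v * Complex.exp (-lineOne v * x)) :=
  ((hχ x).hasDerivAt.ofReal_comp).unique (h.hasDerivAt x)

/-- The main-term constant as an integral over the Fourier side. -/
theorem integral_prod_eq (h : IsFourierDensity φ χ) (hχ : Differentiable ℝ χ) :
    ∫ q : ℝ × ℝ, φ q.1 * φ q.2 * (lineOne q.1 * lineOne q.2 / (lineOne q.1 + lineOne q.2)) =
      ((∫ x in Set.Ioi (0 : ℝ), deriv χ x ^ 2 : ℝ) : ℂ) := by
  have hl := continuous_lineOne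
  have hφ := h.continuous
  set F : ℝ → ℝ × ℝ → ℂ := fun x q => (φ q.1 * (-lineOne q.1 * Complex.exp (-lineOne q.1 * x))) *
    (φ q.2 * (-lineOne q.2 * Complex.exp (-lineOne q.2 * x))) with hF
  have h1 : ∀ x : ℝ, ((deriv χ x ^ 2 : ℝ) : ℂ) = ∫ q, F x q := by
    intro x
    rw [hF, Measure.volume_eq_prod, integral_prod_mul
      (f := fun v => φ v * (-lineOne v * Complex.exp (-lineOne v * x)))
      (g := fun v => φ v * (-lineOne v * Complex.exp (-lineOne v * x))), ← h.ofReal_deriv hχ x]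
    push_cast; ring
  rw [← integral_complex_ofReal]
  simp_rw [h1]
  have hG : Integrable fun v => φ v * lineOne v := by
    refine (h.integrable 1).mono (hφ.mul hl).aestronglyMeasurable
      (Filter.Eventually.of_forall fun v => ?_)
    rw [norm_mul, pow_one, norm_mul, norm_norm, norm_norm]
  -- Fubini: the inner integral over `x > 0` becomes `∫ e^{-(τ+τ')x} dx = 1/(τ+τ')`. Absolute
  -- convergence comes from the factor `e^{-2x}`.
  rw [integral_integral_swap]
  · refine integral_congr_ae (Filter.Eventually.of_forall fun q => ?_)
    have hre : (-(lineOne q.1 + lineOne q.2)).re < 0 := by simp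
    have hne : lineOne q.1 + lineOne q.2 ≠ 0 := fun h0 => by
      rw [h0] at hre; simp at hre
    have h2 : ∀ x : ℝ, F x q = φ q.1 * φ q.2 * (lineOne q.1 * lineOne q.2) *
        Complex.exp (-(lineOne q.1 + lineOne q.2) * x) := by
      intro x
      simp only [hF]
      rw [neg_add, add_mul, Complex.exp_add]
      ring
    simp only [h2]
    rw [integral_const_mul, integral_exp_mul_complex_Ioi hre]
    simp only [Complex.ofReal_zero, mul_zero, Complex.exp_zero]
    field_simp
  · have h3 : Integrable (fun x : ℝ => Real.exp (-2 * x)) (volume.restrict (Set.Ioi 0)) :=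
      exp_neg_integrableOn_Ioi 0 (by norm_num)
    have h4 := h3.mul_prod (hG.norm.mul_prod hG.norm)
    refine h4.mono ?_ (Filter.Eventually.of_forall fun y => ?_)
    · have hcont : Continuous (Function.uncurry F) := by
        unfold Function.uncurry
        simp only [hF]
        fun_prop
      exact hcont.aestronglyMeasurable
    · rw [norm_mul, norm_mul]
      simp only [Function.uncurry, hF, norm_mul, norm_neg, norm_exp_lineOne, norm_norm]
      rw [Real.norm_of_nonneg (Real.exp_pos _).le,
        (by rw [← Real.exp_add]; ring_nf : Real.exp (-2 * y.1) = Real.exp (-y.1) * Real.exp (-y.1))]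
      apply le_of_eq
      ring

end IsFourierDensity

/-- The mean value theorem between `χ 0 = 1` and `χ (|S| + 1) = 0` gives a point of `(0, ∞)` where
`χ'` is nonzero; continuity of `χ'` extends this to an open set. The absolute value avoids an
assumption on the sign of `S`. -/
theorem integral_deriv_sq_pos {χ : ℝ → ℝ} (hχ : ContDiff ℝ ∞ χ) {S : ℝ}
    (hS : Function.support χ ⊆ Set.Icc (-S) S) (h0 : χ 0 = 1) :
    0 < ∫ x in Set.Ioi (0 : ℝ), deriv χ x ^ 2 := by
  have hd : Differentiable ℝ χ := hχ.differentiable (by simp)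
  have hcd : Continuous (deriv χ) := hχ.continuous_deriv (by simp)
  have hc : HasCompactSupport χ :=
    HasCompactSupport.intro isCompact_Icc fun x hx => by
      by_contra h; exact hx (hS h)
  have hcs : HasCompactSupport fun x => deriv χ x ^ 2 :=
    hc.deriv.comp_left (g := fun r : ℝ => r ^ 2) (by simp)
  have hInt : Integrable fun x => deriv χ x ^ 2 :=
    (hcd.pow 2).integrable_of_hasCompactSupport hcs
  have h1 : χ (|S| + 1) = 0 := by
    by_contra h
    have := (hS h).2
    linarith [le_abs_self S]
  obtain ⟨y, hy, hy'⟩ := exists_deriv_eq_slope χ (by positivity : (0 : ℝ) < |S| + 1)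
    hd.continuous.continuousOn hd.differentiableOn
  have hne : deriv χ y ≠ 0 := by
    rw [hy', h1, h0]
    have : |S| + 1 ≠ 0 := by positivity
    simp [this]
  rw [setIntegral_pos_iff_support_of_nonneg_ae (Filter.Eventually.of_forall fun _ => sq_nonneg _)
    hInt.integrableOn]
  have hopen : IsOpen (Function.support (fun x => deriv χ x ^ 2) ∩ Set.Ioi 0) :=
    ((hcd.pow 2).isOpen_support).inter isOpen_Ioi
  exact hopen.measure_pos _ ⟨y, by simpa using hne, hy.1⟩

end FourierDensity

/-! ### Partial Euler products of the zeta function near `1` -/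

open Filter Topology in
-- The M-test for products: the part beyond `P` differs from `1` by at most `e^δ - 1`, and the
-- partial product is at most `e^T`. Both bounds come from `b` and are uniform in `x`.
theorem exists_finset_norm_prod_sub_le {ι α : Type*} {f : ι → α → ℂ} {b : ι → ℝ} {F : α → ℂ}
    (hb : Summable b) (hf : ∀ i x, ‖f i x‖ ≤ b i) (hF : ∀ x, HasProd (fun i => 1 + f i x) (F x))
    {ε : ℝ} (hε : 0 < ε) :
    ∃ P₀ : Finset ι, ∀ P, P₀ ⊆ P → ∀ x, ‖∏ i ∈ P, (1 + f i x) - F x‖ ≤ ε := by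
  classical
  rcases isEmpty_or_nonempty α with hα | ⟨⟨x₀⟩⟩
  · exact ⟨∅, fun P _ x => (hα.false x).elim⟩
  have hb0 : ∀ i, 0 ≤ b i := fun i => (norm_nonneg _).trans (hf i x₀)
  set T := ∑' i, b i
  have htend : Tendsto (fun δ : ℝ => Real.exp T * (Real.exp δ - 1)) (𝓝 0) (𝓝 0) := by
    have : Continuous fun δ : ℝ => Real.exp T * (Real.exp δ - 1) := by fun_prop
    simpa using this.tendsto 0
  obtain ⟨δ, hδ, hδε⟩ : ∃ δ > 0, Real.exp T * (Real.exp δ - 1) < ε :=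
    (((htend.mono_left nhdsWithin_le_nhds).eventually (gt_mem_nhds hε)).and
      (self_mem_nhdsWithin (s := Set.Ioi (0 : ℝ)))).exists.imp fun _ h => ⟨h.2, h.1⟩
  obtain ⟨P₀, hP₀⟩ := summable_iff_vanishing_norm.1 hb δ hδ
  refine ⟨P₀, fun P hP x => ?_⟩
  rw [norm_sub_rev]
  refine le_of_tendsto ((hF x).sub_const _).norm ?_
  filter_upwards [eventually_ge_atTop P] with P' hP'
  have hP' : P ⊆ P' := hP'
  have e : ∏ i ∈ P', (1 + f i x) - ∏ i ∈ P, (1 + f i x) =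
      (∏ i ∈ P, (1 + f i x)) * (∏ i ∈ P' \ P, (1 + f i x) - 1) := by
    rw [← Finset.prod_sdiff hP']; ring
  have h1 : ‖∏ i ∈ P, (1 + f i x)‖ ≤ Real.exp T := by
    refine (norm_prod_le_prod_of_le P (m := fun i => 1 + b i) fun i _ => ?_).trans ?_
    · refine (norm_add_le _ _).trans ?_
      rw [norm_one]; linarith [hf i x]
    · refine (Real.prod_one_add_le_exp_sum P hb0).trans (Real.exp_le_exp.2 ?_)
      exact hb.sum_le_tsum P fun i _ => hb0 i
  have h2 : ‖∏ i ∈ P' \ P, (1 + f i x) - 1‖ ≤ Real.exp δ - 1 := by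
    refine (Finset.norm_prod_one_add_sub_one_le _ _).trans (sub_le_sub_right (Real.exp_le_exp.2 ?_) 1)
    refine (Finset.sum_le_sum fun i _ => hf i x).trans ((le_abs_self _).trans (hP₀ _ ?_).le)
    exact Finset.sdiff_disjoint.mono_right hP
  rw [e, norm_mul]
  exact (mul_le_mul h1 h2 (norm_nonneg _) (Real.exp_pos _).le).trans hδε.le

theorem norm_prime_cpow_neg_le_half (p : Nat.Primes) {s : ℂ} (hs : 1 < s.re) :
    ‖((p : ℕ) : ℂ) ^ (-s)‖ ≤ 1 / 2 := by
  rw [Complex.norm_natCast_cpow_of_pos p.2.pos, Complex.neg_re, Real.rpow_neg (by positivity),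
    one_div]
  refine inv_anti₀ (by norm_num) ?_
  have h2 : (2 : ℝ) ≤ (p : ℕ) := by exact_mod_cast p.2.two_le
  calc (2 : ℝ) ≤ (p : ℕ) := h2
    _ = ((p : ℕ) : ℝ) ^ (1 : ℝ) := (Real.rpow_one _).symm
    _ ≤ _ := Real.rpow_le_rpow_of_exponent_le (by linarith) hs.le

theorem one_sub_prime_cpow_ne_zero (p : Nat.Primes) {s : ℂ} (hs : 1 < s.re) :
    1 - ((p : ℕ) : ℂ) ^ (-s) ≠ 0 := by
  have h := norm_prime_cpow_neg_le_half p hs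
  intro h0
  rw [sub_eq_zero] at h0
  rw [← h0, norm_one] at h
  norm_num at h

theorem hasProd_one_sub_prime_cpow {s : ℂ} (hs : 1 < s.re) :
    HasProd (fun p : Nat.Primes => 1 - ((p : ℕ) : ℂ) ^ (-s)) (riemannZeta s)⁻¹ := by
  have h := (riemannZeta_eulerProduct_hasProd hs).inv₀ (riemannZeta_ne_zero_of_one_lt_re hs)
  simpa using h

/-- Uniform approximation of `ζ` and `1/ζ` by partial Euler products on vertical lines. -/
theorem exists_finset_eulerProduct_approx {σ ε : ℝ} (hσ : 1 < σ) (hε : 0 < ε) :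
    ∃ P₀ : Finset Nat.Primes, ∀ P, P₀ ⊆ P → ∀ s : ℂ, s.re = σ →
      ‖∏ p ∈ P, (1 - ((p : ℕ) : ℂ) ^ (-s)) - (riemannZeta s)⁻¹‖ ≤ ε ∧
      ‖∏ p ∈ P, (1 - ((p : ℕ) : ℂ) ^ (-s))⁻¹ - riemannZeta s‖ ≤ ε := by
  classical
  have hsum : Summable fun p : Nat.Primes => ((p : ℕ) : ℝ) ^ (-σ) :=
    Nat.Primes.summable_rpow.2 (by linarith)
  have hn : ∀ (p : Nat.Primes) (s : {s : ℂ // s.re = σ}),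
      ‖((p : ℕ) : ℂ) ^ (-(s : ℂ))‖ = ((p : ℕ) : ℝ) ^ (-σ) := fun p s => by
    rw [Complex.norm_natCast_cpow_of_pos p.2.pos, Complex.neg_re, s.2]
  have hs1 : ∀ s : {s : ℂ // s.re = σ}, 1 < (s : ℂ).re := fun s => by rw [s.2]; exact hσ
  obtain ⟨P₁, hP₁⟩ := exists_finset_norm_prod_sub_le (α := {s : ℂ // s.re = σ})
    (f := fun (p : Nat.Primes) s => -((p : ℕ) : ℂ) ^ (-(s : ℂ))) (F := fun s => (riemannZeta s)⁻¹) hsum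
    (fun p s => by rw [norm_neg, hn])
    (fun s => by simpa [sub_eq_add_neg] using hasProd_one_sub_prime_cpow (hs1 s)) hε
  obtain ⟨P₂, hP₂⟩ := exists_finset_norm_prod_sub_le (α := {s : ℂ // s.re = σ})
    (f := fun (p : Nat.Primes) s => (1 - ((p : ℕ) : ℂ) ^ (-(s : ℂ)))⁻¹ - 1) (F := fun s => riemannZeta s)
    (hsum.mul_left 2)
    (fun p s => by
      have h1 := one_sub_prime_cpow_ne_zero p (hs1 s)
      have e : (1 - ((p : ℕ) : ℂ) ^ (-(s : ℂ)))⁻¹ - 1 =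
          (1 - ((p : ℕ) : ℂ) ^ (-(s : ℂ)))⁻¹ * ((p : ℕ) : ℂ) ^ (-(s : ℂ)) := by
        field_simp; ring
      rw [e, norm_mul, hn]
      refine mul_le_mul_of_nonneg_right ?_ (by positivity)
      have := norm_inv_one_sub_le (x := ((p : ℕ) : ℂ) ^ (-(s : ℂ))) (u := 1)
        (norm_prime_cpow_neg_le_half p (hs1 s)) (by simp)
      simpa using this)
    (fun s => by simpa using riemannZeta_eulerProduct_hasProd (hs1 s)) hε
  refine ⟨P₁ ∪ P₂, fun P hP s hs => ⟨?_, ?_⟩⟩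
  · simpa [sub_eq_add_neg] using hP₁ P (Finset.union_subset_left hP) ⟨s, hs⟩
  · simpa using hP₂ P (Finset.union_subset_right hP) ⟨s, hs⟩

/-- Both bounds hold factor by factor, with `σ = Re s`: `|1 - p^{-s}| ≥ 1 - p^{-σ}`, and `|1 -
p^{-s}| ≤ 1 + p^{-σ} ≤ (1 - p^{-σ})⁻¹`. -/
theorem norm_riemannZeta_le_of_re {s : ℂ} (hs : 1 < s.re) :
    ‖riemannZeta s‖ ≤ ‖riemannZeta s.re‖ ∧ ‖(riemannZeta s)⁻¹‖ ≤ ‖riemannZeta s.re‖ := by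
  have hσ : 1 < ((s.re : ℝ) : ℂ).re := by simpa using hs
  have h0 := (riemannZeta_eulerProduct_hasProd hσ).norm
  have hn : ∀ p : Nat.Primes, ‖((p : ℕ) : ℂ) ^ (-s)‖ = ((p : ℕ) : ℝ) ^ (-s.re) := fun p => by
    rw [Complex.norm_natCast_cpow_of_pos p.2.pos, Complex.neg_re]
  have hr : ∀ p : Nat.Primes, ((p : ℕ) : ℂ) ^ (-(s.re : ℂ)) = ((((p : ℕ) : ℝ) ^ (-s.re) : ℝ) : ℂ) := by
    intro p
    rw [Complex.ofReal_cpow (by positivity)]; simp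
  have hhalf : ∀ p : Nat.Primes, ((p : ℕ) : ℝ) ^ (-s.re) ≤ 1 / 2 := fun p => by
    rw [← hn]; exact norm_prime_cpow_neg_le_half p hs
  have hpos : ∀ p : Nat.Primes, 0 ≤ ((p : ℕ) : ℝ) ^ (-s.re) := fun p => by positivity
  have hnorm : ∀ p : Nat.Primes, ‖(1 - ((p : ℕ) : ℂ) ^ (-(s.re : ℂ)))⁻¹‖ =
      (1 - ((p : ℕ) : ℝ) ^ (-s.re))⁻¹ := fun p => by
    rw [hr, norm_inv, ← Complex.ofReal_one, ← Complex.ofReal_sub, Complex.norm_real,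
      Real.norm_of_nonneg (by linarith [hhalf p])]
  constructor
  · refine le_of_tendsto_of_tendsto' (riemannZeta_eulerProduct_hasProd hs).norm h0 fun P => ?_
    refine Finset.prod_le_prod (fun _ _ => norm_nonneg _) fun p _ => ?_
    rw [hnorm, norm_inv]
    refine inv_anti₀ (by linarith [hhalf p]) ?_
    have := norm_sub_norm_le (1 : ℂ) (((p : ℕ) : ℂ) ^ (-s))
    rwa [norm_one, hn] at this
  · refine le_of_tendsto_of_tendsto' (hasProd_one_sub_prime_cpow hs).norm h0 fun P => ?_
    refine Finset.prod_le_prod (fun _ _ => norm_nonneg _) fun p _ => ?_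
    rw [hnorm]
    refine (norm_sub_le _ _).trans ?_
    rw [norm_one, hn, ← one_div, le_div_iff₀ (by linarith [hhalf p])]
    nlinarith [hpos p]

open Filter Topology in
-- `ζ(1+z) - 1/z` has a limit at `0`, hence is bounded near `0`. Requiring `‖z‖ M ≤ 1/2` keeps `z
-- ζ(1+z)` away from `0`, which allows inversion.
theorem exists_riemannZeta_near_one : ∃ δ M : ℝ, 0 < δ ∧ δ ≤ 1 ∧ 1 ≤ M ∧ ∀ z : ℂ, z ≠ 0 → ‖z‖ < δ →
    ‖riemannZeta (1 + z) - 1 / z‖ ≤ M ∧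
      (0 < z.re → ‖(riemannZeta (1 + z))⁻¹ - z‖ ≤ 2 * M * ‖z‖ ^ 2) := by
  have h := tendsto_riemannZeta_sub_one_div.norm.eventually
    (gt_mem_nhds (lt_add_one ‖(Real.eulerMascheroniConstant : ℂ)‖))
  rw [eventually_nhdsWithin_iff, Metric.eventually_nhds_iff] at h
  obtain ⟨δ₀, hδ₀, h⟩ := h
  set M := ‖(Real.eulerMascheroniConstant : ℂ)‖ + 1 with hM
  have hM1 : 1 ≤ M := by rw [hM]; linarith [norm_nonneg (Real.eulerMascheroniConstant : ℂ)]
  refine ⟨min δ₀ (1 / (2 * M)), M, by positivity, ?_, hM1, fun z hz hzδ => ?_⟩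
  · refine (min_le_right _ _).trans ?_
    rw [div_le_one (by positivity)]; linarith
  have h1 : ‖riemannZeta (1 + z) - 1 / z‖ ≤ M := by
    have := @h (1 + z) (by simpa [dist_eq_norm] using hzδ.trans_le (min_le_left _ _)) (by simpa using hz)
    simpa using this.le
  refine ⟨h1, fun hre => ?_⟩
  have hz2 : ‖z‖ * M ≤ 1 / 2 := by
    have := hzδ.trans_le (min_le_right _ _)
    rw [lt_div_iff₀ (by positivity)] at this
    linarith
  have hne : riemannZeta (1 + z) ≠ 0 := riemannZeta_ne_zero_of_one_lt_re (by simpa using hre)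
  set ζ := riemannZeta (1 + z)
  have hA : ‖z * ζ - 1‖ ≤ ‖z‖ * M := by
    have e : z * ζ - 1 = z * (ζ - 1 / z) := by field_simp
    rw [e, norm_mul]; gcongr
  have hB : 1 / 2 ≤ ‖z * ζ‖ := by
    have := norm_sub_norm_le (1 : ℂ) (1 - z * ζ)
    rw [norm_one, sub_sub_cancel, norm_sub_rev] at this
    linarith
  have e : ζ⁻¹ - z = -((z * ζ - 1) * (z * ζ)⁻¹ * z) := by
    field_simp; ring
  have hi : ‖(z * ζ)⁻¹‖ ≤ 2 := by
    rw [norm_inv]; exact (inv_anti₀ (by norm_num) hB).trans (by norm_num)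
  rw [e, norm_neg, norm_mul, norm_mul]
  calc ‖z * ζ - 1‖ * ‖(z * ζ)⁻¹‖ * ‖z‖ ≤ (‖z‖ * M) * 2 * ‖z‖ := by gcongr
    _ = _ := by ring

/-- The line `Re s = 1 + 1/ℓ`: the inverse of `ζ` is `s - 1` up to a second order error. -/
theorem exists_riemannZeta_line_bounds : ∃ C ℓ₀ : ℝ, 1 ≤ C ∧ 1 ≤ ℓ₀ ∧ ∀ ℓ : ℝ, ℓ₀ ≤ ℓ →
    (∀ v : ℝ, ‖(riemannZeta (1 + lineOne v / ℓ))⁻¹ - lineOne v / ℓ‖ ≤ C * ‖lineOne v‖ ^ 3 / ℓ ^ 2) ∧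
    ∀ v v' : ℝ, ‖riemannZeta (1 + (lineOne v + lineOne v') / ℓ) -
      1 / ((lineOne v + lineOne v') / ℓ)‖ ≤ C * (‖lineOne v‖ * ‖lineOne v'‖) := by
  obtain ⟨δ, M, hδ, hδ1, hM, h⟩ := exists_riemannZeta_near_one
  have hδ3 : 1 ≤ 1 / δ := (one_le_div hδ).2 hδ1
  -- `ℓ ≥ 4/δ` puts the real points `1/ℓ` and `2/ℓ` inside the disc of radius `δ`; the power of `δ`
  -- pays for the points outside it.
  refine ⟨10 * M / δ ^ 3, 4 / δ, ?_, ?_, fun ℓ hℓ => ?_⟩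
  · rw [le_div_iff₀ (by positivity)]
    have : δ ^ 3 ≤ 1 := pow_le_one₀ hδ.le hδ1
    linarith
  · rw [le_div_iff₀ hδ]; linarith
  have hℓδ : 4 ≤ ℓ * δ := (div_le_iff₀ hδ).1 hℓ
  have hℓ4 : 4 ≤ ℓ := by nlinarith
  have hℓ0 : 0 < ℓ := by linarith
  have hreal : ∀ x : ℝ, 0 < x → x < δ → ‖riemannZeta ((1 + x : ℝ) : ℂ)‖ ≤ 1 / x + M := by
    intro x hx hxδ
    have h1 := (h (x : ℂ) (by exact_mod_cast hx.ne') (by simpa [abs_of_pos hx] using hxδ)).1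
    have h2 := norm_sub_norm_le (riemannZeta (1 + x)) (1 / x)
    rw [norm_div, norm_one, Complex.norm_real, Real.norm_of_nonneg hx.le] at h2
    push_cast
    linarith
  have hδ3' : δ ^ 3 ≤ δ := by
    calc δ ^ 3 = δ * δ ^ 2 := by ring
      _ ≤ δ * 1 := by gcongr; exact pow_le_one₀ hδ.le hδ1
      _ = δ := mul_one δ
  constructor
  · intro v
    have ha := one_le_norm_lineOne v
    set τ := lineOne v with hτ
    set a := ‖τ‖ with hadef
    have hre : (τ / ℓ).re = 1 / ℓ := by rw [Complex.div_ofReal_re, hτ, lineOne_re]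
    have hnz : ‖τ / ℓ‖ = a / ℓ := by
      rw [norm_div, Complex.norm_real, Real.norm_of_nonneg hℓ0.le]
    have hz0 : τ / ℓ ≠ 0 := by
      rw [← norm_pos_iff, hnz]; positivity
    by_cases hlt : ‖τ / ℓ‖ < δ
    · refine ((h _ hz0 hlt).2 (by rw [hre]; positivity)).trans ?_
      rw [hnz, div_pow, ← mul_div_assoc]
      gcongr
      · rw [le_div_iff₀ (by positivity)]
        have : δ ^ 3 ≤ 1 := pow_le_one₀ hδ.le hδ1
        nlinarith
      · norm_num
    -- Far from the pole, `‖τ‖ ≥ δℓ`, so the trivial bound `ℓ + M + ‖τ‖/ℓ` is already covered by a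
    -- multiple of `‖τ‖³/ℓ²`.
    · push Not at hlt
      rw [hnz, le_div_iff₀ hℓ0] at hlt
      have hs : 1 < (1 + τ / ℓ).re := by
        rw [Complex.add_re, hre, Complex.one_re]
        have : 0 < 1 / ℓ := by positivity
        linarith
      have h1 := (norm_riemannZeta_le_of_re hs).2
      have h2 : ‖riemannZeta ((1 + τ / ℓ).re : ℂ)‖ ≤ ℓ + M := by
        rw [Complex.add_re, hre, Complex.one_re]
        have := hreal (1 / ℓ) (by positivity) (by rw [div_lt_iff₀ hℓ0]; linarith)
        rwa [one_div_one_div] at this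
      have h3 : ‖(riemannZeta (1 + τ / ℓ))⁻¹ - τ / ℓ‖ ≤ ℓ + M + a / ℓ := by
        refine (norm_sub_le _ _).trans ?_
        rw [hnz]; linarith
      refine h3.trans ?_
      rw [le_div_iff₀ (by positivity), div_mul_eq_mul_div, le_div_iff₀ (by positivity)]
      have h4 : (δ * ℓ) ^ 3 ≤ a ^ 3 := pow_le_pow_left₀ (by positivity) hlt 3
      have h5 : (ℓ + M + a / ℓ) * ℓ ^ 2 * δ ^ 3 =
          (δ * ℓ) ^ 3 + M * ((δ * ℓ) ^ 2 * δ) + a * (δ * ℓ) * δ ^ 2 := by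
        field_simp
      rw [h5]
      have h6 : (δ * ℓ) ^ 2 * δ ≤ a ^ 3 := by
        calc (δ * ℓ) ^ 2 * δ ≤ a ^ 2 * a := by
              gcongr
              linarith
          _ = a ^ 3 := by ring
      have h7 : a * (δ * ℓ) * δ ^ 2 ≤ a ^ 3 := by
        calc a * (δ * ℓ) * δ ^ 2 ≤ a * a * a := by
              gcongr
              nlinarith
          _ = a ^ 3 := by ring
      have h8 : 0 ≤ a ^ 3 := by positivity
      nlinarith [mul_le_mul_of_nonneg_left h6 (by linarith : 0 ≤ M)]
  · intro v v'
    have ha := one_le_norm_lineOne v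
    have hb := one_le_norm_lineOne v'
    set τ := lineOne v with hτ
    set τ' := lineOne v' with hτ'
    set a := ‖τ‖ with hadef
    set b := ‖τ'‖ with hbdef
    have hre : ((τ + τ') / ℓ).re = 2 / ℓ := by
      rw [Complex.div_ofReal_re, Complex.add_re, hτ, hτ', lineOne_re, lineOne_re]; norm_num
    have hrepos : 0 < ((τ + τ') / ℓ).re := by rw [hre]; positivity
    have hz0 : (τ + τ') / ℓ ≠ 0 := fun h0 => by rw [h0] at hrepos; simp at hrepos
    have hn : ‖(τ + τ') / ℓ‖ ≤ 2 * (a * b) / ℓ := by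
      rw [norm_div, Complex.norm_real, Real.norm_of_nonneg hℓ0.le]
      gcongr
      refine (norm_add_le _ _).trans ?_
      nlinarith
    have hab : 1 ≤ a * b := by nlinarith
    have hC : 10 * M / δ ≤ 10 * M / δ ^ 3 := by gcongr
    by_cases hlt : ‖(τ + τ') / ℓ‖ < δ
    · refine ((h _ hz0 hlt).1).trans ?_
      have : M ≤ 10 * M / δ := by rw [le_div_iff₀ hδ]; nlinarith
      nlinarith
    -- Here `δ ≤ 2 ‖τ‖ ‖τ'‖ / ℓ`, so the trivial bound `ℓ/2 + M + 1/δ` is a multiple of `‖τ‖ ‖τ'‖`.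
    · push Not at hlt
      have hs : 1 < (1 + (τ + τ') / ℓ).re := by
        rw [Complex.add_re, Complex.one_re]; linarith
      have h1 := (norm_riemannZeta_le_of_re hs).1
      have h2 : ‖riemannZeta ((1 + (τ + τ') / ℓ).re : ℂ)‖ ≤ ℓ / 2 + M := by
        rw [Complex.add_re, hre, Complex.one_re]
        have := hreal (2 / ℓ) (by positivity) (by rw [div_lt_iff₀ hℓ0]; linarith)
        rwa [one_div_div] at this
      have h4 : ‖1 / ((τ + τ') / ℓ)‖ ≤ 1 / δ := by
        rw [norm_div, norm_one]
        exact one_div_le_one_div_of_le hδ hlt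
      have h5 : ℓ * δ ≤ 2 * (a * b) := by
        have := hlt.trans hn
        rw [le_div_iff₀ hℓ0] at this
        linarith
      have h6 : ‖riemannZeta (1 + (τ + τ') / ℓ) - 1 / ((τ + τ') / ℓ)‖ ≤ ℓ / 2 + M + 1 / δ := by
        refine (norm_sub_le _ _).trans ?_
        linarith
      refine h6.trans (le_trans ?_ (mul_le_mul_of_nonneg_right hC (by positivity)))
      rw [div_mul_eq_mul_div, le_div_iff₀ hδ]
      have h7 : (ℓ / 2 + M + 1 / δ) * δ = ℓ * δ / 2 + M * δ + 1 := by field_simp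
      rw [h7]
      have h8 : a * b ≤ M * (a * b) := le_mul_of_one_le_left (by positivity) hM
      have h9 : M * δ ≤ M * (a * b) := by gcongr; linarith
      linarith

/-- The Euler factor `eulerRatio` in terms of the factors of the zeta function. -/
theorem inv_eulerRatio_eq (p : Nat.Primes) (z z' : ℂ) :
    (eulerRatio (1 / (p : ℕ)) (((p : ℕ) : ℂ) ^ (-z)) (((p : ℕ) : ℂ) ^ (-z')))⁻¹ =
      (1 - ((p : ℕ) : ℂ) ^ (-(1 + z))) * (1 - ((p : ℕ) : ℂ) ^ (-(1 + z'))) *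
        (1 - ((p : ℕ) : ℂ) ^ (-(1 + (z + z'))))⁻¹ := by
  have hp : ((p : ℕ) : ℂ) ≠ 0 := by exact_mod_cast p.2.ne_zero
  have e : ∀ w : ℂ, ((p : ℕ) : ℂ) ^ (-(1 + w)) = ((p : ℕ) : ℂ) ^ (-w) * (1 / (p : ℕ)) := by
    intro w
    rw [neg_add, add_comm, Complex.cpow_add _ _ hp, Complex.cpow_neg_one, one_div]
  have e2 : ((p : ℕ) : ℂ) ^ (-(z + z')) = ((p : ℕ) : ℂ) ^ (-z) * ((p : ℕ) : ℂ) ^ (-z') := by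
    rw [neg_add, Complex.cpow_add _ _ hp]
  rw [e, e, e, e2, eulerRatio, mul_inv, mul_inv, inv_inv, inv_inv]
  ring

/-- The Euler products of the main term, for a large set of primes depending on `ℓ`. -/
theorem exists_prod_inv_eulerRatio_approx : ∃ C ℓ₀ : ℝ, 1 ≤ C ∧ 1 ≤ ℓ₀ ∧ ∀ ℓ : ℝ, ℓ₀ ≤ ℓ →
    ∃ P₀ : Finset Nat.Primes, ∀ P, P₀ ⊆ P → ∀ v v' : ℝ,
      ‖ℓ * ∏ p ∈ P, (eulerRatio (1 / (p : ℕ)) (((p : ℕ) : ℂ) ^ (-(lineOne v / ℓ)))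
          (((p : ℕ) : ℂ) ^ (-(lineOne v' / ℓ))))⁻¹ -
        lineOne v * lineOne v' / (lineOne v + lineOne v')‖ ≤
      C * (‖lineOne v‖ * ‖lineOne v'‖) ^ 4 / ℓ := by
  classical
  obtain ⟨C, ℓ₀, hC, hℓ₀, h⟩ := exists_riemannZeta_line_bounds
  refine ⟨6 * (C + 1) ^ 3, ℓ₀, ?_, hℓ₀, fun ℓ hℓ => ?_⟩
  · have : 1 ≤ (C + 1) ^ 3 := one_le_pow₀ (by linarith)
    linarith
  have hℓ1 : 1 ≤ ℓ := hℓ₀.trans hℓ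
  have hℓ0 : 0 < ℓ := by linarith
  obtain ⟨h1, h2⟩ := h ℓ hℓ
  -- The two inverse zeta factors are as small as `1/ℓ`, so their partial products are needed to
  -- accuracy `1/ℓ²`. The third factor can be as large as `ℓ`, and accuracy `1` is enough for it.
  obtain ⟨P₁, hP₁⟩ := exists_finset_eulerProduct_approx (σ := 1 + 1 / ℓ) (ε := 1 / ℓ ^ 2)
    (by have : 0 < 1 / ℓ := by positivity
        linarith) (by positivity)
  obtain ⟨P₂, hP₂⟩ := exists_finset_eulerProduct_approx (σ := 1 + 2 / ℓ) (ε := 1)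
    (by have : 0 < 2 / ℓ := by positivity
        linarith) (by positivity)
  refine ⟨P₁ ∪ P₂, fun P hP v v' => ?_⟩
  simp only [inv_eulerRatio_eq, Finset.prod_mul_distrib]
  set K := C + 1 with hK
  have hre : ∀ v : ℝ, (1 + lineOne v / ℓ).re = 1 + 1 / ℓ := fun v => by
    rw [Complex.add_re, Complex.div_ofReal_re, lineOne_re, Complex.one_re]
  have hA : ∀ v : ℝ, ‖∏ p ∈ P, (1 - ((p : ℕ) : ℂ) ^ (-(1 + lineOne v / ℓ))) - lineOne v / ℓ‖ ≤
      K * ‖lineOne v‖ ^ 3 / ℓ ^ 2 := by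
    intro v
    have e1 := (hP₁ P (Finset.union_subset_left hP) _ (hre v)).1
    have e2 := h1 v
    have e3 : 1 / ℓ ^ 2 ≤ ‖lineOne v‖ ^ 3 / ℓ ^ 2 := by
      gcongr
      exact one_le_pow₀ (one_le_norm_lineOne v)
    rw [← sub_add_sub_cancel]
    refine (norm_add_le _ _).trans ((add_le_add (e1.trans e3) e2).trans (le_of_eq ?_))
    rw [hK]; ring
  have hB : ‖∏ p ∈ P, (1 - ((p : ℕ) : ℂ) ^ (-(1 + (lineOne v / ℓ + lineOne v' / ℓ))))⁻¹ -
      1 / ((lineOne v + lineOne v') / ℓ)‖ ≤ K * (‖lineOne v‖ * ‖lineOne v'‖) := by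
    rw [← add_div]
    have e1 := (hP₂ P (Finset.union_subset_right hP) (1 + (lineOne v + lineOne v') / ℓ) (by
      rw [Complex.add_re, Complex.div_ofReal_re, Complex.add_re, lineOne_re, lineOne_re,
        Complex.one_re]
      norm_num)).2
    have e2 := h2 v v'
    have e3 : 1 ≤ ‖lineOne v‖ * ‖lineOne v'‖ :=
      one_le_mul_of_one_le_of_one_le (one_le_norm_lineOne v) (one_le_norm_lineOne v')
    rw [← sub_add_sub_cancel]
    refine (norm_add_le _ _).trans ((add_le_add (e1.trans e3) e2).trans (le_of_eq ?_))
    rw [hK]; ring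
  set A := ∏ p ∈ P, (1 - ((p : ℕ) : ℂ) ^ (-(1 + lineOne v / ℓ)))
  set A' := ∏ p ∈ P, (1 - ((p : ℕ) : ℂ) ^ (-(1 + lineOne v' / ℓ)))
  set B := ∏ p ∈ P, (1 - ((p : ℕ) : ℂ) ^ (-(1 + (lineOne v / ℓ + lineOne v' / ℓ))))⁻¹
  have hA1 := hA v
  have hA2 := hA v'
  have ha := one_le_norm_lineOne v
  have hb := one_le_norm_lineOne v'
  have hsum : 2 ≤ ‖lineOne v + lineOne v'‖ := by
    have := Complex.abs_re_le_norm (lineOne v + lineOne v')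
    rw [Complex.add_re, lineOne_re, lineOne_re] at this
    norm_num at this
    exact this
  set τ := lineOne v
  set τ' := lineOne v'
  set a := ‖τ‖
  set b := ‖τ'‖
  have hne : τ + τ' ≠ 0 := fun h0 => by rw [h0] at hsum; norm_num at hsum
  have hℓc : (ℓ : ℂ) ≠ 0 := by exact_mod_cast hℓ0.ne'
  have hK1 : 1 ≤ K := by linarith
  have hw : ‖1 / ((τ + τ') / ℓ)‖ ≤ ℓ / 2 := by
    rw [norm_div, norm_one, norm_div, Complex.norm_real, Real.norm_of_nonneg hℓ0.le, one_div_div]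
    gcongr
  have hz : ‖τ / ℓ‖ = a / ℓ := by rw [norm_div, Complex.norm_real, Real.norm_of_nonneg hℓ0.le]
  have hnA : ∀ (c : ℝ) (A z : ℂ), 1 ≤ c → ‖z‖ = c / ℓ → ‖A - z‖ ≤ K * c ^ 3 / ℓ ^ 2 →
      ‖A‖ ≤ 2 * K * c ^ 3 / ℓ := by
    intro c A z hc hz hAz
    have e1 : ‖A‖ ≤ ‖z‖ + ‖A - z‖ := by
      have := norm_sub_norm_le A z
      linarith
    have e2 : K * c ^ 3 / ℓ ^ 2 ≤ K * c ^ 3 / ℓ := by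
      gcongr
      nlinarith
    have e3 : c / ℓ ≤ K * c ^ 3 / ℓ := by
      gcongr
      have : 1 ≤ c ^ 2 := one_le_pow₀ hc
      nlinarith [mul_le_mul hK1 this zero_le_one (by linarith)]
    calc ‖A‖ ≤ K * c ^ 3 / ℓ + K * c ^ 3 / ℓ := by linarith
      _ = _ := by ring
  have hz' : ‖τ' / ℓ‖ = b / ℓ := by rw [norm_div, Complex.norm_real, Real.norm_of_nonneg hℓ0.le]
  have hnA1 := hnA a A (τ / ℓ) ha hz hA1
  have hnA2 := hnA b A' (τ' / ℓ) hb hz' hA2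
  -- `B`, `A'` and `A` are replaced by their limits one at a time.
  have e : ℓ * (A * A' * B) - τ * τ' / (τ + τ') =
      ℓ * (A * A' * (B - 1 / ((τ + τ') / ℓ))) +
      ℓ * (((A - τ / ℓ) * A' + τ / ℓ * (A' - τ' / ℓ)) * (1 / ((τ + τ') / ℓ))) := by
    field_simp
    ring
  rw [e]
  have hnℓ : ‖(ℓ : ℂ)‖ = ℓ := by rw [Complex.norm_real, Real.norm_of_nonneg hℓ0.le]
  calc _ ≤ ℓ * ((2 * K * a ^ 3 / ℓ) * (2 * K * b ^ 3 / ℓ) * (K * (a * b))) +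
        ℓ * (((K * a ^ 3 / ℓ ^ 2) * (2 * K * b ^ 3 / ℓ) + a / ℓ * (K * b ^ 3 / ℓ ^ 2)) *
          (ℓ / 2)) := by
        refine (norm_add_le _ _).trans (add_le_add ?_ ?_)
        · rw [norm_mul, norm_mul, norm_mul, hnℓ]
          gcongr
        · rw [norm_mul, norm_mul, hnℓ]
          gcongr
          refine (norm_add_le _ _).trans (add_le_add ?_ ?_)
          · rw [norm_mul]; gcongr
          · rw [norm_mul, hz]; gcongr
    _ = (4 * K ^ 3 * (a * b) ^ 4 + K ^ 2 * (a * b) ^ 3 + K * a * b ^ 3 / 2) / ℓ := by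
        field_simp
        ring
    _ ≤ 6 * K ^ 3 * (a * b) ^ 4 / ℓ := by
        gcongr
        have i1 : K ^ 2 * (a * b) ^ 3 ≤ K ^ 3 * (a * b) ^ 4 := by
          gcongr
          · norm_num
          · nlinarith
          · norm_num
        have i2 : K * a * b ^ 3 ≤ K ^ 3 * (a * b) ^ 4 := by
          calc K * a * b ^ 3 ≤ K ^ 3 * a ^ 4 * b ^ 4 := by
                gcongr
                · exact le_self_pow₀ hK1 (by norm_num)
                · exact le_self_pow₀ ha (by norm_num)
                · norm_num
            _ = _ := by ring
        have i3 : 0 ≤ K * a * b ^ 3 := by positivity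
        linarith

/-! ### Equidistribution of a box in residue classes -/

/-- The count is a difference of two floors whose arguments differ by `⌊Z⌋/D`, which costs at most
`1`; passing from `⌊Z⌋` to `Z` costs at most another `1`. -/
theorem abs_card_residue_sub_le (D : ℕ) [NeZero D] (x : ZMod D) {Z : ℝ} (hZ : 0 ≤ Z) :
    |(((Finset.Icc 1 ⌊Z⌋).filter fun m : ℤ => (m : ZMod D) = x).card : ℝ) - Z / D| ≤ 2 := by
  have hD : (0 : ℤ) < D := by exact_mod_cast Nat.pos_of_ne_zero (NeZero.ne D)
  have hDr : (1 : ℝ) ≤ D := by exact_mod_cast Nat.pos_of_ne_zero (NeZero.ne D)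
  have h1 : ((Finset.Icc 1 ⌊Z⌋).filter fun m : ℤ => (m : ZMod D) = x) =
      (Finset.Ioc 0 ⌊Z⌋).filter fun m : ℤ => m ≡ (x.val : ℤ) [ZMOD (D : ℤ)] := by
    have : Finset.Icc 1 ⌊Z⌋ = Finset.Ioc 0 ⌊Z⌋ := by ext; simp [Int.lt_iff_add_one_le]
    rw [this]
    refine Finset.filter_congr fun m _ => ?_
    rw [← ZMod.intCast_eq_intCast_iff]
    simp
  have h2 := Int.Ioc_filter_modEq_card 0 ⌊Z⌋ hD (x.val : ℤ)
  rw [← h1] at h2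
  set N := ((Finset.Icc 1 ⌊Z⌋).filter fun m : ℤ => (m : ZMod D) = x).card
  push_cast at h2
  set y : ℚ := (⌊Z⌋ - x.val) / (D : ℚ) with hy
  set y₀ : ℚ := (0 - x.val) / (D : ℚ) with hy₀
  have hfl : (0 : ℤ) ≤ ⌊Z⌋ := Int.floor_nonneg.2 hZ
  have hdiff : y - y₀ = ⌊Z⌋ / (D : ℚ) := by rw [hy, hy₀]; ring
  have hnn : 0 ≤ y - y₀ := by rw [hdiff]; positivity
  have b1 := Int.floor_le y
  have b2 := Int.lt_floor_add_one y
  have b3 := Int.floor_le y₀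
  have b4 := Int.lt_floor_add_one y₀
  have hN : |(N : ℚ) - ⌊Z⌋ / (D : ℚ)| ≤ 1 := by
    rw [← hdiff]
    have hN' : (N : ℚ) = max ((⌊y⌋ : ℚ) - ⌊y₀⌋) 0 := by exact_mod_cast h2
    rw [hN', abs_le]
    constructor
    · have := le_max_left ((⌊y⌋ : ℚ) - ⌊y₀⌋) 0
      linarith
    · have : max ((⌊y⌋ : ℚ) - ⌊y₀⌋) 0 ≤ y - y₀ + 1 := max_le (by linarith) (by linarith)
      linarith
  have hN2 : |(N : ℝ) - ⌊Z⌋ / (D : ℝ)| ≤ 1 := by exact_mod_cast hN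
  have hN3 : |(⌊Z⌋ : ℝ) / D - Z / D| ≤ 1 := by
    rw [← sub_div, abs_div, abs_of_pos (by linarith : (0 : ℝ) < D), div_le_one (by linarith), abs_le]
    constructor
    · linarith [Int.lt_floor_add_one Z]
    · linarith [Int.floor_le Z]
  calc _ ≤ |(N : ℝ) - ⌊Z⌋ / (D : ℝ)| + |(⌊Z⌋ : ℝ) / D - Z / D| := abs_sub_le _ _ _
    _ ≤ 2 := by linarith

/-- The class is a product of `d` one-dimensional classes, each with relative error at most `2D/Z`.
As `D ≤ Z`, every ratio is at most `3`, which is the base of the constant. -/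
theorem abs_card_residues_sub_le (d D : ℕ) [NeZero D] (a : Fin d → ZMod D) {Z : ℝ}
    (hD : (D : ℝ) ≤ Z) :
    |(((intBox d Z).filter fun n => (fun j => (n j : ZMod D)) = a).card : ℝ) - (Z / D) ^ d| ≤
      (Z / D) ^ d * (2 * d * 3 ^ d * (D / Z)) := by
  have hDr : (1 : ℝ) ≤ D := by exact_mod_cast Nat.pos_of_ne_zero (NeZero.ne D)
  have hZ : 0 < Z := by linarith
  have hq : 0 < Z / D := by positivity
  have h1 : ((intBox d Z).filter fun n => (fun j => (n j : ZMod D)) = a) =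
      Fintype.piFinset fun j => (Finset.Icc 1 ⌊Z⌋).filter fun m : ℤ => (m : ZMod D) = a j := by
    ext n
    simp only [intBox, Finset.mem_filter, Fintype.mem_piFinset, funext_iff, forall_and]
  rw [h1, Fintype.card_piFinset]
  push_cast
  set c : Fin d → ℝ := fun j =>
    (((Finset.Icc 1 ⌊Z⌋).filter fun m : ℤ => (m : ZMod D) = a j).card : ℝ) with hc
  have hcb : ∀ j, ‖c j / (Z / D) - 1‖ ≤ 2 * (D / Z) := fun j => by
    have := abs_card_residue_sub_le D (a j) hZ.le
    rw [div_sub_one hq.ne', Real.norm_eq_abs, abs_div, abs_of_pos hq, div_le_iff₀ hq]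
    refine this.trans (le_of_eq ?_)
    field_simp
  have hle : 2 * (D / Z) ≤ 2 := by
    have : D / Z ≤ 1 := (div_le_one hZ).2 hD
    linarith
  have hp := norm_prod_sub_prod_le_pow (M := 3) (by norm_num) (a := fun j => c j / (Z / D))
    (b := fun _ => (1 : ℝ))
    (fun j => by
      have := norm_sub_norm_le (c j / (Z / D)) 1
      rw [norm_one] at this
      linarith [hcb j])
    (fun _ => by norm_num)
  rw [Finset.prod_const_one, Finset.prod_div_distrib, Finset.prod_const, Finset.card_univ,
    Fintype.card_fin] at hp
  have e : ∏ j, c j - (Z / D) ^ d = (Z / D) ^ d * ((∏ j, c j) / (Z / D) ^ d - 1) := by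
    field_simp
  rw [e, abs_mul, abs_of_pos (by positivity)]
  refine mul_le_mul_of_nonneg_left (hp.trans ?_) (by positivity)
  calc (3 : ℝ) ^ d * ∑ j, ‖c j / (Z / D) - 1‖ ≤ 3 ^ d * ∑ _j : Fin d, 2 * (D / Z) := by
        gcongr with j
        exact hcb j
    _ = _ := by simp; ring

theorem abs_sum_intBox_sub_le (d D : ℕ) [NeZero D] (G : (Fin d → ZMod D) → ℝ)
    (hG : ∀ a, |G a| ≤ 1) {Z : ℝ} (hD : (D : ℝ) ≤ Z) :
    |∑ n ∈ intBox d Z, G (fun j => (n j : ZMod D)) - Z ^ d * ((∑ a, G a) / (D : ℝ) ^ d)| ≤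
      2 * d * 3 ^ d * Z ^ d * (D / Z) := by
  have hDr : (1 : ℝ) ≤ D := by exact_mod_cast Nat.pos_of_ne_zero (NeZero.ne D)
  have hZ : 0 < Z := by linarith
  have h1 : ∑ n ∈ intBox d Z, G (fun j => (n j : ZMod D)) =
      ∑ a, (((intBox d Z).filter fun n => (fun j => (n j : ZMod D)) = a).card : ℝ) * G a := by
    rw [← Finset.sum_fiberwise (intBox d Z) (fun n => fun j => (n j : ZMod D))]
    refine Finset.sum_congr rfl fun a _ => ?_
    rw [← nsmul_eq_mul, ← Finset.sum_const]
    exact Finset.sum_congr rfl fun n hn => by rw [(Finset.mem_filter.1 hn).2]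
  have h2 : Z ^ d * ((∑ a, G a) / (D : ℝ) ^ d) = ∑ a, (Z / D) ^ d * G a := by
    rw [← Finset.mul_sum, div_pow]; ring
  rw [h1, h2, ← Finset.sum_sub_distrib]
  calc _ ≤ ∑ a : Fin d → ZMod D, (Z / D) ^ d * (2 * d * 3 ^ d * (D / Z)) * 1 := by
        refine (Finset.abs_sum_le_sum_abs _ _).trans (Finset.sum_le_sum fun a _ => ?_)
        rw [← sub_mul, abs_mul]
        exact mul_le_mul (abs_card_residues_sub_le d D a hD) (hG a) (abs_nonneg _) (by positivity)
    _ = _ := by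
        rw [Finset.sum_const, Finset.card_univ, Fintype.card_fun, ZMod.card, Fintype.card_fin,
          nsmul_eq_mul, div_pow]
        push_cast
        field_simp

/-- A box of side `Z` is equidistributed modulo a finite set of primes with product at most `Z`. -/
theorem abs_sum_intBox_prod_sub_le (d : ℕ) (Q : Finset Nat.Primes)
    (F : ∀ p : Nat.Primes, (Fin d → ZMod (p : ℕ)) → ℝ) (hF0 : ∀ p b, 0 ≤ F p b)
    (hF1 : ∀ p b, F p b ≤ 1) {Z : ℝ} (hZ : ∏ p ∈ Q, ((p : ℕ) : ℝ) ≤ Z) :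
    |∑ n ∈ intBox d Z, ∏ p ∈ Q, F p (fun j => (n j : ZMod (p : ℕ))) -
        Z ^ d * ∏ p ∈ Q, ((∑ b, F p b) / ((p : ℕ) : ℝ) ^ d)| ≤
      2 * d * 3 ^ d * Z ^ d * ((∏ p ∈ Q, ((p : ℕ) : ℝ)) / Z) := by
  classical
  set m : Q → ℕ := fun q => ((q : Nat.Primes) : ℕ) with hm
  set D : ℕ := ∏ q, m q with hD
  have hDne : NeZero D := ⟨Finset.prod_ne_zero_iff.2 fun q _ => (q : Nat.Primes).2.ne_zero⟩
  have hcop : Pairwise (Function.onFun Nat.Coprime m) := fun q q' hqq' =>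
    (Nat.coprime_primes (q : Nat.Primes).2 (q' : Nat.Primes).2).2
      fun h => hqq' (Subtype.ext (Subtype.ext h))
  -- Chinese remainder theorem: residues modulo the product are independent residues modulo the
  -- primes of `Q`, so the mean factorises.
  set e : (Fin d → ZMod D) ≃ (∀ q : Q, Fin d → ZMod (m q)) :=
    (Equiv.piCongrRight fun _ => (ZMod.prodEquivPi m hcop).toEquiv).trans (Equiv.piComm _) with he
  set G : (Fin d → ZMod D) → ℝ := fun a => ∏ q : Q, F q (e a q) with hGdef
  have hDr : (D : ℝ) = ∏ p ∈ Q, ((p : ℕ) : ℝ) := by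
    rw [hD, Nat.cast_prod, ← Finset.prod_coe_sort Q]
  have hInt : ∀ n : Fin d → ℤ, G (fun j => (n j : ZMod D)) =
      ∏ p ∈ Q, F p (fun j => (n j : ZMod (p : ℕ))) := by
    intro n
    rw [hGdef, ← Finset.prod_coe_sort Q]
    refine Finset.prod_congr rfl fun q _ => ?_
    congr 1
    funext j
    change ZMod.prodEquivPi m hcop (n j : ZMod D) q = _
    rw [map_intCast, Pi.intCast_apply]
  have hsum : (∑ a, G a) / (D : ℝ) ^ d = ∏ p ∈ Q, ((∑ b, F p b) / ((p : ℕ) : ℝ) ^ d) := by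
    have h1 : ∑ a, G a = ∑ b : (∀ q : Q, Fin d → ZMod (m q)), ∏ q : Q, F q (b q) :=
      Fintype.sum_equiv e _ _ fun a => rfl
    have h2 := Finset.prod_univ_sum (fun q : Q => (Finset.univ : Finset (Fin d → ZMod (m q))))
      (fun q b => F q b)
    rw [Fintype.piFinset_univ] at h2
    rw [h1, ← h2, Finset.prod_div_distrib, ← Finset.prod_coe_sort Q (fun p => ∑ b, F p b),
      Finset.prod_pow, hDr]
  have hmain := abs_sum_intBox_sub_le d D G (fun a => by
    rw [abs_of_nonneg (Finset.prod_nonneg fun q _ => hF0 _ _)]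
    exact Finset.prod_le_one (fun q _ => hF0 _ _) fun q _ => hF1 _ _) (Z := Z) (by rw [hDr]; exact hZ)
  simp only [hInt] at hmain
  rwa [hsum, hDr] at hmain

/-! ### The truncated divisor sum as a sum over sets of primes -/

/-- The product of a finite set of primes. -/
def primeProd (s : Finset Nat.Primes) : ℕ := ∏ p ∈ s, (p : ℕ)

theorem primeProd_eq_prod_map (s : Finset Nat.Primes) :
    primeProd s = ∏ p ∈ s.map ⟨fun p : Nat.Primes => (p : ℕ), Subtype.val_injective⟩, p := by
  rw [Finset.prod_map]; rfl

theorem primeFactors_primeProd (s : Finset Nat.Primes) :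
    (primeProd s).primeFactors = s.map ⟨fun p : Nat.Primes => (p : ℕ), Subtype.val_injective⟩ := by
  rw [primeProd_eq_prod_map]
  refine Nat.primeFactors_prod fun p hp => ?_
  obtain ⟨q, -, rfl⟩ := Finset.mem_map.1 hp
  exact q.2

theorem primeProd_injective : Function.Injective primeProd := fun s s' h => by
  have := primeFactors_primeProd s
  rw [h, primeFactors_primeProd] at this
  exact (Finset.map_injective _ this).symm

theorem primeProd_pos (s : Finset Nat.Primes) : 0 < primeProd s :=
  Finset.prod_pos fun p _ => p.2.pos

theorem log_primeProd (s : Finset Nat.Primes) :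
    Real.log (primeProd s) = ∑ p ∈ s, Real.log (p : ℕ) := by
  rw [primeProd, Nat.cast_prod, Real.log_prod]
  exact fun p _ => by exact_mod_cast p.2.ne_zero

theorem moebius_primeProd (s : Finset Nat.Primes) :
    ArithmeticFunction.moebius (primeProd s) = (-1) ^ s.card := by
  rw [primeProd_eq_prod_map,
    ArithmeticFunction.isMultiplicative_moebius.map_prod_of_prime _ fun p hp => by
      obtain ⟨q, -, rfl⟩ := Finset.mem_map.1 hp
      exact q.2, Finset.prod_map]
  rw [Finset.prod_congr rfl fun p _ => ArithmeticFunction.moebius_apply_prime p.2,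
    Finset.prod_const]

theorem primeProd_dvd_iff (s : Finset Nat.Primes) (n : ℤ) :
    (primeProd s : ℤ) ∣ n ↔ ∀ p ∈ s, ((p : ℕ) : ℤ) ∣ n := by
  constructor
  · intro h p hp
    exact (Int.natCast_dvd_natCast.2 (Finset.dvd_prod_of_mem _ hp)).trans h
  · intro h
    rw [Int.natCast_dvd, primeProd_eq_prod_map]
    refine Finset.prod_primes_dvd _ (fun p hp => ?_) fun p hp => ?_
    · obtain ⟨q, -, rfl⟩ := Finset.mem_map.1 hp
      exact q.2.prime
    · obtain ⟨q, hq, rfl⟩ := Finset.mem_map.1 hp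
      exact Int.natCast_dvd.1 (h q hq)

theorem exists_primeProd_eq {m : ℕ} (hm : Squarefree m) : ∃ s, primeProd s = m := by
  classical
  set f : m.primeFactors → Nat.Primes := fun p => ⟨p, Nat.prime_of_mem_primeFactors p.2⟩ with hf
  have hinj : Function.Injective f := fun p q h => 
    Subtype.ext (congrArg (fun r : Nat.Primes => (r : ℕ)) h)
  refine ⟨m.primeFactors.attach.image f, ?_⟩
  rw [primeProd, Finset.prod_image hinj.injOn]
  exact (Finset.prod_attach m.primeFactors fun p => p).trans (Nat.prod_primeFactors_of_squarefree hm)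

theorem mem_of_mem_of_primeProd_le {s : Finset Nat.Primes} {x : ℝ} (hs : (primeProd s : ℝ) ≤ x)
    {p : Nat.Primes} (hp : p ∈ s) : ((p : ℕ) : ℝ) ≤ x := by
  refine le_trans ?_ hs
  exact_mod_cast Nat.le_of_dvd (primeProd_pos s) (Finset.dvd_prod_of_mem _ hp)

theorem le_rpow_of_apply_log_ne_zero {χ : ℝ → ℝ} {S R : ℝ} (hR : 1 < R)
    (hS : Function.support χ ⊆ Set.Icc (-S) S) {m : ℝ} (hm : 0 < m)
    (h : χ (Real.log m / Real.log R) ≠ 0) : m ≤ R ^ S := by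
  have h1 := (hS h).2
  rw [div_le_iff₀ (Real.log_pos hR)] at h1
  rwa [← Real.log_le_log_iff hm (by positivity), Real.log_rpow (by linarith)]

/-- The sum over sets of primes in `P`, weighted by `∏ (-x_p)` and `χ`. -/
noncomputable def sieveSum (χ : ℝ → ℝ) (ℓ : ℝ) (P : Finset Nat.Primes) (x : Nat.Primes → ℝ) : ℝ :=
  ∑ s ∈ P.powerset, (∏ p ∈ s, (-x p)) * χ ((∑ p ∈ s, Real.log (p : ℕ)) / ℓ)

open Classical in
-- `μ` removes the divisors that are not squarefree and `χ` those above `R^S`; the rest are products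
-- of subsets of `P`. Divisibility is tested prime by prime, so `n = 0` needs no separate treatment.
theorem truncatedDivisorSum_eq_sieveSum {χ : ℝ → ℝ} {S R : ℝ} (hR : 1 < R)
    (hS : Function.support χ ⊆ Set.Icc (-S) S) {P : Finset Nat.Primes}
    (hP : ∀ p : Nat.Primes, ((p : ℕ) : ℝ) ≤ R ^ S → p ∈ P) (n : ℤ) :
    truncatedDivisorSum χ R n = Real.log R *
      sieveSum χ (Real.log R) P (fun p => if ((p : ℕ) : ℤ) ∣ n then 1 else 0) ^ 2 := by
  rw [truncatedDivisorSum]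
  congr 2
  set f : ℕ → ℝ := fun m => (ArithmeticFunction.moebius m : ℝ) * χ (Real.log m / Real.log R) with hf
  rw [finsum_mem_eq_sum_of_inter_support_eq (f := f)
    (t := (P.powerset.filter fun s =>
      ∀ p : Nat.Primes, p ∈ s → ((p : ℕ) : ℤ) ∣ n).image primeProd) ?_]
  · rw [Finset.sum_image primeProd_injective.injOn, Finset.sum_filter, sieveSum]
    refine Finset.sum_congr rfl fun s _ => ?_
    split_ifs with h
    · rw [hf]
      simp only [moebius_primeProd, log_primeProd]
      rw [Finset.prod_congr rfl fun p hp => by rw [if_pos (h p hp)], Finset.prod_const]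
      push_cast; rfl
    · push Not at h
      obtain ⟨p, hp, hpn⟩ := h
      rw [Finset.prod_eq_zero hp (by rw [if_neg hpn, neg_zero]), zero_mul]
  · ext m
    simp only [Set.mem_inter_iff, Function.mem_support, Finset.coe_image, Set.mem_image,
      Finset.mem_coe, Finset.mem_filter, Finset.mem_powerset]
    refine and_congr_left fun hfm => ?_
    constructor
    · rintro ⟨hm, hmn⟩
      have hsq : Squarefree m := by
        rw [← ArithmeticFunction.moebius_ne_zero_iff_squarefree]
        intro h0
        exact hfm (by simp [hf, h0])
      obtain ⟨s, rfl⟩ := exists_primeProd_eq hsq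
      refine ⟨s, ⟨fun p hp => hP p ?_, (primeProd_dvd_iff s n).1 hmn⟩, rfl⟩
      refine mem_of_mem_of_primeProd_le ?_ hp
      exact le_rpow_of_apply_log_ne_zero hR hS (by exact_mod_cast hm) (right_ne_zero_of_mul hfm)
    · rintro ⟨s, ⟨-, hs⟩, rfl⟩
      exact ⟨primeProd_pos s, (primeProd_dvd_iff s n).2 hs⟩

/-- By unique factorisation, the sets with nonzero weight inject into the positive integers up to
`R^S`. -/
theorem sum_abs_weight_le {χ : ℝ → ℝ} {S R K : ℝ} (hR : 1 < R)
    (hS : Function.support χ ⊆ Set.Icc (-S) S) (hK : ∀ x, |χ x| ≤ K) (P : Finset Nat.Primes) :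
    ∑ s ∈ P.powerset, |χ ((∑ p ∈ s, Real.log (p : ℕ)) / Real.log R)| ≤ K * R ^ S := by
  classical
  have hK0 : 0 ≤ K := (abs_nonneg _).trans (hK 0)
  have hRS : 0 ≤ R ^ S := by positivity
  set T := P.powerset.filter fun s => (primeProd s : ℝ) ≤ R ^ S with hT
  have h1 : ∑ s ∈ P.powerset, |χ ((∑ p ∈ s, Real.log (p : ℕ)) / Real.log R)| =
      ∑ s ∈ T, |χ ((∑ p ∈ s, Real.log (p : ℕ)) / Real.log R)| := by
    rw [hT, Finset.sum_filter]
    refine Finset.sum_congr rfl fun s _ => ?_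
    split_ifs with h
    · rfl
    · rw [abs_eq_zero]
      by_contra h0
      rw [← log_primeProd] at h0
      exact h (le_rpow_of_apply_log_ne_zero hR hS (by exact_mod_cast primeProd_pos s) h0)
  have hcard : (T.card : ℝ) ≤ R ^ S := by
    have : T.card ≤ (Finset.Icc 1 ⌊R ^ S⌋₊).card := by
      refine Finset.card_le_card_of_injOn primeProd (fun s hs => ?_) primeProd_injective.injOn
      rw [Finset.mem_coe, Finset.mem_Icc]
      exact ⟨primeProd_pos s, Nat.le_floor (Finset.mem_filter.1 hs).2⟩
    rw [Nat.card_Icc, Nat.add_sub_cancel] at this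
    exact (Nat.cast_le.2 this).trans (Nat.floor_le hRS)
  rw [h1]
  refine (Finset.sum_le_card_nsmul _ _ K fun s _ => hK _).trans ?_
  rw [nsmul_eq_mul, mul_comm]
  exact mul_le_mul_of_nonneg_left hcard hK0

/-! ### The main term of the correlation sum -/

section MainTerm

open MeasureTheory

/-- Signed weight of a pair of sets of primes. -/
noncomputable def pairWeight (χ : ℝ → ℝ) (ℓ : ℝ) (q : Finset Nat.Primes × Finset Nat.Primes) : ℝ :=
  ((-1) ^ q.1.card * χ ((∑ p ∈ q.1, Real.log (p : ℕ)) / ℓ)) *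
    ((-1) ^ q.2.card * χ ((∑ p ∈ q.2, Real.log (p : ℕ)) / ℓ))

open Classical in
/-- The factor at `p` of the indicator attached to the family `σ` of pairs of sets of primes. -/
noncomputable def primeWeight {t : ℕ} (σ : Fin t → Finset Nat.Primes × Finset Nat.Primes)
    (p : Nat.Primes) (x : Fin t → ℝ) : ℝ :=
  ∏ i, (if p ∈ (σ i).1 then x i else 1) * (if p ∈ (σ i).2 then x i else 1)

theorem prod_neg_eq_of_subset {P s : Finset Nat.Primes} [DecidableEq Nat.Primes] (hs : s ⊆ P)
    (x : Nat.Primes → ℝ) :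
    ∏ p ∈ s, (-x p) = (-1) ^ s.card * ∏ p ∈ P, if p ∈ s then x p else 1 := by
  rw [Finset.prod_neg, Finset.prod_ite_mem, Finset.inter_eq_right.2 hs]

/-- Expanding all `2t` sums decouples the sign and `χ` weights from the divisibility conditions, and
the latter then factor over primes. -/
theorem prod_sieveSum_sq {t : ℕ} (χ : ℝ → ℝ) (ℓ : ℝ) (P : Finset Nat.Primes)
    (x : Fin t → Nat.Primes → ℝ) :
    ∏ i, sieveSum χ ℓ P (x i) ^ 2 =
      ∑ σ ∈ Fintype.piFinset fun _ : Fin t => P.powerset ×ˢ P.powerset,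
        (∏ i, pairWeight χ ℓ (σ i)) * ∏ p ∈ P, primeWeight σ p (fun i => x i p) := by
  classical
  have h1 : ∀ i, sieveSum χ ℓ P (x i) ^ 2 = ∑ q ∈ P.powerset ×ˢ P.powerset,
      pairWeight χ ℓ q * ∏ p ∈ P,
        ((if p ∈ q.1 then x i p else 1) * (if p ∈ q.2 then x i p else 1)) := by
    intro i
    rw [sq, sieveSum, Finset.sum_mul_sum, ← Finset.sum_product']
    refine Finset.sum_congr rfl fun q hq => ?_
    rw [Finset.mem_product, Finset.mem_powerset, Finset.mem_powerset] at hq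
    rw [prod_neg_eq_of_subset hq.1, prod_neg_eq_of_subset hq.2, pairWeight, Finset.prod_mul_distrib]
    ring
  simp only [h1]
  rw [Finset.prod_univ_sum]
  refine Finset.sum_congr rfl fun σ _ => ?_
  rw [Finset.prod_mul_distrib, Finset.prod_comm]
  congr 1

theorem sum_abs_pairWeight_le {t : ℕ} {χ : ℝ → ℝ} {S R K : ℝ} (hR : 1 < R)
    (hS : Function.support χ ⊆ Set.Icc (-S) S) (hK : ∀ x, |χ x| ≤ K) (P : Finset Nat.Primes) :
    ∑ σ ∈ Fintype.piFinset fun _ : Fin t => P.powerset ×ˢ P.powerset,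
      |∏ i, pairWeight χ (Real.log R) (σ i)| ≤ ((K * R ^ S) ^ 2) ^ t := by
  simp only [Finset.abs_prod]
  rw [← Finset.prod_univ_sum (fun _ : Fin t => P.powerset ×ˢ P.powerset)
    (fun _ q => |pairWeight χ (Real.log R) q|), Finset.prod_const, Finset.card_univ,
    Fintype.card_fin]
  refine pow_le_pow_left₀ (Finset.sum_nonneg fun _ _ => abs_nonneg _) ?_ t
  have h := sum_abs_weight_le hR hS hK P
  have e : ∑ q ∈ P.powerset ×ˢ P.powerset, |pairWeight χ (Real.log R) q| =
      (∑ s ∈ P.powerset, |χ ((∑ p ∈ s, Real.log (p : ℕ)) / Real.log R)|) ^ 2 := by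
    rw [sq, Finset.sum_mul_sum, ← Finset.sum_product']
    refine Finset.sum_congr rfl fun q _ => ?_
    simp [pairWeight, abs_mul]
  rw [e]
  exact pow_le_pow_left₀ (Finset.sum_nonneg fun _ _ => abs_nonneg _) h 2

theorem primeWeight_mem {t : ℕ} (σ : Fin t → Finset Nat.Primes × Finset Nat.Primes)
    (p : Nat.Primes) {x : Fin t → ℝ} (h0 : ∀ i, 0 ≤ x i) (h1 : ∀ i, x i ≤ 1) :
    0 ≤ primeWeight σ p x ∧ primeWeight σ p x ≤ 1 := by
  have hnn : ∀ (i : Fin t) (c : Prop) [Decidable c], (0 : ℝ) ≤ if c then x i else 1 := by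
    intro i c _; split_ifs <;> [exact h0 i; exact zero_le_one]
  have hle : ∀ (i : Fin t) (c : Prop) [Decidable c], (if c then x i else 1) ≤ (1 : ℝ) := by
    intro i c _; split_ifs <;> [exact h1 i; exact le_rfl]
  exact ⟨Finset.prod_nonneg fun i _ => mul_nonneg (hnn i _) (hnn i _),
    Finset.prod_le_one (fun i _ => mul_nonneg (hnn i _) (hnn i _)) fun i _ =>
      mul_le_one₀ (hle i _) (hnn i _) (hle i _)⟩

namespace AffineSystem

variable {d t : ℕ}

open Classical in
/-- The indicators of the zeros of `ψ_i` along a choice of residues modulo the primes in `P`. -/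
noncomputable def residueInd (Ψ : AffineSystem d t) {P : Finset Nat.Primes}
    (b : ∀ q : P, Fin d → ZMod ((q : Nat.Primes) : ℕ)) (i : Fin t) (p : Nat.Primes) : ℝ :=
  if h : p ∈ P then Ψ.zeroInd (ZMod (p : ℕ)) i (b ⟨p, h⟩) else 0

/-- The mean of the correlation over all residue classes modulo the primes in `P`. -/
noncomputable def sieveMean (Ψ : AffineSystem d t) (χ : ℝ → ℝ) (ℓ : ℝ) (P : Finset Nat.Primes) : ℝ :=
  (∑ b : (∀ q : P, Fin d → ZMod ((q : Nat.Primes) : ℕ)),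
    ∏ i, sieveSum χ ℓ P (Ψ.residueInd b i) ^ 2) / ∏ p ∈ P, ((p : ℕ) : ℝ) ^ d

theorem residueInd_coe (Ψ : AffineSystem d t) {P : Finset Nat.Primes}
    (b : ∀ q : P, Fin d → ZMod ((q : Nat.Primes) : ℕ)) (i : Fin t) (q : P) :
    Ψ.residueInd b i q = Ψ.zeroInd (ZMod ((q : Nat.Primes) : ℕ)) i (b q) := by
  rw [residueInd, dif_pos q.2]

theorem sum_residues_prod {R : Type*} [CommRing R] (d : ℕ) (P : Finset Nat.Primes)
    (f : ∀ p : Nat.Primes, (Fin d → ZMod (p : ℕ)) → R) :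
    ∑ b : (∀ q : P, Fin d → ZMod ((q : Nat.Primes) : ℕ)), ∏ q : P, f q (b q) =
      ∏ p ∈ P, ∑ a, f p a := by
  have h2 := Finset.prod_univ_sum
    (fun q : P => (Finset.univ : Finset (Fin d → ZMod ((q : Nat.Primes) : ℕ)))) (fun q b => f q b)
  rw [Fintype.piFinset_univ] at h2
  rw [← h2, ← Finset.prod_coe_sort P (fun p => ∑ b, f p b)]

theorem sieveMean_eq_sum (Ψ : AffineSystem d t) (χ : ℝ → ℝ) (ℓ : ℝ) (P : Finset Nat.Primes) :
    Ψ.sieveMean χ ℓ P = ∑ σ ∈ Fintype.piFinset fun _ : Fin t => P.powerset ×ˢ P.powerset,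
      (∏ i, pairWeight χ ℓ (σ i)) * ∏ p ∈ P,
        ((∑ a, primeWeight σ p (fun i => Ψ.zeroInd (ZMod (p : ℕ)) i a)) / ((p : ℕ) : ℝ) ^ d) := by
  rw [sieveMean]
  simp only [prod_sieveSum_sq]
  rw [Finset.sum_comm, Finset.sum_div]
  refine Finset.sum_congr rfl fun σ _ => ?_
  rw [← Finset.mul_sum, mul_div_assoc, Finset.prod_div_distrib, ← sum_residues_prod]
  congr 2
  refine Finset.sum_congr rfl fun b _ => ?_
  rw [← Finset.prod_coe_sort P]
  refine Finset.prod_congr rfl fun q _ => ?_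
  simp only [residueInd_coe]

theorem zeroInd_intCast (Ψ : AffineSystem d t) (p : Nat.Primes) (i : Fin t) (n : Fin d → ℤ) :
    Ψ.zeroInd (ZMod (p : ℕ)) i (fun j => (n j : ZMod (p : ℕ))) =
      if ((p : ℕ) : ℤ) ∣ Ψ.form ℤ i n then 1 else 0 := by
  have h : Ψ.form (ZMod (p : ℕ)) i (fun j => (n j : ZMod (p : ℕ))) =
      ((Ψ.form ℤ i n : ℤ) : ZMod (p : ℕ)) := by
    simp [form]
  rw [zeroInd, h]
  simp only [ZMod.intCast_zmod_eq_zero_iff_dvd]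

open Classical in
-- Each of the `2t` sets has product at most `R^S`, and the filtered primes lie in their union.
theorem prod_support_le {t : ℕ} {P : Finset Nat.Primes} {χ : ℝ → ℝ} {S R : ℝ} (hR : 1 < R)
    (hS : Function.support χ ⊆ Set.Icc (-S) S)
    {σ : Fin t → Finset Nat.Primes × Finset Nat.Primes}
    (h : ∏ i, pairWeight χ (Real.log R) (σ i) ≠ 0) :
    ∏ p ∈ P.filter (fun p => ∃ i, p ∈ (σ i).1 ∨ p ∈ (σ i).2), ((p : ℕ) : ℝ) ≤ R ^ (2 * t * S) := by
  have hlR := Real.log_pos hR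
  have hpos : ∀ p : Nat.Primes, (0 : ℝ) < (p : ℕ) := fun p => by exact_mod_cast p.2.pos
  have hsub : P.filter (fun p => ∃ i, p ∈ (σ i).1 ∨ p ∈ (σ i).2) ⊆
      Finset.univ.biUnion fun i => (σ i).1 ∪ (σ i).2 := by
    intro p hp
    obtain ⟨i, hi⟩ := (Finset.mem_filter.1 hp).2
    exact Finset.mem_biUnion.2 ⟨i, Finset.mem_univ i, Finset.mem_union.2 hi⟩
  rw [← Real.log_le_log_iff (Finset.prod_pos fun p _ => hpos p) (by positivity),
    Real.log_rpow (by linarith), Real.log_prod fun p _ => (hpos p).ne']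
  have hnn : ∀ p : Nat.Primes, 0 ≤ Real.log (p : ℕ) := fun p => Real.log_natCast_nonneg _
  have hχ : ∀ s : Finset Nat.Primes, χ ((∑ p ∈ s, Real.log (p : ℕ)) / Real.log R) ≠ 0 →
      ∑ p ∈ s, Real.log (p : ℕ) ≤ S * Real.log R := fun s hs =>
    (div_le_iff₀ hlR).1 (hS hs).2
  calc _ ≤ ∑ p ∈ Finset.univ.biUnion fun i => (σ i).1 ∪ (σ i).2, Real.log (p : ℕ) :=
        Finset.sum_le_sum_of_subset_of_nonneg hsub fun p _ _ => hnn p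
    _ ≤ ∑ i, ∑ p ∈ (σ i).1 ∪ (σ i).2, Real.log (p : ℕ) := sum_biUnion_le_sum_sum _ _ _ hnn
    _ ≤ ∑ _i : Fin t, 2 * (S * Real.log R) := by
        refine Finset.sum_le_sum fun i _ => ?_
        have hi := Finset.prod_ne_zero_iff.1 h i (Finset.mem_univ i)
        have e1 := hχ _ (right_ne_zero_of_mul (left_ne_zero_of_mul hi))
        have e2 := hχ _ (right_ne_zero_of_mul (right_ne_zero_of_mul hi))
        have e3 := Finset.sum_union_inter (s₁ := (σ i).1) (s₂ := (σ i).2)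
          (f := fun p : Nat.Primes => Real.log (p : ℕ))
        have e4 : 0 ≤ ∑ p ∈ (σ i).1 ∩ (σ i).2, Real.log (p : ℕ) :=
          Finset.sum_nonneg fun p _ => hnn p
        linarith
    _ = _ := by simp; ring

/-- The correlation sum over a box is close to the mean over residue classes. -/
theorem abs_sum_prod_truncatedDivisorSum_sub_le (Ψ : AffineSystem d t) {χ : ℝ → ℝ} {S R K Z : ℝ}
    (hR : 1 < R) (hS : Function.support χ ⊆ Set.Icc (-S) S) (hK : ∀ x, |χ x| ≤ K)
    {P : Finset Nat.Primes} (hP : ∀ p : Nat.Primes, ((p : ℕ) : ℝ) ≤ R ^ S → p ∈ P)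
    (hZ : R ^ (2 * t * S) ≤ Z) :
    |∑ n ∈ intBox d Z, ∏ i, truncatedDivisorSum χ R (Ψ.form ℤ i n) -
        Z ^ d * (Real.log R ^ t * Ψ.sieveMean χ (Real.log R) P)| ≤
      Real.log R ^ t * (((K * R ^ S) ^ 2) ^ t * (2 * d * 3 ^ d * Z ^ d * (R ^ (2 * t * S) / Z))) := by
  classical
  have hlR := Real.log_pos hR
  have hZ0 : 0 < Z := lt_of_lt_of_le (by positivity) hZ
  set T := Fintype.piFinset fun _ : Fin t => P.powerset ×ˢ P.powerset
  set F : (Fin t → Finset Nat.Primes × Finset Nat.Primes) → ∀ p : Nat.Primes,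
    (Fin d → ZMod (p : ℕ)) → ℝ := fun σ p a => primeWeight σ p (fun i => Ψ.zeroInd (ZMod (p : ℕ)) i a)
    with hF
  have h1 : ∑ n ∈ intBox d Z, ∏ i, truncatedDivisorSum χ R (Ψ.form ℤ i n) = Real.log R ^ t *
      ∑ σ ∈ T, (∏ i, pairWeight χ (Real.log R) (σ i)) *
        ∑ n ∈ intBox d Z, ∏ p ∈ P, F σ p (fun j => (n j : ZMod (p : ℕ))) := by
    simp only [truncatedDivisorSum_eq_sieveSum hR hS hP, Finset.prod_mul_distrib, Finset.prod_const,
      Finset.card_univ, Fintype.card_fin, ← Finset.mul_sum, prod_sieveSum_sq]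
    congr 1
    rw [Finset.sum_comm]
    refine Finset.sum_congr rfl fun σ _ => ?_
    rw [← Finset.mul_sum]
    congr 1
    refine Finset.sum_congr rfl fun n _ => Finset.prod_congr rfl fun p _ => ?_
    simp only [hF, zeroInd_intCast]
  have hterm : ∀ σ ∈ T, |(∏ i, pairWeight χ (Real.log R) (σ i)) *
        (∑ n ∈ intBox d Z, ∏ p ∈ P, F σ p (fun j => (n j : ZMod (p : ℕ))) -
          Z ^ d * ∏ p ∈ P, ((∑ a, F σ p a) / ((p : ℕ) : ℝ) ^ d))| ≤
      |∏ i, pairWeight χ (Real.log R) (σ i)| *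
        (2 * d * 3 ^ d * Z ^ d * (R ^ (2 * t * S) / Z)) := by
    intro σ _
    rw [abs_mul]
    by_cases hw : ∏ i, pairWeight χ (Real.log R) (σ i) = 0
    · rw [hw]; simp
    refine mul_le_mul_of_nonneg_left ?_ (abs_nonneg _)
    -- Primes of `P` in none of the sets contribute a factor identically `1`. The effective modulus
    -- is therefore the product over `Q`, and the error does not depend on `P`.
    set Q := P.filter (fun p => ∃ i, p ∈ (σ i).1 ∨ p ∈ (σ i).2) with hQ
    have hQle := prod_support_le (P := P) hR hS hw
    have hone : ∀ p ∈ P, p ∉ Q → ∀ a, F σ p a = 1 := by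
      intro p hp hpQ a
      have : ¬ ∃ i, p ∈ (σ i).1 ∨ p ∈ (σ i).2 := fun hi => hpQ (Finset.mem_filter.2 ⟨hp, hi⟩)
      push Not at this
      refine Finset.prod_eq_one fun i _ => ?_
      rw [if_neg (this i).1, if_neg (this i).2, one_mul]
    have e1 : ∀ n : Fin d → ℤ, ∏ p ∈ P, F σ p (fun j => (n j : ZMod (p : ℕ))) =
        ∏ p ∈ Q, F σ p (fun j => (n j : ZMod (p : ℕ))) := fun n =>
      (Finset.prod_subset (Finset.filter_subset _ _) fun p hp hpQ => hone p hp hpQ _).symm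
    have e2 : ∏ p ∈ P, ((∑ a, F σ p a) / ((p : ℕ) : ℝ) ^ d) =
        ∏ p ∈ Q, ((∑ a, F σ p a) / ((p : ℕ) : ℝ) ^ d) := by
      refine (Finset.prod_subset (Finset.filter_subset _ _) fun p hp hpQ => ?_).symm
      have hp0 : ((p : ℕ) : ℝ) ≠ 0 := by exact_mod_cast p.2.ne_zero
      simp [hone p hp hpQ, ZMod.card, hp0]
    simp only [e1, e2]
    have hbd : ∀ p a, 0 ≤ F σ p a ∧ F σ p a ≤ 1 := fun p a =>
      primeWeight_mem σ p (fun i => Ψ.zeroInd_nonneg _ i a) fun i => Ψ.zeroInd_le_one _ i a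
    refine (abs_sum_intBox_prod_sub_le d Q (F σ) (fun p a => (hbd p a).1) (fun p a => (hbd p a).2)
      (hQle.trans hZ)).trans ?_
    gcongr
  have h2 : ∑ n ∈ intBox d Z, ∏ i, truncatedDivisorSum χ R (Ψ.form ℤ i n) -
        Z ^ d * (Real.log R ^ t * Ψ.sieveMean χ (Real.log R) P) =
      Real.log R ^ t * ∑ σ ∈ T, (∏ i, pairWeight χ (Real.log R) (σ i)) *
        (∑ n ∈ intBox d Z, ∏ p ∈ P, F σ p (fun j => (n j : ZMod (p : ℕ))) -
          Z ^ d * ∏ p ∈ P, ((∑ a, F σ p a) / ((p : ℕ) : ℝ) ^ d)) := by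
    simp only [mul_sub, Finset.sum_sub_distrib]
    rw [← h1, sieveMean_eq_sum]
    congr 1
    rw [mul_left_comm, Finset.mul_sum]
    congr 1
    refine Finset.sum_congr rfl fun σ _ => ?_
    ring
  rw [h2, abs_mul, abs_of_pos (by positivity)]
  refine mul_le_mul_of_nonneg_left ?_ (by positivity)
  refine (Finset.abs_sum_le_sum_abs _ _).trans ((Finset.sum_le_sum hterm).trans ?_)
  rw [← Finset.sum_mul]
  exact mul_le_mul_of_nonneg_right (sum_abs_pairWeight_le hR hS hK P) (by positivity)

end AffineSystem

end MainTerm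

/-! ### Evaluation of the main term -/

section Evaluation

open MeasureTheory

theorem exp_neg_lineOne_eq_prod {ℓ : ℝ} (v : ℝ) (s : Finset Nat.Primes) :
    Complex.exp (-lineOne v * ((∑ p ∈ s, Real.log (p : ℕ)) / ℓ : ℝ)) =
      ∏ p ∈ s, ((p : ℕ) : ℂ) ^ (-(lineOne v / ℓ)) := by
  have h : ∀ p ∈ s, ((p : ℕ) : ℂ) ^ (-(lineOne v / ℓ)) =
      Complex.exp ((Real.log (p : ℕ) : ℂ) * (-(lineOne v / ℓ))) := fun p _ => by
    rw [Complex.cpow_def_of_ne_zero (by exact_mod_cast p.2.ne_zero), Complex.natCast_log]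
  rw [Finset.prod_congr rfl h, ← Complex.exp_sum, ← Finset.sum_mul]
  congr 1
  push_cast
  ring

/-- The Fourier side of `sieveSum`. -/
noncomputable def sieveTransform (φ : ℝ → ℂ) (ℓ : ℝ) (P : Finset Nat.Primes) (x : Nat.Primes → ℝ)
    (v : ℝ) : ℂ :=
  φ v * ∏ p ∈ P, (1 - (x p : ℂ) * ((p : ℕ) : ℂ) ^ (-(lineOne v / ℓ)))

namespace IsFourierDensity

variable {φ : ℝ → ℂ} {χ : ℝ → ℝ}

/-- Expanding the product over subsets of `P` recovers the exponentials `e^{-τ log m / ℓ}`, one for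
each product `m` of primes; integration in `v` then restores `χ`. -/
theorem sieveTransform_eq_sum (φ : ℝ → ℂ) (ℓ : ℝ) (P : Finset Nat.Primes) (x : Nat.Primes → ℝ)
    (v : ℝ) : sieveTransform φ ℓ P x v = ∑ s ∈ P.powerset, ((∏ p ∈ s, (-x p) : ℝ) : ℂ) *
      (φ v * Complex.exp (-lineOne v * ((∑ p ∈ s, Real.log (p : ℕ)) / ℓ : ℝ))) := by
  simp only [sieveTransform, sub_eq_add_neg, Finset.prod_one_add, Finset.mul_sum]
  refine Finset.sum_congr rfl fun s _ => ?_
  rw [exp_neg_lineOne_eq_prod]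
  simp only [← neg_mul, Finset.prod_mul_distrib]
  push_cast
  ring

theorem integrable_sieveTransform (h : IsFourierDensity φ χ) (ℓ : ℝ) (P : Finset Nat.Primes)
    (x : Nat.Primes → ℝ) : Integrable (sieveTransform φ ℓ P x) := by
  rw [funext (sieveTransform_eq_sum φ ℓ P x)]
  exact integrable_finsetSum _ fun s _ => (h.integrable_mul_exp _).const_mul _

theorem ofReal_sieveSum (h : IsFourierDensity φ χ) (ℓ : ℝ) (P : Finset Nat.Primes)
    (x : Nat.Primes → ℝ) : (sieveSum χ ℓ P x : ℂ) = ∫ v, sieveTransform φ ℓ P x v := by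
  simp only [sieveTransform_eq_sum]
  rw [integral_finsetSum _ fun s _ => (h.integrable_mul_exp _).const_mul _, sieveSum,
    Complex.ofReal_sum]
  refine Finset.sum_congr rfl fun s _ => ?_
  rw [integral_const_mul, ← h.eq_integral, Complex.ofReal_mul]

theorem integrable_prod_sieveTransform {t : ℕ} (h : IsFourierDensity φ χ) (ℓ : ℝ)
    (P : Finset Nat.Primes) (x : Fin t → Nat.Primes → ℝ) :
    Integrable fun v : Fin t → ℝ × ℝ =>
      ∏ i, (sieveTransform φ ℓ P (x i) (v i).1 * sieveTransform φ ℓ P (x i) (v i).2) :=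
  Integrable.fintype_prod (f := fun i (q : ℝ × ℝ) =>
    sieveTransform φ ℓ P (x i) q.1 * sieveTransform φ ℓ P (x i) q.2) fun i =>
      (h.integrable_sieveTransform ℓ P (x i)).mul_prod (h.integrable_sieveTransform ℓ P (x i))

theorem ofReal_prod_sieveSum_sq {t : ℕ} (h : IsFourierDensity φ χ) (ℓ : ℝ) (P : Finset Nat.Primes)
    (x : Fin t → Nat.Primes → ℝ) :
    ((∏ i, sieveSum χ ℓ P (x i) ^ 2 : ℝ) : ℂ) = ∫ v : Fin t → ℝ × ℝ,
      ∏ i, (sieveTransform φ ℓ P (x i) (v i).1 * sieveTransform φ ℓ P (x i) (v i).2) := by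
  rw [integral_fintype_prod_volume_eq_prod (f := fun i (q : ℝ × ℝ) =>
    sieveTransform φ ℓ P (x i) q.1 * sieveTransform φ ℓ P (x i) q.2), Complex.ofReal_prod]
  refine Finset.prod_congr rfl fun i _ => ?_
  rw [Measure.volume_eq_prod, integral_prod_mul, ← h.ofReal_sieveSum]
  push_cast; ring

end IsFourierDensity

namespace AffineSystem

variable {d t : ℕ}

theorem zeroInd_mul_self (Ψ : AffineSystem d t) (K : Type*) [CommRing K] (i : Fin t)
    (a : Fin d → K) : Ψ.zeroInd K i a * Ψ.zeroInd K i a = Ψ.zeroInd K i a := by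
  unfold zeroInd; split_ifs <;> norm_num

/-- The product of the densities times the local means. -/
noncomputable def sieveIntegrand (Ψ : AffineSystem d t) (φ : ℝ → ℂ) (ℓ : ℝ) (P : Finset Nat.Primes)
    (v : Fin t → ℝ × ℝ) : ℂ :=
  (∏ i, (φ (v i).1 * φ (v i).2)) * ∏ p ∈ P, Ψ.localMean p fun i =>
    ((p : ℕ) : ℂ) ^ (-(lineOne (v i).1 / ℓ)) + ((p : ℕ) : ℂ) ^ (-(lineOne (v i).2 / ℓ)) -
      ((p : ℕ) : ℂ) ^ (-(lineOne (v i).1 / ℓ)) * ((p : ℕ) : ℂ) ^ (-(lineOne (v i).2 / ℓ))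

theorem sieveIntegrand_eq (Ψ : AffineSystem d t) (φ : ℝ → ℂ) (ℓ : ℝ) (P : Finset Nat.Primes)
    (v : Fin t → ℝ × ℝ) : Ψ.sieveIntegrand φ ℓ P v =
      (∑ b : (∀ q : P, Fin d → ZMod ((q : Nat.Primes) : ℕ)),
        ∏ i, (sieveTransform φ ℓ P (Ψ.residueInd b i) (v i).1 *
          sieveTransform φ ℓ P (Ψ.residueInd b i) (v i).2)) / ∏ p ∈ P, ((p : ℕ) : ℂ) ^ d := by
  simp only [sieveIntegrand, localMean]
  rw [Finset.prod_div_distrib, ← sum_residues_prod, ← mul_div_assoc, Finset.mul_sum]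
  congr 1
  refine Finset.sum_congr rfl fun b _ => ?_
  rw [Finset.prod_comm, ← Finset.prod_mul_distrib]
  refine Finset.prod_congr rfl fun i _ => ?_
  rw [sieveTransform, sieveTransform, mul_mul_mul_comm, ← Finset.prod_mul_distrib,
    ← Finset.prod_coe_sort P]
  congr 1
  refine Finset.prod_congr rfl fun q _ => ?_
  -- For an indicator `x` idempotency gives `(1 - xu)(1 - xu') = 1 - x(u + u' - uu')`, the origin of
  -- the weight in `localMean`.
  have hsq : (Ψ.zeroInd (ZMod ((q : Nat.Primes) : ℕ)) i (b q) : ℂ) *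
      Ψ.zeroInd (ZMod ((q : Nat.Primes) : ℕ)) i (b q) =
      Ψ.zeroInd (ZMod ((q : Nat.Primes) : ℕ)) i (b q) := by
    rw [← Complex.ofReal_mul, zeroInd_mul_self]
  rw [residueInd_coe]
  linear_combination -(((q : Nat.Primes) : ℕ) : ℂ) ^ (-(lineOne (v i).1 / ℓ)) *
    (((q : Nat.Primes) : ℕ) : ℂ) ^ (-(lineOne (v i).2 / ℓ)) * hsq

theorem integrable_sieveIntegrand (Ψ : AffineSystem d t) {φ : ℝ → ℂ} {χ : ℝ → ℝ}
    (h : IsFourierDensity φ χ) (ℓ : ℝ) (P : Finset Nat.Primes) :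
    Integrable (Ψ.sieveIntegrand φ ℓ P) := by
  rw [funext (Ψ.sieveIntegrand_eq φ ℓ P)]
  exact (integrable_finsetSum _ fun b _ => h.integrable_prod_sieveTransform ℓ P _).div_const _

theorem ofReal_sieveMean (Ψ : AffineSystem d t) {φ : ℝ → ℂ} {χ : ℝ → ℝ}
    (h : IsFourierDensity φ χ) (ℓ : ℝ) (P : Finset Nat.Primes) :
    (Ψ.sieveMean χ ℓ P : ℂ) = ∫ v, Ψ.sieveIntegrand φ ℓ P v := by
  simp only [sieveIntegrand_eq]
  rw [integral_div, integral_finsetSum _ fun b _ => h.integrable_prod_sieveTransform ℓ P _,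
    sieveMean, Complex.ofReal_div, Complex.ofReal_sum]
  simp only [h.ofReal_prod_sieveSum_sq]
  push_cast
  rfl

theorem eulerRatio_ne_zero {x u u' : ℂ} (hx : ‖x‖ ≤ 1 / 2) (hu : ‖u‖ ≤ 1) (hu' : ‖u'‖ ≤ 1) :
    eulerRatio x u u' ≠ 0 :=
  mul_ne_zero (one_sub_mul_ne_zero hx (by rw [norm_mul]; exact mul_le_one₀ hu (norm_nonneg _) hu'))
    (mul_ne_zero (inv_ne_zero (one_sub_mul_ne_zero hx hu)) (inv_ne_zero (one_sub_mul_ne_zero hx hu')))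

/-- Each of the `t` copies of `ℓ` from the factor `log R` is paired with one inverse Euler product
of size about `1/ℓ`. What is left of the local mean at `p` is the twisted factor. -/
theorem sieveIntegrand_eq_twisted (Ψ : AffineSystem d t) (φ : ℝ → ℂ) {ℓ : ℝ} (hℓ : 0 < ℓ)
    (P : Finset Nat.Primes) (v : Fin t → ℝ × ℝ) :
    (ℓ : ℂ) ^ t * Ψ.sieveIntegrand φ ℓ P v = (∏ i, (φ (v i).1 * φ (v i).2)) *
      ((∏ i, (ℓ * ∏ p ∈ P, (eulerRatio (1 / (p : ℕ)) (((p : ℕ) : ℂ) ^ (-(lineOne (v i).1 / ℓ)))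
          (((p : ℕ) : ℂ) ^ (-(lineOne (v i).2 / ℓ))))⁻¹)) *
        ∏ p ∈ P, Ψ.twistedFactor p (fun i => ((p : ℕ) : ℂ) ^ (-(lineOne (v i).1 / ℓ)))
          (fun i => ((p : ℕ) : ℂ) ^ (-(lineOne (v i).2 / ℓ)))) := by
  have hre : ∀ w : ℝ, 0 ≤ (lineOne w / ℓ).re := fun w => by
    rw [Complex.div_ofReal_re, lineOne_re]; positivity
  have hne : ∀ (p : Nat.Primes) i, eulerRatio (1 / (p : ℕ))
      (((p : ℕ) : ℂ) ^ (-(lineOne (v i).1 / ℓ))) (((p : ℕ) : ℂ) ^ (-(lineOne (v i).2 / ℓ))) ≠ 0 :=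
    fun p i => eulerRatio_ne_zero (norm_one_div_prime_le p)
      (norm_prime_cpow_neg_le_one p (hre _)) (norm_prime_cpow_neg_le_one p (hre _))
  have h1 : ∀ p ∈ P, Ψ.localMean p (fun i => ((p : ℕ) : ℂ) ^ (-(lineOne (v i).1 / ℓ)) +
      ((p : ℕ) : ℂ) ^ (-(lineOne (v i).2 / ℓ)) -
      ((p : ℕ) : ℂ) ^ (-(lineOne (v i).1 / ℓ)) * ((p : ℕ) : ℂ) ^ (-(lineOne (v i).2 / ℓ))) =
      (∏ i, (eulerRatio (1 / (p : ℕ)) (((p : ℕ) : ℂ) ^ (-(lineOne (v i).1 / ℓ)))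
          (((p : ℕ) : ℂ) ^ (-(lineOne (v i).2 / ℓ))))⁻¹) *
      Ψ.twistedFactor p (fun i => ((p : ℕ) : ℂ) ^ (-(lineOne (v i).1 / ℓ)))
          (fun i => ((p : ℕ) : ℂ) ^ (-(lineOne (v i).2 / ℓ))) := by
    intro p _
    rw [twistedFactor, mul_left_comm, ← Finset.prod_mul_distrib, Finset.prod_eq_one, mul_one]
    exact fun i _ => inv_mul_cancel₀ (hne p i)
  rw [sieveIntegrand, Finset.prod_congr rfl h1, Finset.prod_mul_distrib (s := P),
    Finset.prod_mul_distrib (f := fun _ : Fin t => (ℓ : ℂ)),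
    Finset.prod_const, Finset.card_univ, Fintype.card_fin, Finset.prod_comm (s := P)]
  ring

end AffineSystem

end Evaluation

/-! ### Asymptotics of the main term -/

section Asymptotics

open MeasureTheory

theorem two_le_norm_lineOne_add (v v' : ℝ) : 2 ≤ ‖lineOne v + lineOne v'‖ := by
  have := Complex.abs_re_le_norm (lineOne v + lineOne v')
  rw [Complex.add_re, lineOne_re, lineOne_re] at this
  norm_num at this
  exact this

theorem lineOne_add_lineOne_ne_zero (v v' : ℝ) : lineOne v + lineOne v' ≠ 0 :=
  norm_pos_iff.1 (two_pos.trans_le (two_le_norm_lineOne_add v v'))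

theorem norm_lineOne_mul_div_le (v w : ℝ) :
    ‖lineOne v * lineOne w / (lineOne v + lineOne w)‖ ≤ ‖lineOne v‖ * ‖lineOne w‖ := by
  rw [norm_div, norm_mul]
  exact div_le_self (by positivity) (by linarith [two_le_norm_lineOne_add v w])

/-- The product over `i` of the norms of the points `lineOne (v i).1` and `lineOne (v i).2`. -/
noncomputable def lineNorm {t : ℕ} (v : Fin t → ℝ × ℝ) : ℝ :=
  ∏ i, (‖lineOne (v i).1‖ * ‖lineOne (v i).2‖)

theorem one_le_norm_lineOne_mul (v v' : ℝ) : 1 ≤ ‖lineOne v‖ * ‖lineOne v'‖ :=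
  one_le_mul_of_one_le_of_one_le (one_le_norm_lineOne _) (one_le_norm_lineOne _)

theorem norm_lineOne_mul_le_lineNorm {t : ℕ} (v : Fin t → ℝ × ℝ) (i : Fin t) :
    ‖lineOne (v i).1‖ * ‖lineOne (v i).2‖ ≤ lineNorm v := by
  have := Finset.prod_le_prod_of_subset_of_one_le (Finset.subset_univ {i})
    (f := fun i => ‖lineOne (v i).1‖ * ‖lineOne (v i).2‖) (fun _ _ => by positivity)
    fun _ _ _ => one_le_norm_lineOne_mul _ _
  rwa [Finset.prod_singleton] at this

theorem one_le_lineNorm {t : ℕ} (v : Fin t → ℝ × ℝ) : 1 ≤ lineNorm v :=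
  Finset.one_le_prod fun _ _ => one_le_norm_lineOne_mul _ _

theorem sum_norm_lineOne_div_le {t : ℕ} (v : Fin t → ℝ × ℝ) {ℓ : ℝ} (hℓ : 0 < ℓ) :
    ∑ i, (‖lineOne (v i).1 / (ℓ : ℂ)‖ + ‖lineOne (v i).2 / (ℓ : ℂ)‖) ≤
      2 * t * lineNorm v / ℓ := by
  have h : ∀ i ∈ Finset.univ, ‖lineOne (v i).1 / (ℓ : ℂ)‖ + ‖lineOne (v i).2 / (ℓ : ℂ)‖ ≤
      2 * lineNorm v / ℓ := fun i _ => by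
    rw [norm_div, norm_div, Complex.norm_of_nonneg hℓ.le, ← add_div]
    gcongr
    have h1 := norm_lineOne_mul_le_lineNorm v i
    nlinarith [one_le_norm_lineOne (v i).1, one_le_norm_lineOne (v i).2]
  refine (Finset.sum_le_card_nsmul _ _ _ h).trans (le_of_eq ?_)
  simp
  ring

theorem sqrt_le_self_of_one_le {x : ℝ} (hx : 1 ≤ x) : √x ≤ x :=
  Real.sqrt_le_iff.2 ⟨by linarith, by nlinarith⟩

theorem sqrt_add_self_le {s M ℓ : ℝ} (hM : 1 ≤ M) (hℓ : 1 ≤ ℓ) (hs : s ≤ M / ℓ) :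
    √s + s ≤ 2 * M / √ℓ := by
  have hsq : 1 ≤ √ℓ := Real.one_le_sqrt.2 hℓ
  have h1 : √s ≤ M / √ℓ := by
    refine (Real.sqrt_le_sqrt hs).trans ?_
    rw [Real.sqrt_div (by positivity)]
    gcongr
    exact sqrt_le_self_of_one_le hM
  have h2 : s ≤ M / √ℓ := hs.trans (by
    gcongr
    exact sqrt_le_self_of_one_le hℓ)
  calc √s + s ≤ M / √ℓ + M / √ℓ := add_le_add h1 h2
    _ = _ := by ring

namespace AffineSystem

/-- Uses `Qr - qβ = (Q - q) r + q (r - β)`, where `Q` tends to `q` by the pole of zeta and `r` to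
`β` by continuity of the twisted factors. Eight powers of `lineNorm` suffice: four from the size of
the factors and four from their differences. -/
theorem exists_norm_prod_mul_sub_le (t : ℕ) (ht : 2 ≤ t) : ∃ C ℓ₀ : ℝ, 1 ≤ C ∧ 1 ≤ ℓ₀ ∧
    ∀ ℓ : ℝ, ℓ₀ ≤ ℓ → ∃ P₀ : Finset Nat.Primes, ∀ P, P₀ ⊆ P →
      ∀ (d : ℕ) (Ψ : AffineSystem d t) (v : Fin t → ℝ × ℝ), 0 < d → Ψ.Admissible →
      ‖(∏ i, (ℓ * ∏ p ∈ P, (eulerRatio (1 / (p : ℕ)) (((p : ℕ) : ℂ) ^ (-(lineOne (v i).1 / ℓ)))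
          (((p : ℕ) : ℂ) ^ (-(lineOne (v i).2 / ℓ))))⁻¹)) *
        ∏ p ∈ P, Ψ.twistedFactor p (fun i => ((p : ℕ) : ℂ) ^ (-(lineOne (v i).1 / ℓ)))
          (fun i => ((p : ℕ) : ℂ) ^ (-(lineOne (v i).2 / ℓ))) -
        (∏ i, (lineOne (v i).1 * lineOne (v i).2 / (lineOne (v i).1 + lineOne (v i).2))) *
          ∏ p ∈ P, (Ψ.localFactor p : ℂ)‖ ≤
      C * (1 + Ψ.exceptionalSum) * Real.exp (C * (1 + Ψ.exceptionalSum)) / √ℓ * lineNorm v ^ 8 := by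
  obtain ⟨C₁, ℓ₀, hC₁, hℓ₀, h₁⟩ := exists_prod_inv_eulerRatio_approx
  obtain ⟨C₂, hC₂, h₂⟩ := exists_prod_twistedFactor_bound t ht
  have ht1 : (1 : ℝ) ≤ t := by exact_mod_cast (by omega : 1 ≤ t)
  set D : ℝ := (C₁ + 1) ^ t * (t * C₁) with hD
  have hD0 : 0 ≤ D := by positivity
  refine ⟨C₂ + D + 4 * t * C₂, ℓ₀, ?_, hℓ₀, fun ℓ hℓ => ?_⟩
  · have : 0 ≤ 4 * t * C₂ := by positivity
    linarith
  obtain ⟨P₀, hP₀⟩ := h₁ ℓ hℓ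
  refine ⟨P₀, fun P hP d Ψ v hd hΨ => ?_⟩
  have hℓ1 : 1 ≤ ℓ := hℓ₀.trans hℓ
  have hℓ0 : 0 < ℓ := by linarith
  have hX := Ψ.exceptionalSum_nonneg
  have hre : ∀ w : ℝ, 0 ≤ (lineOne w / ℓ).re := fun w => by
    rw [Complex.div_ofReal_re, lineOne_re]; positivity
  obtain ⟨hr, hrb⟩ := h₂ d Ψ P (fun i => lineOne (v i).1 / ℓ) (fun i => lineOne (v i).2 / ℓ) hd hΨ
    (fun i => hre _) fun i => hre _
  have hQ := fun i => hP₀ P hP (v i).1 (v i).2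
  have hA1 := one_le_lineNorm v
  have hsq : 1 ≤ √ℓ := Real.one_le_sqrt.2 hℓ1
  set X := Ψ.exceptionalSum
  set A := lineNorm v with hA
  set a : Fin t → ℝ := fun i => ‖lineOne (v i).1‖ * ‖lineOne (v i).2‖ with ha
  have ha1 : ∀ i, 1 ≤ a i := fun i => one_le_norm_lineOne_mul _ _
  have haA : ∀ i, a i ≤ A := norm_lineOne_mul_le_lineNorm v
  set Q : Fin t → ℂ := fun i => ℓ * ∏ p ∈ P, (eulerRatio (1 / (p : ℕ))
    (((p : ℕ) : ℂ) ^ (-(lineOne (v i).1 / ℓ))) (((p : ℕ) : ℂ) ^ (-(lineOne (v i).2 / ℓ))))⁻¹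
  set q : Fin t → ℂ := fun i =>
    lineOne (v i).1 * lineOne (v i).2 / (lineOne (v i).1 + lineOne (v i).2)
  set r := ∏ p ∈ P, Ψ.twistedFactor p (fun i => ((p : ℕ) : ℂ) ^ (-(lineOne (v i).1 / ℓ)))
          (fun i => ((p : ℕ) : ℂ) ^ (-(lineOne (v i).2 / ℓ)))
  set β := ∏ p ∈ P, (Ψ.localFactor p : ℂ)
  have hq : ∀ i, ‖q i‖ ≤ a i := fun i => norm_lineOne_mul_div_le _ _
  have hq4 : ∀ i, ‖q i‖ ≤ a i ^ 4 := fun i =>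
    (hq i).trans (le_self_pow₀ (ha1 i) (by norm_num))
  have hQq : ∀ i, ‖Q i - q i‖ ≤ C₁ * a i ^ 4 / ℓ := hQ
  have hprod : ∏ i, ((C₁ + 1) * a i ^ 4) = (C₁ + 1) ^ t * A ^ 4 := by
    rw [Finset.prod_mul_distrib, Finset.prod_pow, Finset.prod_const, Finset.card_univ,
      Fintype.card_fin]
    rfl
  have hm : ∀ i, a i ^ 4 ≤ (C₁ + 1) * a i ^ 4 := fun i =>
    le_mul_of_one_le_left (by positivity) (by linarith)
  have h3 : ‖∏ i, Q i - ∏ i, q i‖ ≤ D * A ^ 8 / √ℓ := by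
    have h := norm_prod_sub_prod_le Finset.univ (a := Q) (b := q) (m := fun i => (C₁ + 1) * a i ^ 4)
      (fun i _ => (one_le_pow₀ (ha1 i)).trans (hm i)) (fun i _ => ?_)
      (fun i _ => (hq4 i).trans (hm i))
    · rw [hprod] at h
      refine h.trans ?_
      have hs : ∑ i, ‖Q i - q i‖ ≤ t * (C₁ * A ^ 4 / √ℓ) := by
        refine (Finset.sum_le_card_nsmul _ _ (C₁ * A ^ 4 / √ℓ) fun i _ => (hQq i).trans ?_).trans
          (le_of_eq (by simp))
        have := haA i
        have := ha1 i
        have := sqrt_le_self_of_one_le hℓ1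
        gcongr
      calc (C₁ + 1) ^ t * A ^ 4 * ∑ i, ‖Q i - q i‖
          ≤ (C₁ + 1) ^ t * A ^ 4 * (t * (C₁ * A ^ 4 / √ℓ)) := by gcongr
        _ = _ := by rw [hD]; ring
    · calc ‖Q i‖ ≤ ‖Q i - q i‖ + ‖q i‖ := by
            simpa using norm_add_le (Q i - q i) (q i)
        _ ≤ C₁ * a i ^ 4 + a i ^ 4 :=
            add_le_add ((hQq i).trans (div_le_self (by positivity) hℓ1)) (hq4 i)
        _ = _ := by ring
  have h4 : ‖r - β‖ ≤ Real.exp (C₂ * (1 + X)) * (C₂ * (1 + X) * (4 * t * A / √ℓ)) := by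
    refine hrb.trans ?_
    gcongr
    refine (sqrt_add_self_le (M := 2 * t * A) ?_ hℓ1 (sum_norm_lineOne_div_le v hℓ0)).trans
      (le_of_eq (by ring))
    nlinarith
  have h5 : ‖∏ i, q i‖ ≤ A := norm_prod_le_prod_of_le _ fun i _ => hq i
  have hE : Real.exp (C₂ * (1 + X)) ≤ Real.exp ((C₂ + D + 4 * t * C₂) * (1 + X)) := by
    gcongr
    have : 0 ≤ 4 * t * C₂ := by positivity
    linarith
  calc ‖(∏ i, Q i) * r - (∏ i, q i) * β‖
      = ‖(∏ i, Q i - ∏ i, q i) * r + (∏ i, q i) * (r - β)‖ := by congr 1; ring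
    _ ≤ ‖∏ i, Q i - ∏ i, q i‖ * ‖r‖ + ‖∏ i, q i‖ * ‖r - β‖ := by
        refine (norm_add_le _ _).trans ?_
        rw [norm_mul, norm_mul]
    _ ≤ D * A ^ 8 / √ℓ * Real.exp (C₂ * (1 + X)) +
        A * (Real.exp (C₂ * (1 + X)) * (C₂ * (1 + X) * (4 * t * A / √ℓ))) := by gcongr
    _ = (D * A ^ 8 + 4 * t * C₂ * (1 + X) * A ^ 2) * (Real.exp (C₂ * (1 + X)) / √ℓ) := by ring
    _ ≤ (D * (1 + X) * A ^ 8 + 4 * t * C₂ * (1 + X) * A ^ 8) * (Real.exp (C₂ * (1 + X)) / √ℓ) := by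
        have : A ^ 2 ≤ A ^ 8 := pow_le_pow_right₀ hA1 (by norm_num)
        have : D ≤ D * (1 + X) := le_mul_of_one_le_right hD0 (by linarith)
        gcongr
    _ = (D + 4 * t * C₂) * (1 + X) * Real.exp (C₂ * (1 + X)) / √ℓ * A ^ 8 := by ring
    _ ≤ _ := by
        gcongr
        linarith

end AffineSystem

namespace IsFourierDensity

variable {φ : ℝ → ℂ} {χ : ℝ → ℝ}

theorem integrable_prod_mul_lineNorm (h : IsFourierDensity φ χ) (t k : ℕ) :
    Integrable fun v : Fin t → ℝ × ℝ =>
      (∏ i, (‖φ (v i).1‖ * ‖φ (v i).2‖)) * lineNorm v ^ k := by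
  have := Integrable.fintype_prod (ι := Fin t) (f := fun _ (q : ℝ × ℝ) =>
    (‖φ q.1‖ * ‖lineOne q.1‖ ^ k) * (‖φ q.2‖ * ‖lineOne q.2‖ ^ k)) fun _ =>
      (h.integrable k).mul_prod (h.integrable k)
  refine this.congr (Filter.Eventually.of_forall fun v => ?_)
  simp only [lineNorm]
  rw [← Finset.prod_pow, ← Finset.prod_mul_distrib]
  exact Finset.prod_congr rfl fun i _ => by ring

theorem integrable_prod_mul_div (h : IsFourierDensity φ χ) : Integrable fun q : ℝ × ℝ =>
    φ q.1 * φ q.2 * (lineOne q.1 * lineOne q.2 / (lineOne q.1 + lineOne q.2)) := by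
  have hl := continuous_lineOne
  have hφ := h.continuous
  refine ((h.integrable 1).mul_prod (h.integrable 1)).mono' ?_
    (Filter.Eventually.of_forall fun q => ?_)
  · have : Continuous fun q : ℝ × ℝ =>
        φ q.1 * φ q.2 * (lineOne q.1 * lineOne q.2 / (lineOne q.1 + lineOne q.2)) := by
      refine Continuous.mul (by fun_prop) (Continuous.div (by fun_prop) (by fun_prop) fun q => ?_)
      exact lineOne_add_lineOne_ne_zero _ _
    exact this.aestronglyMeasurable
  · rw [norm_mul, norm_mul]
    refine (mul_le_mul_of_nonneg_left (norm_lineOne_mul_div_le _ _) (by positivity)).trans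
      (le_of_eq (by ring))

end IsFourierDensity

namespace AffineSystem

theorem exists_sieveMean_approx {t : ℕ} (ht : 2 ≤ t) {φ : ℝ → ℂ} {χ : ℝ → ℝ}
    (h : IsFourierDensity φ χ) (hχ : Differentiable ℝ χ) : ∃ C ℓ₀ : ℝ, 1 ≤ C ∧ 1 ≤ ℓ₀ ∧
    ∀ ℓ : ℝ, ℓ₀ ≤ ℓ → ∃ P₀ : Finset Nat.Primes, ∀ P, P₀ ⊆ P →
      ∀ (d : ℕ) (Ψ : AffineSystem d t), 0 < d → Ψ.Admissible →
      |ℓ ^ t * Ψ.sieveMean χ ℓ P -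
        (∫ x in Set.Ioi (0 : ℝ), deriv χ x ^ 2) ^ t * ∏ p ∈ P, Ψ.localFactor p| ≤
      C * (1 + Ψ.exceptionalSum) * Real.exp (C * (1 + Ψ.exceptionalSum)) / √ℓ := by
  obtain ⟨C, ℓ₀, hC, hℓ₀, hb⟩ := exists_norm_prod_mul_sub_le t ht
  set W := fun v : Fin t → ℝ × ℝ => (∏ i, (‖φ (v i).1‖ * ‖φ (v i).2‖)) * lineNorm v ^ 8 with hW
  have hWi : Integrable W := h.integrable_prod_mul_lineNorm t 8
  have hW0 : 0 ≤ ∫ v, W v := integral_nonneg fun v =>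
    mul_nonneg (Finset.prod_nonneg fun i _ => by positivity)
      (pow_nonneg (by linarith [one_le_lineNorm v]) _)
  -- The rapid decay of `φ` makes `W` integrable. Its integral is needed as a factor only, but
  -- enlarging the constant in the exponent as well is harmless.
  refine ⟨C * (1 + ∫ v, W v), ℓ₀, by nlinarith, hℓ₀, fun ℓ hℓ => ?_⟩
  obtain ⟨P₀, hP₀⟩ := hb ℓ hℓ
  refine ⟨P₀, fun P hP d Ψ hd hΨ => ?_⟩
  have hℓ0 : 0 < ℓ := by linarith
  have hX := Ψ.exceptionalSum_nonneg
  set X := Ψ.exceptionalSum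
  set β := ∏ p ∈ P, (Ψ.localFactor p : ℂ) with hβ
  set F := fun q : ℝ × ℝ =>
    φ q.1 * φ q.2 * (lineOne q.1 * lineOne q.2 / (lineOne q.1 + lineOne q.2)) with hF
  have hFi : Integrable fun v : Fin t → ℝ × ℝ => ∏ i, F (v i) :=
    Integrable.fintype_prod (f := fun _ => F) fun _ => h.integrable_prod_mul_div
  have hFint : ∫ v : Fin t → ℝ × ℝ, ∏ i, F (v i) =
      ((∫ x in Set.Ioi (0 : ℝ), deriv χ x ^ 2 : ℝ) : ℂ) ^ t := by
    rw [integral_fintype_prod_volume_eq_pow, h.integral_prod_eq hχ, Fintype.card_fin]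
  have e : ((ℓ ^ t * Ψ.sieveMean χ ℓ P -
        (∫ x in Set.Ioi (0 : ℝ), deriv χ x ^ 2) ^ t * ∏ p ∈ P, Ψ.localFactor p : ℝ) : ℂ) =
      ∫ v, ((ℓ : ℂ) ^ t * Ψ.sieveIntegrand φ ℓ P v - (∏ i, F (v i)) * β) := by
    rw [integral_sub ((Ψ.integrable_sieveIntegrand h ℓ P).const_mul _) (hFi.mul_const _),
      integral_const_mul, integral_mul_const, hFint, ← Ψ.ofReal_sieveMean h, hβ]
    push_cast
    rfl
  rw [← Real.norm_eq_abs, ← Complex.norm_real, e]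
  have hK : 0 ≤ C * (1 + X) * Real.exp (C * (1 + X)) / √ℓ := by positivity
  have hle : ∀ v, ‖(ℓ : ℂ) ^ t * Ψ.sieveIntegrand φ ℓ P v - (∏ i, F (v i)) * β‖ ≤
      C * (1 + X) * Real.exp (C * (1 + X)) / √ℓ * W v := fun v => by
    have e2 : ∏ i, F (v i) = (∏ i, (φ (v i).1 * φ (v i).2)) *
        ∏ i, (lineOne (v i).1 * lineOne (v i).2 / (lineOne (v i).1 + lineOne (v i).2)) :=
      Finset.prod_mul_distrib
    rw [sieveIntegrand_eq_twisted Ψ φ hℓ0, e2, mul_assoc, ← mul_sub, norm_mul]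
    refine (mul_le_mul_of_nonneg_left (hP₀ P hP d Ψ v hd hΨ) (norm_nonneg _)).trans (le_of_eq ?_)
    rw [norm_prod, hW]
    simp only [norm_mul]
    ring
  refine (norm_integral_le_of_norm_le (hWi.const_mul _)
    (Filter.Eventually.of_forall hle)).trans ?_
  rw [integral_const_mul]
  calc C * (1 + X) * Real.exp (C * (1 + X)) / √ℓ * ∫ v, W v
      ≤ C * (1 + X) * Real.exp (C * (1 + ∫ v, W v) * (1 + X)) / √ℓ * (1 + ∫ v, W v) := by
        gcongr
        · nlinarith
        · linarith
    _ = _ := by ring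

end AffineSystem

end Asymptotics

/-! ### The correlation estimate -/

section Correlation

open MeasureTheory Filter Topology

/-- With `y = √(log x)` the quotient is `exp(-y (y/2 - a))`. At `x = 2 log N` this says that the
loss from the exceptional primes is beaten by the saving `1/√(log R)`. -/
theorem tendsto_exp_mul_sqrt_log_div_sqrt (a : ℝ) :
    Tendsto (fun x : ℝ => Real.exp (a * √(Real.log x)) / √x) atTop (𝓝 0) := by
  have hy : Tendsto (fun x : ℝ => √(Real.log x)) atTop atTop :=
    Real.tendsto_sqrt_atTop.comp Real.tendsto_log_atTop
  have h1 : Tendsto (fun y : ℝ => y * (y / 2 - a)) atTop atTop :=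
    tendsto_id.atTop_mul_atTop₀
      (tendsto_atTop_add_const_right _ (-a) (tendsto_id.atTop_div_const two_pos))
  have h2 := (Real.tendsto_exp_neg_atTop_nhds_zero.comp h1).comp hy
  refine h2.congr' ?_
  filter_upwards [eventually_ge_atTop 1] with x hx
  have hl : 0 ≤ Real.log x := Real.log_nonneg hx
  have hsx : √x = Real.exp (√(Real.log x) ^ 2 / 2) := by
    rw [Real.sq_sqrt hl, Real.exp_half, Real.exp_log (by linarith)]
  simp only [Function.comp_apply]
  rw [hsx, ← Real.exp_sub]
  congr 1
  ring

theorem tendsto_log_pow_mul_rpow_neg (t : ℕ) {r : ℝ} (hr : 0 < r) :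
    Tendsto (fun N : ℝ => Real.log N ^ t * N ^ (-r)) atTop (𝓝 0) := by
  have h := (isLittleO_log_rpow_rpow_atTop (t : ℝ) hr).tendsto_div_nhds_zero
  refine h.congr' ?_
  filter_upwards [eventually_gt_atTop 0] with N hN
  rw [Real.rpow_neg hN.le, Real.rpow_natCast, div_eq_mul_inv]

namespace AffineSystem

variable {d t : ℕ}

theorem tendsto_prod_localFactor {Ψ : AffineSystem d t} (hd : 0 < d) (ht : 2 ≤ t)
    (hΨ : Ψ.Admissible) :
    Tendsto (fun P : Finset Nat.Primes => ∏ p ∈ P, Ψ.localFactor p) atTop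
      (𝓝 (∏' p, Ψ.localFactor p)) := by
  simpa [HasProd] using (multipliable_localFactor hd ht hΨ).hasProd

theorem exists_abs_sum_sub_le (hd : 0 < d) (ht : 2 ≤ t) {χ : ℝ → ℝ} (hχ : ContDiff ℝ ∞ χ) {S : ℝ}
    (hsupp : Function.support χ ⊆ Set.Icc (-S) S) : ∃ C ℓ₀ : ℝ, 1 ≤ C ∧ 1 ≤ ℓ₀ ∧
    ∀ (R Z : ℝ) (Ψ : AffineSystem d t), 1 < R → ℓ₀ ≤ Real.log R → R ^ (2 * t * S) ≤ Z →
      Ψ.Admissible →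
      |∑ n ∈ intBox d Z, ∏ i, truncatedDivisorSum χ R (Ψ.form ℤ i n) -
        Z ^ d * (∫ x in Set.Ioi (0 : ℝ), deriv χ x ^ 2) ^ t * ∏' p, Ψ.localFactor p| ≤
      Z ^ d * (C * Real.log R ^ t * R ^ (4 * t * S) / Z +
        C * Real.exp (C * (1 + Ψ.exceptionalSum)) / √(Real.log R)) := by
  classical
  obtain ⟨φ, hφ⟩ := exists_isFourierDensity hχ hsupp
  have hc : HasCompactSupport χ :=
    HasCompactSupport.intro isCompact_Icc fun x hx => by
      by_contra h; exact hx (hsupp h)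
  obtain ⟨K, hK⟩ := hc.exists_bound_of_continuous hχ.continuous
  obtain ⟨C, ℓ₀, hC, hℓ₀, hmean⟩ := exists_sieveMean_approx ht hφ (hχ.differentiable (by simp))
  set c := ∫ x in Set.Ioi (0 : ℝ), deriv χ x ^ 2 with hcdef
  have hK0 : 0 ≤ K := (norm_nonneg _).trans (hK 0)
  set D : ℝ := K ^ (2 * t) * (2 * d * 3 ^ d) with hD
  have hD0 : 0 ≤ D := by positivity
  refine ⟨C + 1 + D, ℓ₀, by linarith, hℓ₀, fun R Z Ψ hR hℓ hZ hΨ => ?_⟩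
  obtain ⟨P₀, hP₀⟩ := hmean (Real.log R) hℓ
  have hR0 : 0 < R := by linarith
  have hZ0 : 0 < Z := (Real.rpow_pos_of_pos hR0 _).trans_le hZ
  have hℓ0 : 0 < Real.log R := by linarith
  have hX := Ψ.exceptionalSum_nonneg
  set X := Ψ.exceptionalSum
  set β := ∏' p, Ψ.localFactor p
  set T := ∑ n ∈ intBox d Z, ∏ i, truncatedDivisorSum χ R (Ψ.form ℤ i n)
  have hsmall : ∀ᶠ P : Finset Nat.Primes in atTop,
      |c ^ t * ∏ p ∈ P, Ψ.localFactor p - c ^ t * β| < 1 / √(Real.log R) := by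
    have h := Metric.tendsto_nhds.1 ((tendsto_prod_localFactor hd ht hΨ).const_mul (c ^ t))
      (1 / √(Real.log R)) (by positivity)
    simpa only [Real.dist_eq] using h
  -- `P` may depend on `R` and `Ψ`. It contains every prime up to `R^S`, the set needed for the main
  -- term, and enough primes for the partial singular series to be near its limit. It disappears
  -- from the final bound.
  obtain ⟨P, hPs, hPsub⟩ := (hsmall.and (eventually_ge_atTop
    (P₀ ∪ (Finset.Iic ⌊R ^ S⌋₊).subtype Nat.Prime))).exists
  have h1 := Ψ.abs_sum_prod_truncatedDivisorSum_sub_le hR hsupp hK (P := P) (fun p hp =>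
    hPsub (Finset.mem_union_right _ (Finset.mem_subtype.2 (Finset.mem_Iic.2
      (Nat.le_floor hp))))) hZ
  have h2 := hP₀ P (Finset.union_subset_left hPsub) d Ψ hd hΨ
  set M := Real.log R ^ t * Ψ.sieveMean χ (Real.log R) P
  set G := c ^ t * ∏ p ∈ P, Ψ.localFactor p
  have hpow : R ^ (4 * t * S) = ((R ^ S) ^ 2) ^ t * R ^ (2 * t * S) := by
    rw [← pow_mul, ← Real.rpow_natCast, ← Real.rpow_mul hR0.le, ← Real.rpow_add hR0]
    congr 1
    push_cast
    ring
  have h1' : |T - Z ^ d * M| ≤ Z ^ d * (D * Real.log R ^ t * R ^ (4 * t * S) / Z) := by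
    refine h1.trans (le_of_eq ?_)
    rw [hpow, hD, mul_pow, mul_pow, ← pow_mul K]
    ring
  -- The polynomial factor is absorbed through `1 + X ≤ exp(1 + X)`, raising the constant in the
  -- exponent by one.
  have h3 : C * (1 + X) * Real.exp (C * (1 + X)) + 1 ≤
      (C + 1 + D) * Real.exp ((C + 1 + D) * (1 + X)) := by
    have hE : Real.exp ((C + 1) * (1 + X)) ≤ Real.exp ((C + 1 + D) * (1 + X)) := by
      exact Real.exp_le_exp.2 (mul_le_mul_of_nonneg_right (by linarith) (by positivity))
    have hE1 : 1 ≤ Real.exp ((C + 1) * (1 + X)) := Real.one_le_exp (by positivity)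
    have h4 : (1 + X) * Real.exp (C * (1 + X)) ≤ Real.exp ((C + 1) * (1 + X)) := by
      rw [add_mul C, one_mul, Real.exp_add, mul_comm]
      gcongr
      linarith [Real.add_one_le_exp (1 + X)]
    calc C * (1 + X) * Real.exp (C * (1 + X)) + 1
        ≤ C * Real.exp ((C + 1) * (1 + X)) + Real.exp ((C + 1) * (1 + X)) := by
          rw [mul_assoc]; gcongr
      _ = (C + 1) * Real.exp ((C + 1) * (1 + X)) := by ring
      _ ≤ _ := mul_le_mul (by linarith) hE (Real.exp_pos _).le (by linarith)
  have h5 : |M - c ^ t * β| ≤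
      (C + 1 + D) * Real.exp ((C + 1 + D) * (1 + X)) / √(Real.log R) := by
    calc |M - c ^ t * β| ≤ |M - G| + |G - c ^ t * β| := abs_sub_le _ _ _
      _ ≤ C * (1 + X) * Real.exp (C * (1 + X)) / √(Real.log R) + 1 / √(Real.log R) :=
          add_le_add h2 hPs.le
      _ = (C * (1 + X) * Real.exp (C * (1 + X)) + 1) / √(Real.log R) := by ring
      _ ≤ _ := by gcongr
  calc |T - Z ^ d * c ^ t * β| ≤ |T - Z ^ d * M| + |Z ^ d * M - Z ^ d * c ^ t * β| :=
        abs_sub_le _ _ _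
    _ = |T - Z ^ d * M| + Z ^ d * |M - c ^ t * β| := by
        rw [mul_assoc, ← mul_sub, abs_mul, abs_of_pos (pow_pos hZ0 d)]
    _ ≤ Z ^ d * (D * Real.log R ^ t * R ^ (4 * t * S) / Z) + Z ^ d *
        ((C + 1 + D) * Real.exp ((C + 1 + D) * (1 + X)) / √(Real.log R)) := by gcongr
    _ ≤ _ := by
        rw [← mul_add]
        gcongr
        linarith

/-- For large `N` the error terms of the correlation estimate are small, uniformly in the size of
the box and in the exceptional primes. -/
theorem eventually_error_le (t : ℕ) {S γ C C' : ℝ} (ht : 0 < t) (hS : 0 < S) (hγ : 0 < γ)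
    (hγ' : γ < 1 / (8 * t * S)) (hC : 1 ≤ C) (hC' : 0 < C') (A ℓ₀ Z₀ : ℝ) {η : ℝ} (hη : 0 < η) :
    ∀ᶠ N : ℝ in atTop, 1 < N ^ γ ∧ ℓ₀ ≤ Real.log (N ^ γ) ∧ ∀ Z : ℝ, N / Real.log N ^ A ≤ Z →
      Z ≤ N * Real.log N ^ A → Z₀ ≤ Z ∧ (N ^ γ) ^ (2 * t * S) ≤ Z ∧
      C * Real.log (N ^ γ) ^ t * (N ^ γ) ^ (4 * t * S) / Z ≤ η ∧
      ∀ X : ℝ, X ≤ C' * √(Real.log (Real.log Z)) →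
        C * Real.exp (C * (1 + X)) / √(Real.log (N ^ γ)) ≤ η := by
  have ht0 : (0 : ℝ) < t := by exact_mod_cast ht
  have hγt : γ * (8 * t * S) < 1 := by rwa [lt_div_iff₀ (by positivity)] at hγ'
  -- Powers of the logarithm are below `N^{1/4}`, which places `Z` between `N^{3/4}` and `N²`.
  have e1 : ∀ᶠ N : ℝ in atTop, Real.log N ^ A ≤ N ^ (1 / 4 : ℝ) := by
    have h := (isLittleO_log_rpow_rpow_atTop A (by norm_num : (0 : ℝ) < 1 / 4)).bound one_pos
    filter_upwards [h, eventually_gt_atTop 0] with N hN hN0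
    rw [one_mul, Real.norm_of_nonneg (Real.rpow_nonneg hN0.le (1 / 4))] at hN
    exact (Real.le_norm_self _).trans hN
  have e2 : ∀ᶠ N : ℝ in atTop, ℓ₀ / γ ≤ Real.log N :=
    Real.tendsto_log_atTop.eventually_ge_atTop _
  have e3 : ∀ᶠ N : ℝ in atTop, max Z₀ 3 ≤ N ^ (3 / 4 : ℝ) :=
    (tendsto_rpow_atTop (by norm_num)).eventually_ge_atTop _
  have e4 : ∀ᶠ N : ℝ in atTop, C * γ ^ t * (Real.log N ^ t * N ^ (-(1 / 4) : ℝ)) ≤ η := by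
    have h := (tendsto_log_pow_mul_rpow_neg t (by norm_num : (0 : ℝ) < 1 / 4)).const_mul (C * γ ^ t)
    rw [mul_zero] at h
    exact h.eventually_le_const hη
  have e5 : ∀ᶠ N : ℝ in atTop, C * Real.exp C / √(γ / 2) *
      (Real.exp (C * C' * √(Real.log (2 * Real.log N))) / √(2 * Real.log N)) ≤ η := by
    have h := ((tendsto_exp_mul_sqrt_log_div_sqrt (C * C')).comp
      (Real.tendsto_log_atTop.const_mul_atTop two_pos)).const_mul (C * Real.exp C / √(γ / 2))
    rw [mul_zero] at h
    exact h.eventually_le_const hη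
  filter_upwards [e1, e2, e3, e4, e5, eventually_gt_atTop 1] with N h1 h2 h3 h4 h5 hN
  have hN0 : 0 < N := by linarith
  have hl : 0 < Real.log N := Real.log_pos hN
  have hlog : Real.log (N ^ γ) = γ * Real.log N := Real.log_rpow hN0 γ
  refine ⟨Real.one_lt_rpow hN hγ, ?_, fun Z hZ hZ' => ?_⟩
  · rw [hlog, mul_comm]
    exact (div_le_iff₀ hγ).1 h2
  have hlA : 0 < Real.log N ^ A := Real.rpow_pos_of_pos hl _
  have hZlow : N ^ (3 / 4 : ℝ) ≤ Z := by
    refine le_trans ?_ hZ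
    rw [le_div_iff₀ hlA]
    calc N ^ (3 / 4 : ℝ) * Real.log N ^ A ≤ N ^ (3 / 4 : ℝ) * N ^ (1 / 4 : ℝ) := by gcongr
      _ = N := by rw [← Real.rpow_add hN0]; norm_num
  have hZup : Z ≤ N ^ 2 := by
    calc Z ≤ N * Real.log N ^ A := hZ'
      _ ≤ N * N ^ (1 / 4 : ℝ) := by gcongr
      _ ≤ N * N ^ (1 : ℝ) := by
          gcongr
          · exact hN.le
          · norm_num
      _ = N ^ 2 := by rw [Real.rpow_one]; ring
  have hZ0 : 0 < Z := (Real.rpow_pos_of_pos hN0 _).trans_le hZlow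
  have hZ3 : 3 ≤ Z := (le_max_right _ _).trans (h3.trans hZlow)
  refine ⟨(le_max_left _ _).trans (h3.trans hZlow), ?_, ?_, fun X hX => ?_⟩
  · rw [← Real.rpow_mul hN0.le]
    refine le_trans (Real.rpow_le_rpow_of_exponent_le hN.le ?_) hZlow
    nlinarith
  · refine le_trans ?_ h4
    rw [hlog, ← Real.rpow_mul hN0.le, mul_pow]
    -- `γ · 8tS < 1` makes the numerator at most `N^{1/2}`; against `Z ≥ N^{3/4}` a saving of
    -- `N^{1/4}` remains, enough to defeat `log^t N`.
    have h6 : N ^ (γ * (4 * t * S)) / Z ≤ N ^ (-(1 / 4) : ℝ) := by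
      rw [div_le_iff₀ hZ0]
      calc N ^ (γ * (4 * t * S)) ≤ N ^ (-(1 / 4) + 3 / 4 : ℝ) :=
            Real.rpow_le_rpow_of_exponent_le hN.le (by nlinarith)
        _ = N ^ (-(1 / 4) : ℝ) * N ^ (3 / 4 : ℝ) := Real.rpow_add hN0 _ _
        _ ≤ _ := by gcongr
    calc C * (γ ^ t * Real.log N ^ t) * N ^ (γ * (4 * t * S)) / Z
        = C * γ ^ t * (Real.log N ^ t * (N ^ (γ * (4 * t * S)) / Z)) := by ring
      _ ≤ _ := by gcongr
  · refine le_trans ?_ h5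
    have hlZ : Real.log Z ≤ 2 * Real.log N := by
      have : Real.log (N ^ 2) = 2 * Real.log N := by rw [Real.log_pow]; norm_num
      rw [← this]
      exact Real.log_le_log hZ0 hZup
    have hX' : X ≤ C' * √(Real.log (2 * Real.log N)) := hX.trans (by
      gcongr
      exact Real.log_pos (by linarith))
    have hsq : √(Real.log (N ^ γ)) = √(γ / 2) * √(2 * Real.log N) := by
      rw [hlog, ← Real.sqrt_mul (by positivity)]
      congr 1
      ring
    rw [hsq]
    calc C * Real.exp (C * (1 + X)) / (√(γ / 2) * √(2 * Real.log N))
        ≤ C * Real.exp (C * (1 + C' * √(Real.log (2 * Real.log N)))) /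
          (√(γ / 2) * √(2 * Real.log N)) := by gcongr
      _ = C * (Real.exp C * Real.exp (C * C' * √(Real.log (2 * Real.log N)))) /
          (√(γ / 2) * √(2 * Real.log N)) := by
          rw [← Real.exp_add]
          congr 3
          ring
      _ = _ := by
          rw [div_mul_div_comm]
          ring

end AffineSystem

end Correlation

/-! ### Conclusion: uniform bounds combined into the two statements -/

theorem mainTheorem4 (d t : ℕ) (hd : 2 ≤ d) (ht : 2 ≤ t) :
    -- the exceptional primes: `∑_{p ∈ P_Ψ} p^{-1/2} = O(√(log log Z))`
    (∀ B L : ℝ, 0 < B → 0 < L → ∃ C Z₀ : ℝ, ∀ Z : ℝ, Z₀ ≤ Z →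
      ∀ Ψ : AffineSystem d t, Ψ.Admissible → Ψ.size Z B ≤ L →
        Ψ.exceptionalPrimes.Finite ∧
        ∑' p : Ψ.exceptionalPrimes, (((p : ℕ) : ℝ)) ^ (-(1 / 2) : ℝ) ≤
          C * Real.sqrt (Real.log (Real.log Z))) ∧
    -- the correlation estimate, for `R = N ^ γ` a small power of `N`
    (∀ S : ℝ, 0 < S → ∃ γ₀ : ℝ, 0 < γ₀ ∧ ∀ γ : ℝ, 0 < γ → γ < γ₀ →
      ∀ χ : ℝ → ℝ, ContDiff ℝ ∞ χ → Function.support χ ⊆ Set.Icc (-S) S → χ 0 = 1 →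
      ∀ A B L : ℝ, 0 < A → 0 < B → 0 < L →
      ∀ ε : ℝ, 0 < ε → ∃ N₀ : ℝ, ∀ N Z : ℝ, N₀ ≤ N →
        N / Real.log N ^ A ≤ Z → Z ≤ N * Real.log N ^ A →
      ∀ Ψ : AffineSystem d t, Ψ.Admissible → Ψ.size Z B ≤ L →
        Multipliable Ψ.localFactor ∧
        0 < ∏' p, Ψ.localFactor p ∧
        |∑ n ∈ intBox d Z, ∏ i, truncatedDivisorSum χ (N ^ γ) (Ψ.form ℤ i n) -
            Z ^ d * (∫ x in Set.Ioi (0 : ℝ), deriv χ x ^ 2) ^ t * ∏' p, Ψ.localFactor p| ≤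
          ε * (Z ^ d * (∫ x in Set.Ioi (0 : ℝ), deriv χ x ^ 2) ^ t *
            ∏' p, Ψ.localFactor p)) := by
  have hd0 : 0 < d := by omega
  refine ⟨fun B L hB hL => ?_, fun S hS => ?_⟩
  · obtain ⟨C, Z₀, -, h⟩ := AffineSystem.exceptionalPrimes_sum_le d t hd0 B L hB hL
    exact ⟨C, Z₀, fun Z hZ Ψ hΨ hs => ⟨AffineSystem.exceptionalPrimes_finite hd0 hΨ.1,
      h Z hZ Ψ hΨ.1 hs⟩⟩
  have ht0 : (0 : ℝ) < t := by exact_mod_cast (by omega : 0 < t)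
  refine ⟨1 / (8 * t * S), by positivity, fun γ hγ hγ' χ hχ hsupp h0 A B L _ hB hL ε hε => ?_⟩
  obtain ⟨C, ℓ₀, hC, -, hest⟩ := AffineSystem.exists_abs_sum_sub_le hd0 ht hχ hsupp
  obtain ⟨C', Z₀, hC', hexc⟩ := AffineSystem.exceptionalPrimes_sum_le d t hd0 B L hB hL
  obtain ⟨b, hb, hβ⟩ := AffineSystem.exists_prod_localFactor_ge d t
  have hc := integral_deriv_sq_pos hχ hsupp h0
  set c := ∫ x in Set.Ioi (0 : ℝ), deriv χ x ^ 2
  -- The two error terms each receive half of `ε c^t b`, where `b` is a lower bound for `∏ β_p`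
  -- independent of `Ψ`; this turns the absolute error into a relative one.
  obtain ⟨N₀, hN₀⟩ := Filter.eventually_atTop.1 (AffineSystem.eventually_error_le t (by omega) hS
    hγ hγ' hC hC' A ℓ₀ Z₀ (by positivity : 0 < ε * (c ^ t * b) / 2))
  refine ⟨N₀, fun N Z hN hZ hZ' Ψ hΨ hs => ?_⟩
  obtain ⟨hR, hℓ, h⟩ := hN₀ N hN
  obtain ⟨hZ₀, hRZ, h1, h2⟩ := h Z hZ hZ'
  have hprod : b ≤ ∏' p, Ψ.localFactor p :=
    ge_of_tendsto' (AffineSystem.tendsto_prod_localFactor hd0 ht hΨ) fun P => hβ Ψ P hΨ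
  refine ⟨AffineSystem.multipliable_localFactor hd0 ht hΨ, hb.trans_le hprod, ?_⟩
  have hZ0 : 0 < Z := (Real.rpow_pos_of_pos (by linarith) _).trans_le hRZ
  refine (hest (N ^ γ) Z Ψ hR hℓ hRZ hΨ).trans ?_
  have h3 := h2 Ψ.exceptionalSum (hexc Z hZ₀ Ψ hΨ.1 hs)
  calc Z ^ d * (C * Real.log (N ^ γ) ^ t * (N ^ γ) ^ (4 * t * S) / Z +
        C * Real.exp (C * (1 + Ψ.exceptionalSum)) / √(Real.log (N ^ γ)))
      ≤ Z ^ d * (ε * (c ^ t * b) / 2 + ε * (c ^ t * b) / 2) := by gcongr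
    _ = ε * (Z ^ d * c ^ t * b) := by ring
    _ ≤ _ := by gcongr
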